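/- **Setting.** Let $T\ge 0$, let $\mathcal M^0=\{1,\dots,\kappa^0\}$, $\mathcal M^1=\{1,\dots,\kappa^1\}$ be finite sets of global and local modes, and consider, for states $X^n_t\in\mathbb R^{d_X^n}$ and actions $U^n_t\in\mathbb R^{d_U^n}$ ($n=0,1$), with $X_t=(X^0_t,X^1_t)$, $U_t=(U^0_t,U^1_t)$, $W_t=(W^0_t,W^1_t)$, $$X_{t+1}=A(M^0_t,M^1_t)X_t+B(M^0_t,M^1_t)U_t+W_t,\quad A=\begin{bmatrix}A^{00}(m^0)&0\\A^{10}(m^{0},m^1)&A^{11}(m^{0},m^1)\end{bmatrix},\quad B=\begin{bmatrix}B^{00}(m^0)&0\\B^{10}(m^{0},m^1)&B^{11}(m^{0},m^1)\end{bmatrix}.$$ The random variables $X_0^n,W_t^n,M_t^n,\Gamma_t$ ($n=0,1$, $0\le t\le T$) are mutually independent; $X_0^n$ has law $\pi_{X_0^n}$ and finite second moment; $W^n_t$ has mean zero and finite second moment; $M_t^n$ has law $\pi_{M^n}$ for all $t$, with $\pi_{M^1}(m)>0$ for all $m\in\mathcal M^1$; $\Gamma_t\in\{0,1\}$ with $\mathbb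 P(\Gamma_t=i)=p(i)$ for all $t$. The channel output is $(Z_t,\tilde Z_t)=(X^1_t,M^1_t)$ if $\Gamma_t=1$ and $(\emptyset,\emptyset)$ if $\Gamma_t=0$. Controller $C^0$ plays $U^0_t=\lambda^0_t(H^0_t)$ with $H^0_t=(X^0_{0:t},M^0_{0:t},Z_{0:t},\tilde Z_{0:t},U^0_{0:t-1})$, controller $C^1$ plays $U^1_t=\lambda^1_t(H^0_t,X^1_t,M^1_t)$, with Borel measurable $\lambda^n_t$. A strategy pair is feasible if all $X^n_t,U^n_t$, $0\le t\le T$, have finite second moments. Problem 1 is to minimize over feasible pairs $$J(\lambda^0,\lambda^1)=\mathbb E\Big[\sum_{t=0}^T X_t^{\top}Q_t(M^0_t,M^1_t)X_t+U_t^{\top}R_t(M^0_t,M^1_t)U_t\Big],$$ where all $Q_t(m^0,m^1)$ are symmetric positive semidefinite and all $R_t(m^0,m^1)$ symmetric positive definite. **Gains.** Let $\tilde{\mathcal M}^1=\mathcal M^1\cup\{\emptyset\}$, $D=[A\ B]$, $D^{11}=[A^{11}\ B^{11}]$, $C_t=\mathrm{diag}(Q_t,R_t)$, $C_t^{11}=\mathrm{diag}(Q_t^{11},R_t^{11})$;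 let $L_m$ be the matrix with $L_m\,(x,u^0,q(1),\dots,q(\kappa^1))=(x,u^0,q(m))$; let $D^{aug}(m^0,m^1)=D(m^0,m^1)L_{m^1}$, $D^\emptyset(m^0)=\sum_{m^1}\pi_{M^1}(m^1)D^{aug}(m^0,m^1)$, $C^\emptyset_t(m^0)=\sum_{m^1}\pi_{M^1}(m^1)L_{m^1}^\top C_t(m^0,m^1)L_{m^1}$. $[\cdot]_{1\bullet}$ denotes the block row of the local state. For families of matrices indexed by $\mathcal M^0\times\tilde{\mathcal M}^1$ put $$\Psi(G^1,G^2)=p(0)\sum_{m^0}\pi_{M^0}(m^0)G^1(m^0,\emptyset)+p(1)\sum_{m^0,m^1}\pi_{M^0}(m^0)\pi_{M^1}(m^1)G^2(m^0,m^1),\qquad \Pi(G)=\Psi(G,G).$$ For a block matrix $G=\begin{bmatrix}G^{11}&G^{12}\\G^{21}&G^{22}\end{bmatrix}$ let $SC(G)=G^{11}-G^{12}(G^{22})^{-1}G^{21}$. Starting from $P_{T+1}=0$, $\tilde P_{T+1}=0$, and writing $\Psi_{t+1}=\Psi(\tilde P_{t+1},P^{11}_{t+1})$ where $P^{11}$ is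 the local-state block of $P$, define backwards, for $t=T,\dots,0$, $$H_t(m^0,\emptyset)=C_t^\emptyset+(D^\emptyset)^\top\Pi(P_{t+1})D^\emptyset+\sum_{m^1}\pi_{M^1}(m^1)[D^{aug}]_{1\bullet}^\top\Psi_{t+1}[D^{aug}]_{1\bullet}-[D^\emptyset]_{1\bullet}^\top\Psi_{t+1}[D^\emptyset]_{1\bullet},$$ $$H_t(m^0,m^1)=C_t+D^\top\Pi(P_{t+1})D,\qquad \tilde H_t(m^0,m^1)=C_t^{11}+(D^{11})^\top\Psi_{t+1}D^{11},$$ $$P_t(m^0,\tilde z)=SC(H_t(m^0,\tilde z)),\quad \tilde P_t(m^0,m^1)=SC(\tilde H_t(m^0,m^1)),\quad \tilde P_t(m^0,\emptyset)=\sum_{m^1}\pi_{M^1}(m^1)SC(\tilde H_t(m^0,m^1)),$$ where $H_t$ is partitioned into state and action blocks ($X$, $U$) and $\tilde H_t$ into local state and local action blocks, and $$K_t(m^0,\tilde z)=-\big(H_t^{UU}(m^0,\tilde z)\big)^{-1}H_t^{UX}(m^0,\tilde z),\qquad \tilde K_t(m^0,m^1)=-\big(\tilde H_t^{U^1U^1}(m^0,m^1)\big)^{-1}\tilde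 H_t^{U^1X^1}(m^0,m^1).$$ **Candidate strategies.** Given $\hat x^1_t$, define $u^{0*}_t,\bar q^*_t,\tilde q^*_t$ as follows. If $\tilde z_t=\emptyset$: $(u^{0*}_t,\bar q^*_t(1),\dots,\bar q^*_t(\kappa^1))=K_t(m^0_t,\emptyset)(x^0_t,\hat x^1_t)$ and $\tilde q^*_t(x^1,m^1)=\tilde K_t(m^0_t,m^1)(x^1-\hat x^1_t)$. If $\tilde z_t=l\in\mathcal M^1$: $(u^{0*}_t,\bar q^*_t(l))=K_t(m^0_t,l)(x^0_t,\hat x^1_t)$, $\bar q^*_t(m^1)=0$ for $m^1\ne l$, and $\tilde q^*_t=0$. The estimate $\hat x^1_t$ is the function of the realized common information $h^0_t$ given recursively by $\hat x^1_0=x^1_0$ if $z_0=x^1_0$, $\hat x^1_0=\int x\,\pi_{X^1_0}(dx)$ if $z_0=\emptyset$, and $$\hat x^1_{t+1}=\begin{cases}x^1_{t+1}&\text{if }z_{t+1}=x^1_{t+1},\\ \sum_{m^1}\pi_{M^1}(m^1)[D(m^0_t,m^1)]_{1\bullet}\,(x^0_t,\hat x^1_t,u^{0*}_t,\bar q^*_t(m^1))&\text{if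 }z_{t+1}=\emptyset,\ \tilde z_t=\emptyset,\\ [D(m^0_t,m^1_t)]_{1\bullet}\,(x^0_t,\hat x^1_t,u^{0*}_t,\bar q^*_t(m^1_t))&\text{if }z_{t+1}=\emptyset,\ \tilde z_t=m^1_t.\end{cases}$$ **Theorem.** The strategy pair in which $C^0$ plays $u^{0*}_t$ and $C^1$ plays $u^{1*}_t=\bar q^*_t(m^1_t)+\tilde q^*_t(x^1_t,m^1_t)$ for $t=0,\dots,T$ is feasible and optimal for Problem 1, i.e. it minimizes $J$ over all feasible strategy pairs. Moreover, under this pair, for every $t\le T$, almost surely, $\hat x^1_t$ is the mean $\mu(\theta_t)$ of the conditional distribution $\theta_t$ of $X^1_t$ given $H^0_t$, that is, $\hat x^1_t=\mathbb E[X^1_t\mid H^0_t]$. -/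

import Mathlib

open MeasureTheory ProbabilityTheory
open scoped Matrix

noncomputable section

namespace NCS

/-- Dimensions of the states and of the control actions of the global plant / controller `0` and
the local plant / controller `1`, and the numbers of global and local modes. -/
structure Dims where
  x0 : ℕ
  x1 : ℕ
  u0 : ℕ
  u1 : ℕ
  κ0 : ℕ
  κ1 : ℕ

namespace Dims

variable (d : Dims)

/-- Global states. -/
abbrev X0 : Type := Fin d.x0 → ℝ
/-- Local states. -/
abbrev X1 : Type := Fin d.x1 → ℝ
/-- Actions of the global controller. -/
abbrev U0 : Type := Fin d.u0 → ℝ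
/-- Actions of the local controller. -/
abbrev U1 : Type := Fin d.u1 → ℝ
/-- Global modes. -/
abbrev M0 : Type := Fin d.κ0
/-- Local modes. -/
abbrev M1 : Type := Fin d.κ1

/-- Index set of the components of `vec(x⁰, x¹)`. -/
abbrev IX : Type := Fin d.x0 ⊕ Fin d.x1
/-- Index set of the components of `vec(u⁰, u¹)`. -/
abbrev IU : Type := Fin d.u0 ⊕ Fin d.u1
/-- Index set of the components of `vec(u⁰, q(1), …, q(κ¹))`. -/
abbrev IQ : Type := Fin d.u0 ⊕ (Fin d.κ1 × Fin d.u1)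

/-- Output of the channel: `Sum.inl a` if `a` is received, `Sum.inr ()` (the symbol `∅`) if the
packet is dropped. -/
abbrev Received (α : Type) : Type := α ⊕ Unit

/-- The common information `(x⁰_{0:t}, m⁰_{0:t}, z_{0:t}, z̃_{0:t}, u⁰_{0:t-1})` at time `t`. -/
abbrev Hist (t : ℕ) : Type :=
  (Fin (t + 1) → d.X0) × (Fin (t + 1) → d.M0) × (Fin (t + 1) → Received d.X1) ×
    (Fin (t + 1) → Received d.M1) × (Fin t → d.U0)

variable {d}

/-- The current global state `x⁰_t`. -/
def Hist.x0 {t : ℕ} (h : d.Hist t) : d.X0 := h.1 (Fin.last t)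
/-- The current global mode `m⁰_t`. -/
def Hist.m0 {t : ℕ} (h : d.Hist t) : d.M0 := h.2.1 (Fin.last t)
/-- The current channel output `z_t`. -/
def Hist.z {t : ℕ} (h : d.Hist t) : Received d.X1 := h.2.2.1 (Fin.last t)
/-- The current channel output `z̃_t`. -/
def Hist.zt {t : ℕ} (h : d.Hist t) : Received d.M1 := h.2.2.2.1 (Fin.last t)

/-- The common information at time `t` contained in that at time `t + 1`. -/
def Hist.past {t : ℕ} (h : d.Hist (t + 1)) : d.Hist t :=
  (fun i => h.1 i.castSucc, fun i => h.2.1 i.castSucc, fun i => h.2.2.1 i.castSucc,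
    fun i => h.2.2.2.1 i.castSucc, fun i => h.2.2.2.2 i.castSucc)

/-- The common information at time `0`. -/
def Hist.start (x : d.X0) (m : d.M0) (z : Received d.X1) (zt : Received d.M1) : d.Hist 0 :=
  (fun _ => x, fun _ => m, fun _ => z, fun _ => zt, Fin.elim0)

/-- The common information at time `t + 1`: that at time `t`, the action `u⁰_t`, and the new
observations. -/
def Hist.extend {t : ℕ} (h : d.Hist t) (u : d.U0) (x : d.X0) (m : d.M0) (z : Received d.X1)
    (zt : Received d.M1) : d.Hist (t + 1) :=
  (Fin.snoc (α := fun _ => d.X0) h.1 x, Fin.snoc (α := fun _ => d.M0) h.2.1 m,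
    Fin.snoc (α := fun _ => Received d.X1) h.2.2.1 z,
    Fin.snoc (α := fun _ => Received d.M1) h.2.2.2.1 zt,
    Fin.snoc (α := fun _ => d.U0) h.2.2.2.2 u)

end Dims

open Dims

/-- The data of the problem: system matrices, cost matrices, and the distributions of the primitive
random variables (the packet goes through iff the link variable is `true`). -/
structure System (d : Dims) where
  A00 : d.M0 → Matrix (Fin d.x0) (Fin d.x0) ℝ
  A10 : d.M0 → d.M1 → Matrix (Fin d.x1) (Fin d.x0) ℝ
  A11 : d.M0 → d.M1 → Matrix (Fin d.x1) (Fin d.x1) ℝ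
  B00 : d.M0 → Matrix (Fin d.x0) (Fin d.u0) ℝ
  B10 : d.M0 → d.M1 → Matrix (Fin d.x1) (Fin d.u0) ℝ
  B11 : d.M0 → d.M1 → Matrix (Fin d.x1) (Fin d.u1) ℝ
  Q : ℕ → d.M0 → d.M1 → Matrix d.IX d.IX ℝ
  R : ℕ → d.M0 → d.M1 → Matrix d.IU d.IU ℝ
  lawX0 : Measure d.X0
  lawX1 : Measure d.X1
  lawW0 : ℕ → Measure d.X0
  lawW1 : ℕ → Measure d.X1
  lawM0 : Measure d.M0
  lawM1 : Measure d.M1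
  lawΓ : Measure Bool

/-- The primitive random variables: initial states, noises, modes and link states. -/
structure Primitives (d : Dims) (Ω : Type*) where
  x0 : Ω → d.X0
  x1 : Ω → d.X1
  w0 : ℕ → Ω → d.X0
  w1 : ℕ → Ω → d.X1
  m0 : ℕ → Ω → d.M0
  m1 : ℕ → Ω → d.M1
  γ : ℕ → Ω → Bool

/-- Indices of the primitive random variables up to the horizon `T`. -/
inductive Src (T : ℕ) : Type
  | x0 : Src T
  | x1 : Src T
  | w0 : Fin (T + 1) → Src T
  | w1 : Fin (T + 1) → Src T
  | m0 : Fin (T + 1) → Src T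
  | m1 : Fin (T + 1) → Src T
  | γ : Fin (T + 1) → Src T

/-- The space in which a primitive random variable takes its values. -/
def Src.Space (d : Dims) {T : ℕ} : Src T → Type
  | .x0 => d.X0
  | .x1 => d.X1
  | .w0 _ => d.X0
  | .w1 _ => d.X1
  | .m0 _ => d.M0
  | .m1 _ => d.M1
  | .γ _ => Bool

instance Src.instMeasurableSpace (d : Dims) {T : ℕ} : ∀ i : Src T, MeasurableSpace (i.Space d)
  | .x0 => inferInstanceAs (MeasurableSpace d.X0)
  | .x1 => inferInstanceAs (MeasurableSpace d.X1)
  | .w0 _ => inferInstanceAs (MeasurableSpace d.X0)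
  | .w1 _ => inferInstanceAs (MeasurableSpace d.X1)
  | .m0 _ => inferInstanceAs (MeasurableSpace d.M0)
  | .m1 _ => inferInstanceAs (MeasurableSpace d.M1)
  | .γ _ => inferInstanceAs (MeasurableSpace Bool)

/-- The primitive random variables as one family. -/
def Primitives.family {d : Dims} {Ω : Type*} (ξ : Primitives d Ω) {T : ℕ} :
    ∀ i : Src T, Ω → i.Space d
  | .x0 => ξ.x0
  | .x1 => ξ.x1
  | .w0 t => ξ.w0 t
  | .w1 t => ξ.w1 t
  | .m0 t => ξ.m0 t
  | .m1 t => ξ.m1 t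
  | .γ t => ξ.γ t

namespace System

variable {d : Dims} (S : System d)

/-- The assumptions on the cost matrices, the noises and the initial states. -/
structure Standing (T : ℕ) : Prop where
  Q_psd : ∀ t ≤ T, ∀ m0 m1, (S.Q t m0 m1).PosSemidef
  R_pd : ∀ t ≤ T, ∀ m0 m1, (S.R t m0 m1).PosDef
  x0_sq : MemLp id 2 S.lawX0
  x1_sq : MemLp id 2 S.lawX1
  w0_sq : ∀ t ≤ T, MemLp id 2 (S.lawW0 t)
  w1_sq : ∀ t ≤ T, MemLp id 2 (S.lawW1 t)
  w0_mean : ∀ t ≤ T, ∫ w, w ∂(S.lawW0 t) = 0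
  w1_mean : ∀ t ≤ T, ∫ w, w ∂(S.lawW1 t) = 0

/-- The primitive random variables have the prescribed distributions and are independent. -/
structure Realizes {Ω : Type*} [MeasurableSpace Ω] (P : Measure Ω) (T : ℕ)
    (ξ : Primitives d Ω) : Prop where
  measurable : ∀ i : Src T, Measurable (ξ.family i)
  indep : iIndepFun (fun i : Src T => ξ.family i) P
  law_x0 : P.map ξ.x0 = S.lawX0
  law_x1 : P.map ξ.x1 = S.lawX1
  law_w0 : ∀ t ≤ T, P.map (ξ.w0 t) = S.lawW0 t
  law_w1 : ∀ t ≤ T, P.map (ξ.w1 t) = S.lawW1 t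
  law_m0 : ∀ t ≤ T, P.map (ξ.m0 t) = S.lawM0
  law_m1 : ∀ t ≤ T, P.map (ξ.m1 t) = S.lawM1
  law_γ : ∀ t ≤ T, P.map (ξ.γ t) = S.lawΓ

/-- The probability of the global mode `m`. -/
def π0 (m : d.M0) : ℝ := S.lawM0.real {m}
/-- The probability of the local mode `m`. -/
def π1 (m : d.M1) : ℝ := S.lawM1.real {m}
/-- The probability of the link state `b`. -/
def p (b : Bool) : ℝ := S.lawΓ.real {b}

/-! ### System matrices -/

/-- `A(m⁰, m¹)`. -/
def A (m0 : d.M0) (m1 : d.M1) : Matrix d.IX d.IX ℝ :=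
  Matrix.fromBlocks (S.A00 m0) 0 (S.A10 m0 m1) (S.A11 m0 m1)

/-- `B(m⁰, m¹)`. -/
def B (m0 : d.M0) (m1 : d.M1) : Matrix d.IX d.IU ℝ :=
  Matrix.fromBlocks (S.B00 m0) 0 (S.B10 m0 m1) (S.B11 m0 m1)

/-- `D = [A B]`. -/
def D (m0 : d.M0) (m1 : d.M1) : Matrix d.IX (d.IX ⊕ d.IU) ℝ :=
  Matrix.fromCols (S.A m0 m1) (S.B m0 m1)

/-- `vec(x⁰, x¹, u⁰, u¹)`. -/
def vec (x0 : d.X0) (x1 : d.X1) (u0 : d.U0) (u1 : d.U1) : d.IX ⊕ d.IU → ℝ :=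
  Sum.elim (Sum.elim x0 x1) (Sum.elim u0 u1)

/-! ### Closed-loop behaviour -/

/-- A strategy of the global controller: `λ⁰_t` acts on the common information. -/
abbrev Strategy0 (d : Dims) : Type := ∀ t : ℕ, d.Hist t → d.U0

/-- A strategy of the local controller: `λ¹_t` acts on the common information and on the current
local state and mode. -/
abbrev Strategy1 (d : Dims) : Type := ∀ t : ℕ, d.Hist t × d.X1 × d.M1 → d.U1

section ClosedLoop

variable {Ω : Type*} (ξ : Primitives d Ω) (l0 : Strategy0 d) (l1 : Strategy1 d)

/-- The channel: its input is received iff the link state is `true`. -/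
def channel {α : Type} (b : Bool) (a : α) : Received α := if b then Sum.inl a else Sum.inr ()

/-- The common information `H⁰_t` and the local state `X¹_t` under the strategies `l0`, `l1`. -/
def run (ω : Ω) : ∀ t : ℕ, d.Hist t × d.X1
  | 0 => (Hist.start (ξ.x0 ω) (ξ.m0 0 ω) (channel (ξ.γ 0 ω) (ξ.x1 ω))
      (channel (ξ.γ 0 ω) (ξ.m1 0 ω)), ξ.x1 ω)
  | t + 1 =>
    let h := (run ω t).1
    let x1 := (run ω t).2
    let m1 := ξ.m1 t ω
    let u0 := l0 t h
    let u1 := l1 t (h, x1, m1)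
    let next : d.IX → ℝ :=
      S.A h.m0 m1 *ᵥ Sum.elim h.x0 x1 + S.B h.m0 m1 *ᵥ Sum.elim u0 u1
        + Sum.elim (ξ.w0 t ω) (ξ.w1 t ω)
    let y0 : d.X0 := fun i => next (Sum.inl i)
    let y1 : d.X1 := fun i => next (Sum.inr i)
    (h.extend u0 y0 (ξ.m0 (t + 1) ω) (channel (ξ.γ (t + 1) ω) y1)
      (channel (ξ.γ (t + 1) ω) (ξ.m1 (t + 1) ω)), y1)

/-- The common information `H⁰_t`. -/
def hist (t : ℕ) (ω : Ω) : d.Hist t := (S.run ξ l0 l1 ω t).1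
/-- The global state `X⁰_t`. -/
def state0 (t : ℕ) (ω : Ω) : d.X0 := (S.hist ξ l0 l1 t ω).x0
/-- The local state `X¹_t`. -/
def state1 (t : ℕ) (ω : Ω) : d.X1 := (S.run ξ l0 l1 ω t).2
/-- The action `U⁰_t`. -/
def action0 (t : ℕ) (ω : Ω) : d.U0 := l0 t (S.hist ξ l0 l1 t ω)
/-- The action `U¹_t`. -/
def action1 (t : ℕ) (ω : Ω) : d.U1 :=
  l1 t (S.hist ξ l0 l1 t ω, S.state1 ξ l0 l1 t ω, ξ.m1 t ω)

/-- The instantaneous cost `xᵀ Q_t x + uᵀ R_t u`. -/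
def cost (t : ℕ) (x0 : d.X0) (x1 : d.X1) (m0 : d.M0) (m1 : d.M1) (u0 : d.U0) (u1 : d.U1) : ℝ :=
  Sum.elim x0 x1 ⬝ᵥ (S.Q t m0 m1 *ᵥ Sum.elim x0 x1) +
    Sum.elim u0 u1 ⬝ᵥ (S.R t m0 m1 *ᵥ Sum.elim u0 u1)

variable [MeasurableSpace Ω] (P : Measure Ω) (T : ℕ)

/-- The total expected cost `J(λ⁰, λ¹)`. -/
def J : ℝ :=
  ∫ ω, ∑ t ∈ Finset.range (T + 1),
    S.cost t (S.state0 ξ l0 l1 t ω) (S.state1 ξ l0 l1 t ω) (ξ.m0 t ω) (ξ.m1 t ω)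
      (S.action0 ξ l0 l1 t ω) (S.action1 ξ l0 l1 t ω) ∂P

/-- Borel measurable strategies under which all states and actions have finite second moments. -/
structure Feasible : Prop where
  measurable0 : ∀ t ≤ T, Measurable (l0 t)
  measurable1 : ∀ t ≤ T, Measurable (l1 t)
  state0_sq : ∀ t ≤ T, MemLp (S.state0 ξ l0 l1 t) 2 P
  state1_sq : ∀ t ≤ T, MemLp (S.state1 ξ l0 l1 t) 2 P
  action0_sq : ∀ t ≤ T, MemLp (S.action0 ξ l0 l1 t) 2 P
  action1_sq : ∀ t ≤ T, MemLp (S.action1 ξ l0 l1 t) 2 P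

/-- `(l0, l1)` solves the decentralized control problem. -/
def IsOptimal : Prop :=
  S.Feasible ξ l0 l1 P T ∧
    ∀ (k0 : Strategy0 d) (k1 : Strategy1 d), S.Feasible ξ k0 k1 P T →
      S.J ξ l0 l1 P T ≤ S.J ξ k0 k1 P T

end ClosedLoop

/-! ### Operators, recursions and gains -/

/-- `Π(G)`: the mean of `G(M⁰, Z̃)`. -/
def PiOp {ι : Type} (G : d.M0 → Received d.M1 → Matrix ι ι ℝ) : Matrix ι ι ℝ :=
  S.p false • (∑ m0, S.π0 m0 • G m0 (Sum.inr ())) +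
    S.p true • (∑ m0, ∑ m1, (S.π0 m0 * S.π1 m1) • G m0 (Sum.inl m1))

/-- `Ψ(G¹, G²) = p(0) Π(G¹, 0) + p(1) Π(G², 1)`. -/
def PsiOp {ι : Type} (G1 G2 : d.M0 → Received d.M1 → Matrix ι ι ℝ) : Matrix ι ι ℝ :=
  S.p false • (∑ m0, S.π0 m0 • G1 m0 (Sum.inr ())) +
    S.p true • (∑ m0, ∑ m1, (S.π0 m0 * S.π1 m1) • G2 m0 (Sum.inl m1))

/-- The Schur complement of the lower right block. -/
def SC {ι κ : Type} [Fintype κ] [DecidableEq κ] (G : Matrix (ι ⊕ κ) (ι ⊕ κ) ℝ) : Matrix ι ι ℝ :=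
  G.toBlocks₁₁ - G.toBlocks₁₂ * G.toBlocks₂₂⁻¹ * G.toBlocks₂₁

/-- `-(G²²)⁻¹ G²¹`. -/
def gain {ι κ : Type} [Fintype κ] [DecidableEq κ] (G : Matrix (ι ⊕ κ) (ι ⊕ κ) ℝ) :
    Matrix κ ι ℝ :=
  -(G.toBlocks₂₂⁻¹ * G.toBlocks₂₁)

/-- `L_m`: maps `vec(x, u⁰, q(1), …, q(κ¹))` to `vec(x, u⁰, q(m))`. -/
def L (m : d.M1) : Matrix (d.IX ⊕ d.IU) (d.IX ⊕ d.IQ) ℝ :=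
  Matrix.fromBlocks 1 0 0
    (Matrix.fromBlocks 1 0 0 (Matrix.of fun i j => if j.1 = m ∧ j.2 = i then 1 else 0))

/-- `D¹¹ = [A¹¹ B¹¹]`. -/
def D11 (m0 : d.M0) (m1 : d.M1) : Matrix (Fin d.x1) (Fin d.x1 ⊕ Fin d.u1) ℝ :=
  Matrix.fromCols (S.A11 m0 m1) (S.B11 m0 m1)

/-- `D^aug`. -/
def Daug (m0 : d.M0) (m1 : d.M1) : Matrix d.IX (d.IX ⊕ d.IQ) ℝ := S.D m0 m1 * L m1

/-- `D^∅`. -/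
def Dempty (m0 : d.M0) : Matrix d.IX (d.IX ⊕ d.IQ) ℝ := ∑ m1, S.π1 m1 • S.Daug m0 m1

/-- `C_t`. -/
def C (t : ℕ) (m0 : d.M0) (m1 : d.M1) : Matrix (d.IX ⊕ d.IU) (d.IX ⊕ d.IU) ℝ :=
  Matrix.fromBlocks (S.Q t m0 m1) 0 0 (S.R t m0 m1)

/-- `C_t^∅`. -/
def Cempty (t : ℕ) (m0 : d.M0) : Matrix (d.IX ⊕ d.IQ) (d.IX ⊕ d.IQ) ℝ :=
  ∑ m1, S.π1 m1 • ((L m1)ᵀ * S.C t m0 m1 * L m1)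

/-- `C_t¹¹`. -/
def C11 (t : ℕ) (m0 : d.M0) (m1 : d.M1) :
    Matrix (Fin d.x1 ⊕ Fin d.u1) (Fin d.x1 ⊕ Fin d.u1) ℝ :=
  Matrix.fromBlocks (S.Q t m0 m1).toBlocks₂₂ 0 0 (S.R t m0 m1).toBlocks₂₂

/-- The matrices `P` indexed by `m⁰` and `z̃`. -/
abbrev PFam (d : Dims) : Type := d.M0 → Received d.M1 → Matrix d.IX d.IX ℝ
/-- The matrices `P̃` indexed by `m⁰` and `z̃`. -/
abbrev PtFam (d : Dims) : Type := d.M0 → Received d.M1 → Matrix (Fin d.x1) (Fin d.x1) ℝ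

section Step

/-! In this section `G`, `Gt` stand for `P_{t+1}`, `P̃_{t+1}`. -/

variable (t : ℕ) (G : PFam d) (Gt : PtFam d)

/-- `Ψ(P̃_{t+1}, P_{t+1}¹¹)`. -/
def Psi11 : Matrix (Fin d.x1) (Fin d.x1) ℝ := S.PsiOp Gt (fun m0 z => (G m0 z).toBlocks₂₂)

/-- `E_t^∅`. -/
def Eempty (m0 : d.M0) : Matrix (d.IX ⊕ d.IQ) (d.IX ⊕ d.IQ) ℝ :=
  (S.Dempty m0)ᵀ * S.PiOp G * S.Dempty m0

/-- `F_t^∅`. -/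
def Fempty (m0 : d.M0) : Matrix (d.IX ⊕ d.IQ) (d.IX ⊕ d.IQ) ℝ :=
  (∑ m1, S.π1 m1 • ((S.Daug m0 m1).toRows₂ᵀ * S.Psi11 G Gt * (S.Daug m0 m1).toRows₂)) -
    (S.Dempty m0).toRows₂ᵀ * S.Psi11 G Gt * (S.Dempty m0).toRows₂

/-- `H_t(m⁰, ∅)`. -/
def Hempty (m0 : d.M0) : Matrix (d.IX ⊕ d.IQ) (d.IX ⊕ d.IQ) ℝ :=
  S.Cempty t m0 + S.Eempty G m0 + S.Fempty G Gt m0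

/-- `H_t(m⁰, m¹)`. -/
def Hmode (m0 : d.M0) (m1 : d.M1) : Matrix (d.IX ⊕ d.IU) (d.IX ⊕ d.IU) ℝ :=
  S.C t m0 m1 + (S.D m0 m1)ᵀ * S.PiOp G * S.D m0 m1

/-- `H̃_t(m⁰, m¹)`. -/
def Htilde (m0 : d.M0) (m1 : d.M1) :
    Matrix (Fin d.x1 ⊕ Fin d.u1) (Fin d.x1 ⊕ Fin d.u1) ℝ :=
  S.C11 t m0 m1 + (S.D11 m0 m1)ᵀ * S.Psi11 G Gt * S.D11 m0 m1

/-- `P_t`. -/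
def stepP : PFam d
  | m0, Sum.inr _ => SC (S.Hempty t G Gt m0)
  | m0, Sum.inl m1 => SC (S.Hmode t G m0 m1)

/-- `P̃_t`. -/
def stepPt : PtFam d
  | m0, Sum.inr _ => ∑ m1, S.π1 m1 • SC (S.Htilde t G Gt m0 m1)
  | m0, Sum.inl m1 => SC (S.Htilde t G Gt m0 m1)

end Step

variable (T : ℕ)

/-- `(P_t, P̃_t)` with `t = T + 1 - k`, by backward recursion from `(P_{T+1}, P̃_{T+1}) = 0`. -/
def riccati : ℕ → PFam d × PtFam d
  | 0 => (0, 0)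
  | k + 1 => (S.stepP (T - k) (riccati k).1 (riccati k).2,
      S.stepPt (T - k) (riccati k).1 (riccati k).2)

/-- `P_t`. -/
def Pmat (t : ℕ) : PFam d := (S.riccati T (T + 1 - t)).1
/-- `P̃_t`. -/
def Ptmat (t : ℕ) : PtFam d := (S.riccati T (T + 1 - t)).2

/-- `K_t(m⁰, ∅)`. -/
def Kempty (t : ℕ) (m0 : d.M0) : Matrix d.IQ d.IX ℝ :=
  gain (S.Hempty t (S.Pmat T (t + 1)) (S.Ptmat T (t + 1)) m0)

/-- `K_t(m⁰, m¹)`. -/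
def Kmode (t : ℕ) (m0 : d.M0) (m1 : d.M1) : Matrix d.IU d.IX ℝ :=
  gain (S.Hmode t (S.Pmat T (t + 1)) m0 m1)

/-- `K̃_t(m⁰, m¹)`. -/
def Ktilde (t : ℕ) (m0 : d.M0) (m1 : d.M1) : Matrix (Fin d.u1) (Fin d.x1) ℝ :=
  gain (S.Htilde t (S.Pmat T (t + 1)) (S.Ptmat T (t + 1)) m0 m1)

/-! ### The optimal strategies -/

/-- `u⁰*_t` as a function of `m⁰_t, z̃_t, x⁰_t` and the estimate `x̂¹_t`. -/
def uStar (t : ℕ) (m0 : d.M0) (zt : Received d.M1) (x0 : d.X0) (xh : d.X1) : d.U0 :=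
  match zt with
  | Sum.inr _ => fun i => (S.Kempty T t m0 *ᵥ Sum.elim x0 xh) (Sum.inl i)
  | Sum.inl l => fun i => (S.Kmode T t m0 l *ᵥ Sum.elim x0 xh) (Sum.inl i)

/-- `q̄*_t(m¹)`. -/
def qbar (t : ℕ) (m0 : d.M0) (zt : Received d.M1) (x0 : d.X0) (xh : d.X1) (m1 : d.M1) : d.U1 :=
  match zt with
  | Sum.inr _ => fun i => (S.Kempty T t m0 *ᵥ Sum.elim x0 xh) (Sum.inr (m1, i))
  | Sum.inl l =>
    if m1 = l then fun i => (S.Kmode T t m0 l *ᵥ Sum.elim x0 xh) (Sum.inr i) else 0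

/-- `q̃*_t(x¹, m¹)`. -/
def qtilde (t : ℕ) (m0 : d.M0) (zt : Received d.M1) (xh : d.X1) (x1 : d.X1) (m1 : d.M1) : d.U1 :=
  match zt with
  | Sum.inr _ => S.Ktilde T t m0 m1 *ᵥ (x1 - xh)
  | Sum.inl _ => 0

/-- `[D(m⁰, m¹)]_{1•} vec(x⁰_t, x̂¹_t, u⁰*_t, q̄*_t(m¹))`. -/
def propagate (t : ℕ) (m0 : d.M0) (zt : Received d.M1) (x0 : d.X0) (xh : d.X1) (m1 : d.M1) :
    d.X1 :=
  (S.D m0 m1).toRows₂ *ᵥ vec x0 xh (S.uStar T t m0 zt x0 xh) (S.qbar T t m0 zt x0 xh m1)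

/-- The recursive estimate `x̂¹_t` as a function of the common information. -/
def xhat : ∀ t : ℕ, d.Hist t → d.X1
  | 0, h =>
    match h.z with
    | Sum.inl x => x
    | Sum.inr _ => ∫ x, x ∂S.lawX1
  | t + 1, h =>
    match h.z with
    | Sum.inl x => x
    | Sum.inr _ =>
      let g := h.past
      match g.zt with
      | Sum.inr _ => ∑ m1, S.π1 m1 • S.propagate T t g.m0 g.zt g.x0 (xhat t g) m1
      | Sum.inl l => S.propagate T t g.m0 g.zt g.x0 (xhat t g) l

/-- The strategy of the global controller: `u⁰*_t`. -/
def optStrategy0 : Strategy0 d := fun t h => S.uStar T t h.m0 h.zt h.x0 (S.xhat T t h)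

/-- The strategy of the local controller: `q̄*_t(m¹_t) + q̃*_t(x¹_t, m¹_t)`. -/
def optStrategy1 : Strategy1 d := fun t i =>
  S.qbar T t i.1.m0 i.1.zt i.1.x0 (S.xhat T t i.1) i.2.2 +
    S.qtilde T t i.1.m0 i.1.zt (S.xhat T t i.1) i.2.1 i.2.2

/-- The common belief `θ_t`: the conditional distribution of `X¹_t` given `H⁰_t = h`. -/
def belief {Ω : Type*} [MeasurableSpace Ω] (P : Measure Ω) [IsFiniteMeasure P]
    (ξ : Primitives d Ω) (l0 : Strategy0 d) (l1 : Strategy1 d) (t : ℕ) (h : d.Hist t) :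
    Measure d.X1 :=
  condDistrib (S.state1 ξ l0 l1 t) (S.hist ξ l0 l1 t) P h

end System

end NCS

end

/- Fix a strategy pair and let `b t h m` be the conditional mean of `U¹_t` given `H⁰_t = h` and
`M¹_t = m`. Conditionally on `H⁰_t`, the noise `W_t` has mean zero and a local mode that the channel
dropped still has its law, so the conditional mean of `X¹_t` given `H⁰_t` satisfies the recursion
for `x̂¹` with `b` in the role of `q̄*`. By Pythagoras, the expected cost-to-go splits into a
quadratic form in these conditional means, governed by `P_t`, and one in the deviations from them,
governed by `P̃_t`. Completing the square in the actions shows that the expected stage cost plus the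
value at time `t + 1` is at least the value at time `t` plus the contribution of the noises, with
equality when the means of the actions are given by `K_t` and their deviations by `K̃_t`. Summing
over `t`, the cost of every feasible pair is at least the value at time `0` plus the contributions
of all noises, and the candidate pair attains this bound. -/

noncomputable section

namespace NCS

open Dims

/-! ### Quadratic forms and Schur complements -/

section QuadForm

variable {R ι κ α : Type*} [CommRing R] [Fintype ι] [Fintype κ]

/-- The quadratic form `x ↦ xᵀ A x` of a matrix that need not be symmetric, in which all stage costs
and cost-to-go functions are expressed. -/
def quadForm (A : Matrix ι ι R) (x : ι → R) : R := x ⬝ᵥ (A *ᵥ x)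

lemma quadForm_add (A B : Matrix ι ι R) (x : ι → R) :
    quadForm (A + B) x = quadForm A x + quadForm B x := by
  simp only [quadForm, Matrix.add_mulVec, dotProduct_add]

lemma quadForm_sub (A B : Matrix ι ι R) (x : ι → R) :
    quadForm (A - B) x = quadForm A x - quadForm B x := by
  simp only [quadForm, Matrix.sub_mulVec, dotProduct_sub]

lemma quadForm_smul (c : R) (A : Matrix ι ι R) (x : ι → R) :
    quadForm (c • A) x = c * quadForm A x := by
  simp only [quadForm, Matrix.smul_mulVec, dotProduct_smul, smul_eq_mul]

lemma quadForm_sum (s : Finset α) (A : α → Matrix ι ι R) (x : ι → R) :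
    quadForm (∑ a ∈ s, A a) x = ∑ a ∈ s, quadForm (A a) x := by
  simp only [quadForm, Matrix.sum_mulVec, dotProduct_sum]

lemma quadForm_zero (A : Matrix ι ι R) : quadForm A 0 = 0 := by
  simp only [quadForm, zero_dotProduct]

lemma quadForm_transpose_mul_mul (A : Matrix ι ι R) (B : Matrix ι κ R) (x : κ → R) :
    quadForm (Bᵀ * A * B) x = quadForm A (B *ᵥ x) := by
  simp only [quadForm, ← Matrix.mulVec_mulVec, Matrix.dotProduct_mulVec, Matrix.vecMul_transpose]

lemma quadForm_add_vec (A : Matrix ι ι R) (x y : ι → R) :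
    quadForm A (x + y) = quadForm A x + quadForm A y + ((Aᵀ + A) *ᵥ x) ⬝ᵥ y := by
  simp only [quadForm, Matrix.mulVec_add, Matrix.add_mulVec, dotProduct_add, add_dotProduct,
    Matrix.dotProduct_mulVec, Matrix.mulVec_transpose, Matrix.add_vecMul,
    dotProduct_comm (A *ᵥ x) y]
  ring

lemma quadForm_fromBlocks_diag (A : Matrix ι ι R) (B : Matrix κ κ R) (x : ι → R) (y : κ → R) :
    quadForm (Matrix.fromBlocks A 0 0 B) (Sum.elim x y) = quadForm A x + quadForm B y := by
  simp [quadForm, Matrix.fromBlocks_mulVec, sumElim_dotProduct_sumElim]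

lemma quadForm_sumElim_zero_left (H : Matrix (ι ⊕ κ) (ι ⊕ κ) R) (y : κ → R) :
    quadForm H (Sum.elim 0 y) = quadForm H.toBlocks₂₂ y := by
  rw [← Matrix.fromBlocks_toBlocks H]
  simp [quadForm, Matrix.fromBlocks_mulVec, sumElim_dotProduct_sumElim]

lemma sum_mul_quadForm_sub_mean [Fintype α] {w : α → R} (hw : ∑ a, w a = 1)
    (A : Matrix ι ι R) (y : α → ι → R) :
    ∑ a, w a * quadForm A (y a - ∑ b, w b • y b) =
      ∑ a, w a * quadForm A (y a) - quadForm A (∑ a, w a • y a) := by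
  set z := ∑ b, w b • y b with hz
  have expand (a : α) : w a * quadForm A (y a - z) =
      w a * quadForm A (y a) - (w a • y a) ⬝ᵥ (A *ᵥ z) - z ⬝ᵥ (A *ᵥ (w a • y a)) +
        w a * quadForm A z := by
    simp only [quadForm, Matrix.mulVec_sub, dotProduct_sub, sub_dotProduct, Matrix.mulVec_smul,
      dotProduct_smul, smul_dotProduct, smul_eq_mul]
    ring
  simp only [expand, Finset.sum_add_distrib, Finset.sum_sub_distrib, ← sum_dotProduct,
    ← dotProduct_sum, ← Matrix.mulVec_sum, ← Finset.sum_mul, hw, ← hz]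
  simp only [quadForm]
  ring

end QuadForm

section Positivity

variable {ι κ : Type*}

lemma posSemidef_toBlocks₂₂ {H : Matrix (ι ⊕ κ) (ι ⊕ κ) ℝ} (hH : H.PosSemidef) :
    H.toBlocks₂₂.PosSemidef := hH.submatrix Sum.inr

lemma posDef_toBlocks₂₂ {H : Matrix (ι ⊕ κ) (ι ⊕ κ) ℝ} (hH : H.PosDef) :
    H.toBlocks₂₂.PosDef := hH.submatrix Sum.inr_injective

lemma posSemidef_iff_quadForm [Fintype ι] {A : Matrix ι ι ℝ} :
    A.PosSemidef ↔ A.IsHermitian ∧ ∀ x, 0 ≤ quadForm A x := by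
  simp [Matrix.posSemidef_iff_dotProduct_mulVec, quadForm]

lemma posDef_iff_quadForm [Fintype ι] {A : Matrix ι ι ℝ} :
    A.PosDef ↔ A.IsHermitian ∧ ∀ x, x ≠ 0 → 0 < quadForm A x := by
  simp [Matrix.posDef_iff_dotProduct_mulVec, quadForm]

lemma quadForm_nonneg [Fintype ι] {A : Matrix ι ι ℝ} (hA : A.PosSemidef) (x : ι → ℝ) :
    0 ≤ quadForm A x :=
  (posSemidef_iff_quadForm.1 hA).2 x

lemma posSemidef_transpose_mul_mul [Fintype ι] [Finite κ] {A : Matrix ι ι ℝ} (hA : A.PosSemidef)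
    (B : Matrix ι κ ℝ) : (Bᵀ * A * B).PosSemidef := by
  simpa using hA.conjTranspose_mul_mul_same B

lemma posSemidef_fromBlocks_diag [Finite ι] [Finite κ] {A : Matrix ι ι ℝ} {B : Matrix κ κ ℝ}
    (hA : A.PosSemidef) (hB : B.PosSemidef) : (Matrix.fromBlocks A 0 0 B).PosSemidef := by
  cases nonempty_fintype ι
  cases nonempty_fintype κ
  refine posSemidef_iff_quadForm.2 ⟨.fromBlocks hA.1 (by simp) hB.1, fun x => ?_⟩
  rw [← Sum.elim_comp_inl_inr x, quadForm_fromBlocks_diag]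
  exact add_nonneg (quadForm_nonneg hA _) (quadForm_nonneg hB _)

end Positivity

/-- A positive semidefinite matrix, split into a state block and an action block, whose action block
is positive definite. Minimizing `quadForm H (x, v)` over the action `v` is then a strictly convex
problem, solved by `v = gain H *ᵥ x` with value `quadForm (SC H) x`. -/
structure ActionDefinite {ι κ : Type*} (H : Matrix (ι ⊕ κ) (ι ⊕ κ) ℝ) : Prop where
  posSemidef : H.PosSemidef
  posDef : H.toBlocks₂₂.PosDef

namespace ActionDefinite

section Blocks

variable {ι κ : Type*} {H G : Matrix (ι ⊕ κ) (ι ⊕ κ) ℝ}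

lemma add_posSemidef (hH : ActionDefinite H) (hG : G.PosSemidef) : ActionDefinite (H + G) :=
  ⟨hH.posSemidef.add hG, hH.posDef.add_posSemidef (posSemidef_toBlocks₂₂ hG)⟩

lemma fromBlocks_diag [Finite ι] [Finite κ] {Q : Matrix ι ι ℝ} {R : Matrix κ κ ℝ}
    (hQ : Q.PosSemidef) (hR : R.PosDef) : ActionDefinite (Matrix.fromBlocks Q 0 0 R) :=
  ⟨posSemidef_fromBlocks_diag hQ hR.posSemidef, hR⟩

lemma toBlocks₂₁_eq (hH : ActionDefinite H) : H.toBlocks₂₁ = H.toBlocks₁₂ᴴ := by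
  ext i j
  exact (hH.posSemidef.1.apply (Sum.inr i) (Sum.inl j)).symm

end Blocks

open NCS.System (SC gain)

variable {ι κ : Type} [Fintype κ] [DecidableEq κ] {H : Matrix (ι ⊕ κ) (ι ⊕ κ) ℝ}

lemma SC_posSemidef [Finite ι] (hH : ActionDefinite H) : (SC H).PosSemidef := by
  have := Fintype.ofFinite ι
  let _ := hH.posDef.isUnit.invertible
  have h := Matrix.PosDef.fromBlocks₂₂ H.toBlocks₁₁ H.toBlocks₁₂ hH.posDef
  rw [← hH.toBlocks₂₁_eq, Matrix.fromBlocks_toBlocks] at h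
  exact h.1 hH.posSemidef

variable [Fintype ι]

lemma quadForm_eq_SC_add (hH : ActionDefinite H) (x : ι → ℝ) (v : κ → ℝ) :
    quadForm H (Sum.elim x v) =
      quadForm (SC H) x + quadForm H.toBlocks₂₂ (v - gain H *ᵥ x) := by
  let _ := hH.posDef.isUnit.invertible
  have h := Matrix.schur_complement_eq₂₂ H.toBlocks₁₁ H.toBlocks₁₂ x v hH.posDef.1
  rw [← hH.toBlocks₂₁_eq, Matrix.fromBlocks_toBlocks] at h
  simp only [star_trivial, ← Matrix.dotProduct_mulVec] at h
  rw [quadForm, h, quadForm, quadForm, SC, gain, Matrix.neg_mulVec, sub_neg_eq_add, add_comm v,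
    add_comm]

lemma quadForm_SC_le (hH : ActionDefinite H) (x : ι → ℝ) (v : κ → ℝ) :
    quadForm (SC H) x ≤ quadForm H (Sum.elim x v) := by
  rw [hH.quadForm_eq_SC_add]
  exact le_add_of_nonneg_right (quadForm_nonneg hH.posDef.posSemidef _)

lemma quadForm_gain (hH : ActionDefinite H) (x : ι → ℝ) :
    quadForm H (Sum.elim x (gain H *ᵥ x)) = quadForm (SC H) x := by
  rw [hH.quadForm_eq_SC_add, sub_self, quadForm_zero, add_zero]

end ActionDefinite

namespace System

variable {d : Dims} (S : System d)

/-- The vector `vec(x, u⁰, q(1), …, q(κ¹))` on which `H_t(m⁰, ∅)` acts: when the local mode is not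
received, the common information prescribes an action `q(m¹)` for every local mode. -/
def aug (x : d.IX → ℝ) (u : d.U0) (q : d.M1 → d.U1) : d.IX ⊕ d.IQ → ℝ :=
  Sum.elim x (Sum.elim u fun j => q j.1 j.2)

lemma L_mulVec_aug (m : d.M1) (x : d.IX → ℝ) (u : d.U0) (q : d.M1 → d.U1) :
    L m *ᵥ aug x u q = Sum.elim x (Sum.elim u (q m)) := by
  have select : (Matrix.of fun (i : Fin d.u1) (j : Fin d.κ1 × Fin d.u1) =>
      if j.1 = m ∧ j.2 = i then (1 : ℝ) else 0) *ᵥ (fun j => q j.1 j.2) = q m := by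
    ext i
    simp [Matrix.mulVec, dotProduct, Fintype.sum_prod_type, ite_and]
  simp [L, aug, Matrix.fromBlocks_mulVec, select]

lemma Dempty_mulVec (m0 : d.M0) (a : d.IX ⊕ d.IQ → ℝ) :
    S.Dempty m0 *ᵥ a = ∑ m, S.π1 m • (S.D m0 m *ᵥ (L m *ᵥ a)) := by
  simp only [Dempty, Daug, Matrix.sum_mulVec, Matrix.smul_mulVec, Matrix.mulVec_mulVec]

lemma quadForm_Fempty (hπ : ∑ m, S.π1 m = 1) (G : PFam d) (Gt : PtFam d) (m0 : d.M0)
    (a : d.IX ⊕ d.IQ → ℝ) :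
    quadForm (S.Fempty G Gt m0) a = ∑ m, S.π1 m * quadForm (S.Psi11 G Gt)
      ((S.D m0 m *ᵥ (L m *ᵥ a)) ∘ Sum.inr -
        (∑ m', S.π1 m' • (S.D m0 m' *ᵥ (L m' *ᵥ a))) ∘ Sum.inr) := by
  have toRows₂_mulVec {κ : Type} [Fintype κ] (M : Matrix d.IX κ ℝ) (x : κ → ℝ) :
      M.toRows₂ *ᵥ x = (M *ᵥ x) ∘ Sum.inr := rfl
  have sum_comp_inr : (∑ m', S.π1 m' • (S.D m0 m' *ᵥ (L m' *ᵥ a))) ∘ Sum.inr =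
      ∑ m', S.π1 m' • ((S.D m0 m' *ᵥ (L m' *ᵥ a)) ∘ Sum.inr : d.X1) := by
    ext i
    simp
  rw [sum_comp_inr, sum_mul_quadForm_sub_mean hπ, Fempty, quadForm_sub, quadForm_sum]
  simp only [quadForm_smul, quadForm_transpose_mul_mul, toRows₂_mulVec, Dempty_mulVec,
    sum_comp_inr, Daug, ← Matrix.mulVec_mulVec]

lemma quadForm_Hempty (hπ : ∑ m, S.π1 m = 1) (t : ℕ) (G : PFam d) (Gt : PtFam d) (m0 : d.M0)
    (a : d.IX ⊕ d.IQ → ℝ) :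
    quadForm (S.Hempty t G Gt m0) a = ∑ m, S.π1 m * (quadForm (S.C t m0 m) (L m *ᵥ a) +
      quadForm (S.PiOp G) (∑ m', S.π1 m' • (S.D m0 m' *ᵥ (L m' *ᵥ a))) +
      quadForm (S.Psi11 G Gt) ((S.D m0 m *ᵥ (L m *ᵥ a)) ∘ Sum.inr -
        (∑ m', S.π1 m' • (S.D m0 m' *ᵥ (L m' *ᵥ a))) ∘ Sum.inr)) := by
  simp only [Hempty, quadForm_add, S.quadForm_Fempty hπ, mul_add, Finset.sum_add_distrib, Eempty,
    quadForm_transpose_mul_mul, Dempty_mulVec, Cempty, quadForm_sum, quadForm_smul]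
  rw [← Finset.sum_mul, hπ, one_mul]

lemma quadForm_Hmode (t : ℕ) (G : PFam d) (m0 : d.M0) (m1 : d.M1) (z : d.IX ⊕ d.IU → ℝ) :
    quadForm (S.Hmode t G m0 m1) z =
      quadForm (S.C t m0 m1) z + quadForm (S.PiOp G) (S.D m0 m1 *ᵥ z) := by
  rw [Hmode, quadForm_add, quadForm_transpose_mul_mul]

lemma quadForm_Htilde (t : ℕ) (G : PFam d) (Gt : PtFam d) (m0 : d.M0) (m1 : d.M1)
    (z : Fin d.x1 ⊕ Fin d.u1 → ℝ) :
    quadForm (S.Htilde t G Gt m0 m1) z =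
      quadForm (S.C11 t m0 m1) z + quadForm (S.Psi11 G Gt) (S.D11 m0 m1 *ᵥ z) := by
  rw [Htilde, quadForm_add, quadForm_transpose_mul_mul]

lemma π0_nonneg (m : d.M0) : 0 ≤ S.π0 m := measureReal_nonneg
lemma π1_nonneg (m : d.M1) : 0 ≤ S.π1 m := measureReal_nonneg
lemma p_nonneg (b : Bool) : 0 ≤ S.p b := measureReal_nonneg

variable {S} {T t : ℕ} {G : PFam d} {Gt : PtFam d}

lemma PsiOp_posSemidef {ι : Type} {G1 G2 : d.M0 → Received d.M1 → Matrix ι ι ℝ}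
    (h1 : ∀ m0 z, (G1 m0 z).PosSemidef) (h2 : ∀ m0 z, (G2 m0 z).PosSemidef) :
    (S.PsiOp G1 G2).PosSemidef := by
  refine .add (.smul ?_ (S.p_nonneg _)) (.smul ?_ (S.p_nonneg _))
  · exact Matrix.posSemidef_sum _ fun m0 _ => (h1 m0 _).smul (S.π0_nonneg m0)
  · exact Matrix.posSemidef_sum _ fun m0 _ => Matrix.posSemidef_sum _ fun m1 _ =>
      (h2 m0 _).smul (mul_nonneg (S.π0_nonneg m0) (S.π1_nonneg m1))

lemma PiOp_posSemidef (hG : ∀ m0 z, (G m0 z).PosSemidef) : (S.PiOp G).PosSemidef :=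
  PsiOp_posSemidef hG hG

lemma Psi11_posSemidef (hG : ∀ m0 z, (G m0 z).PosSemidef) (hGt : ∀ m0 z, (Gt m0 z).PosSemidef) :
    (S.Psi11 G Gt).PosSemidef :=
  PsiOp_posSemidef hGt fun m0 z => posSemidef_toBlocks₂₂ (hG m0 z)

lemma actionDefinite_Hmode (hS : S.Standing T) (ht : t ≤ T) (hG : ∀ m0 z, (G m0 z).PosSemidef)
    (m0 : d.M0) (m1 : d.M1) : ActionDefinite (S.Hmode t G m0 m1) :=
  (ActionDefinite.fromBlocks_diag (hS.Q_psd t ht m0 m1) (hS.R_pd t ht m0 m1)).add_posSemidef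
    (posSemidef_transpose_mul_mul (PiOp_posSemidef hG) _)

lemma actionDefinite_Htilde (hS : S.Standing T) (ht : t ≤ T) (hG : ∀ m0 z, (G m0 z).PosSemidef)
    (hGt : ∀ m0 z, (Gt m0 z).PosSemidef) (m0 : d.M0) (m1 : d.M1) :
    ActionDefinite (S.Htilde t G Gt m0 m1) :=
  (ActionDefinite.fromBlocks_diag (posSemidef_toBlocks₂₂ (hS.Q_psd t ht m0 m1))
    (posDef_toBlocks₂₂ (hS.R_pd t ht m0 m1))).add_posSemidef
      (posSemidef_transpose_mul_mul (Psi11_posSemidef hG hGt) _)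

/- Every mode has positive probability, so all the actions `q(m¹)` are penalized. -/
lemma actionDefinite_Cempty [Nonempty d.M1] (hS : S.Standing T) (hpos : ∀ m : d.M1, 0 < S.π1 m)
    (ht : t ≤ T) (m0 : d.M0) : ActionDefinite (S.Cempty t m0) := by
  have hC : (S.Cempty t m0).PosSemidef := Matrix.posSemidef_sum _ fun m1 _ =>
    (posSemidef_transpose_mul_mul (posSemidef_fromBlocks_diag (hS.Q_psd t ht m0 m1)
      (hS.R_pd t ht m0 m1).posSemidef) _).smul (S.π1_nonneg m1)
  refine ⟨hC, posDef_iff_quadForm.2 ⟨(posSemidef_toBlocks₂₂ hC).1, fun v hv => ?_⟩⟩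
  obtain ⟨u, q, rfl⟩ : ∃ (u : d.U0) (q : d.M1 → d.U1), v = Sum.elim u fun j => q j.1 j.2 :=
    ⟨v ∘ Sum.inl, fun m i => v (Sum.inr (m, i)), (Sum.elim_comp_inl_inr v).symm⟩
  have value : quadForm (S.Cempty t m0).toBlocks₂₂ (Sum.elim u fun j => q j.1 j.2) =
      ∑ m, S.π1 m * quadForm (S.R t m0 m) (Sum.elim u (q m)) := by
    rw [← quadForm_sumElim_zero_left, ← aug, Cempty, quadForm_sum]
    simp only [quadForm_smul, quadForm_transpose_mul_mul, L_mulVec_aug, C,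
      quadForm_fromBlocks_diag, quadForm_zero, zero_add]
  obtain ⟨m, hm⟩ : ∃ m, Sum.elim u (q m) ≠ 0 := by
    by_contra! h
    refine hv (funext fun j => ?_)
    rcases j with i | ⟨m, i⟩
    · exact congrFun (h (Classical.arbitrary _)) (Sum.inl i)
    · exact congrFun (h m) (Sum.inr i)
  rw [value]
  exact Finset.sum_pos'
    (fun m _ => mul_nonneg (S.π1_nonneg m) (quadForm_nonneg (hS.R_pd t ht m0 m).posSemidef _))
    ⟨m, Finset.mem_univ m,
      mul_pos (hpos m) ((posDef_iff_quadForm.1 (hS.R_pd t ht m0 m)).2 _ hm)⟩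

lemma Fempty_posSemidef (hπ : ∑ m, S.π1 m = 1) (hG : ∀ m0 z, (G m0 z).PosSemidef)
    (hGt : ∀ m0 z, (Gt m0 z).PosSemidef) (m0 : d.M0) : (S.Fempty G Gt m0).PosSemidef := by
  have hΨ : (S.Psi11 G Gt).PosSemidef := Psi11_posSemidef hG hGt
  refine posSemidef_iff_quadForm.2 ⟨?_, fun x => ?_⟩
  · exact Matrix.IsHermitian.sub (Matrix.posSemidef_sum _ fun m1 _ =>
      (posSemidef_transpose_mul_mul hΨ _).smul (S.π1_nonneg m1)).1
        (posSemidef_transpose_mul_mul hΨ _).1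
  · rw [S.quadForm_Fempty hπ]
    exact Finset.sum_nonneg fun m _ => mul_nonneg (S.π1_nonneg m) (quadForm_nonneg hΨ _)

lemma nonempty_modes (hπ : ∑ m : d.M1, S.π1 m = 1) : Nonempty d.M1 := by
  by_contra h
  simp [not_nonempty_iff.1 h] at hπ

lemma actionDefinite_Hempty (hS : S.Standing T) (hpos : ∀ m : d.M1, 0 < S.π1 m)
    (hπ : ∑ m, S.π1 m = 1) (ht : t ≤ T) (hG : ∀ m0 z, (G m0 z).PosSemidef)
    (hGt : ∀ m0 z, (Gt m0 z).PosSemidef) (m0 : d.M0) :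
    ActionDefinite (S.Hempty t G Gt m0) :=
  have := nonempty_modes hπ
  ((actionDefinite_Cempty hS hpos ht m0).add_posSemidef
    (posSemidef_transpose_mul_mul (PiOp_posSemidef hG) _)).add_posSemidef
      (Fempty_posSemidef hπ hG hGt m0)

lemma riccati_posSemidef (hS : S.Standing T) (hpos : ∀ m : d.M1, 0 < S.π1 m)
    (hπ : ∑ m, S.π1 m = 1) (k : ℕ) :
    (∀ m0 z, ((S.riccati T k).1 m0 z).PosSemidef) ∧
      ∀ m0 z, ((S.riccati T k).2 m0 z).PosSemidef := by
  induction k with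
  | zero => exact ⟨fun _ _ => Matrix.PosSemidef.zero, fun _ _ => Matrix.PosSemidef.zero⟩
  | succ k ih =>
    have ht : T - k ≤ T := Nat.sub_le _ _
    have SC_Htilde (m0 : d.M0) (m1 : d.M1) :=
      (actionDefinite_Htilde hS ht ih.1 ih.2 m0 m1).SC_posSemidef
    constructor
    · rintro m0 (m1 | _)
      · exact (actionDefinite_Hmode hS ht ih.1 m0 m1).SC_posSemidef
      · exact (actionDefinite_Hempty hS hpos hπ ht ih.1 ih.2 m0).SC_posSemidef
    · rintro m0 (m1 | _)
      · exact SC_Htilde m0 m1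
      · exact Matrix.posSemidef_sum Finset.univ fun m1 _ =>
          (SC_Htilde m0 m1).smul (S.π1_nonneg m1)

lemma riccati_succ_sub (ht : t ≤ T) :
    S.riccati T (T + 1 - t) = (S.stepP t (S.Pmat T (t + 1)) (S.Ptmat T (t + 1)),
      S.stepPt t (S.Pmat T (t + 1)) (S.Ptmat T (t + 1))) := by
  rw [Pmat, Ptmat, Nat.succ_sub ht, Nat.add_sub_add_right, riccati, Nat.sub_sub_self ht]

lemma Pmat_eq (ht : t ≤ T) :
    S.Pmat T t = S.stepP t (S.Pmat T (t + 1)) (S.Ptmat T (t + 1)) :=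
  congrArg Prod.fst (riccati_succ_sub ht)

lemma Ptmat_eq (ht : t ≤ T) :
    S.Ptmat T t = S.stepPt t (S.Pmat T (t + 1)) (S.Ptmat T (t + 1)) :=
  congrArg Prod.snd (riccati_succ_sub ht)

end System

/-! ### Square integrable and conditionally centered random vectors -/

section SquareIntegrability

variable {Ω : Type*} [MeasurableSpace Ω] {P : Measure Ω} {ι κ : Type*} [Fintype ι]

lemma memLp_sumElim [Fintype κ] {p : ENNReal} {X : Ω → ι → ℝ} {Y : Ω → κ → ℝ} (hX : MemLp X p P)
    (hY : MemLp Y p P) : MemLp (fun ω => Sum.elim (X ω) (Y ω)) p P :=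
  memLp_pi_iff.2 fun
    | .inl i => hX.eval i
    | .inr i => hY.eval i

lemma memLp_comp_index [Fintype κ] {p : ENNReal} {X : Ω → ι → ℝ} (hX : MemLp X p P)
    (g : κ → ι) : MemLp (fun ω => X ω ∘ g) p P :=
  memLp_pi_iff.2 fun i => hX.eval (g i)

lemma memLp_mulVec [Fintype κ] {p : ENNReal} {X : Ω → ι → ℝ} (hX : MemLp X p P)
    (A : Matrix κ ι ℝ) : MemLp (fun ω => A *ᵥ X ω) p P :=
  A.mulVecLin.toContinuousLinearMap.comp_memLp' hX

lemma integrable_dotProduct {X Y : Ω → ι → ℝ} (hX : MemLp X 2 P) (hY : MemLp Y 2 P) :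
    Integrable (fun ω => X ω ⬝ᵥ Y ω) P :=
  integrable_finsetSum _ fun i _ => (hX.eval i).integrable_mul (hY.eval i)

lemma integrable_quadForm (A : Matrix ι ι ℝ) {X : Ω → ι → ℝ} (hX : MemLp X 2 P) :
    Integrable (fun ω => quadForm A (X ω)) P :=
  integrable_dotProduct hX (memLp_mulVec hX A)

lemma apply_eq_sum_indicator {E α : Type*} [AddCommMonoid E] [Fintype κ] (c : α → κ)
    (f : κ → α → E) : (fun a => f (c a) a) = ∑ k, (c ⁻¹' {k}).indicator (f k) := by
  classical
  ext a
  simp [Finset.sum_apply, Set.indicator_apply]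

variable [Finite κ] [MeasurableSpace κ] [MeasurableSingletonClass κ] {c : Ω → κ}

lemma memLp_switch {E : Type*} [NormedAddCommGroup E] {p : ENNReal} (hc : Measurable c)
    {f : κ → Ω → E} (hf : ∀ k, MemLp (f k) p P) : MemLp (fun ω => f (c ω) ω) p P := by
  cases nonempty_fintype κ
  rw [apply_eq_sum_indicator]
  exact memLp_finsetSum' _ fun k _ => (hf k).indicator (hc (measurableSet_singleton k))

lemma memLp_switch_mulVec {γ : Type*} [Fintype γ] {p : ENNReal} (hc : Measurable c)
    (A : κ → Matrix γ ι ℝ) {X : Ω → ι → ℝ} (hX : MemLp X p P) :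
    MemLp (fun ω => A (c ω) *ᵥ X ω) p P :=
  memLp_switch (f := fun k ω => A k *ᵥ X ω) hc fun k => memLp_mulVec hX (A k)

lemma integrable_quadForm_switch (hc : Measurable c) (A : κ → Matrix ι ι ℝ) {X : Ω → ι → ℝ}
    (hX : MemLp X 2 P) : Integrable (fun ω => quadForm (A (c ω)) (X ω)) P :=
  integrable_dotProduct hX (memLp_switch_mulVec hc A hX)

end SquareIntegrability

section Measurability

lemma measurable_switch {κ α β : Type*} [Countable κ] [MeasurableSpace κ]
    [MeasurableSingletonClass κ] [MeasurableSpace α] [MeasurableSpace β] {c : α → κ}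
    (hc : Measurable c) {f : κ → α → β} (hf : ∀ k, Measurable (f k)) :
    Measurable fun a => f (c a) a :=
  (measurable_from_prod_countable_right (f := fun q : κ × α => f q.1 q.2) hf).comp
    (hc.prodMk measurable_id)

lemma measurable_mulVec {ι γ : Type*} [Fintype ι] [Finite γ] (A : Matrix γ ι ℝ) :
    Measurable (A *ᵥ ·) :=
  (continuous_const.matrix_mulVec continuous_id).measurable

lemma measurable_switch_mulVec {ι γ κ α : Type*} [Fintype ι] [Finite γ] [Finite κ]
    [MeasurableSpace α] [MeasurableSpace κ] [MeasurableSingletonClass κ] {c : α → κ}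
    (hc : Measurable c) (A : κ → Matrix γ ι ℝ) {x : α → ι → ℝ} (hx : Measurable x) :
    Measurable fun a => A (c a) *ᵥ x a :=
  measurable_switch (f := fun k a => A k *ᵥ x a) hc fun k => (measurable_mulVec (A k)).comp hx

lemma measurable_quadForm {ι : Type*} [Fintype ι] (A : Matrix ι ι ℝ) : Measurable (quadForm A) :=
  (continuous_id.dotProduct (continuous_const.matrix_mulVec continuous_id)).measurable

end Measurability

section Independence

variable {Ω α β κ E : Type*} [MeasurableSpace Ω] [MeasurableSpace α] [MeasurableSpace β]
variable [NormedAddCommGroup E] {P : Measure Ω} [IsFiniteMeasure P]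

lemma integrable_prod_of_indepFun {X : Ω → α} {N : Ω → β} (hX : Measurable X) (hN : Measurable N)
    (h : IndepFun X N P) {g : α × β → E} (hg : StronglyMeasurable g)
    (hint : Integrable (fun ω => g (X ω, N ω)) P) : Integrable g ((P.map X).prod (P.map N)) := by
  rw [← h.map_prod_eq_prod_map_map hX.aemeasurable hN.aemeasurable]
  exact (integrable_map_measure hg.aestronglyMeasurable (hX.prodMk hN).aemeasurable).2 hint

lemma ae_integrable_of_indepFun {X : Ω → α} {N : Ω → β} (hX : Measurable X) (hN : Measurable N)
    (h : IndepFun X N P) {g : α × β → E} (hg : StronglyMeasurable g)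
    (hint : Integrable (fun ω => g (X ω, N ω)) P) :
    ∀ᵐ n ∂(P.map N), Integrable (fun ω => g (X ω, n)) P :=
  (integrable_prod_of_indepFun hX hN h hg hint).prod_left_ae.mono fun _ hn =>
    (integrable_map_measure hn.1 hX.aemeasurable).1 hn

lemma integrable_of_indepFun_countable [Countable κ] [MeasurableSpace κ]
    [MeasurableSingletonClass κ] [MeasurableSpace E] [BorelSpace E] [SecondCountableTopology E]
    {M : Ω → κ} {V : Ω → α} (hM : Measurable M) (hV : Measurable V) (h : IndepFun M V P)
    {f : κ → α → E} (hf : ∀ k, Measurable (f k))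
    (hint : Integrable (fun ω => f (M ω) (V ω)) P) (k : κ) (hk : 0 < (P.map M).real {k}) :
    Integrable (fun ω => f k (V ω)) P := by
  have hg : Measurable fun q : α × κ => f q.2 q.1 := measurable_from_prod_countable_left hf
  have hae := ae_integrable_of_indepFun hV hM h.symm hg.stronglyMeasurable hint
  exact ae_iff_of_countable.1 hae k (measureReal_ne_zero_iff (by finiteness) |>.1 hk.ne')

variable [NormedSpace ℝ E]

lemma integral_of_indepFun {X : Ω → α} {N : Ω → β} (hX : Measurable X) (hN : Measurable N)
    (h : IndepFun X N P) {g : α × β → E} (hg : StronglyMeasurable g)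
    (hint : Integrable (fun ω => g (X ω, N ω)) P) :
    ∫ ω, g (X ω, N ω) ∂P = ∫ n, ∫ ω, g (X ω, n) ∂P ∂(P.map N) := by
  calc ∫ ω, g (X ω, N ω) ∂P
      = ∫ q, g q ∂((P.map X).prod (P.map N)) := by
        rw [← h.map_prod_eq_prod_map_map hX.aemeasurable hN.aemeasurable,
          integral_map (hX.prodMk hN).aemeasurable hg.aestronglyMeasurable]
    _ = ∫ n, ∫ x, g (x, n) ∂(P.map X) ∂(P.map N) :=
        integral_prod_symm _ (integrable_prod_of_indepFun hX hN h hg hint)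
    _ = ∫ n, ∫ ω, g (X ω, n) ∂P ∂(P.map N) := by
        congr with n
        exact integral_map hX.aemeasurable
          (hg.comp_measurable measurable_prodMk_right).aestronglyMeasurable

lemma integral_of_indepFun_finite [Fintype κ] [MeasurableSpace κ] [MeasurableSingletonClass κ]
    [MeasurableSpace E] [BorelSpace E] [SecondCountableTopology E] [CompleteSpace E] {M : Ω → κ}
    {V : Ω → α} (hM : Measurable M) (hV : Measurable V) (h : IndepFun M V P) {f : κ → α → E}
    (hf : ∀ k, Measurable (f k)) (hint : Integrable (fun ω => f (M ω) (V ω)) P) :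
    ∫ ω, f (M ω) (V ω) ∂P = ∑ k, (P.map M).real {k} • ∫ ω, f k (V ω) ∂P := by
  have hg : Measurable fun q : α × κ => f q.2 q.1 := measurable_from_prod_countable_left hf
  rw [integral_of_indepFun hV hM h.symm hg.stronglyMeasurable hint,
    integral_fintype .of_finite]

lemma integral_sum_smul_of_indepFun [Fintype κ] [MeasurableSpace κ] [MeasurableSingletonClass κ]
    [MeasurableSpace E] [BorelSpace E] [SecondCountableTopology E] [CompleteSpace E] {M : Ω → κ}
    {V : Ω → α} (hM : Measurable M) (hV : Measurable V) (h : IndepFun M V P) {f : κ → α → E}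
    (hf : ∀ k, Measurable (f k)) (hint : Integrable (fun ω => f (M ω) (V ω)) P)
    (hpos : ∀ k, 0 < (P.map M).real {k}) :
    Integrable (fun ω => ∑ k, (P.map M).real {k} • f k (V ω)) P ∧
      ∫ ω, ∑ k, (P.map M).real {k} • f k (V ω) ∂P = ∫ ω, f (M ω) (V ω) ∂P := by
  have hk (k : κ) : Integrable (fun ω => (P.map M).real {k} • f k (V ω)) P :=
    (integrable_of_indepFun_countable hM hV h hf hint k (hpos k)).smul ((P.map M).real {k})
  refine ⟨integrable_finsetSum _ fun k _ => hk k, ?_⟩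
  rw [integral_of_indepFun_finite hM hV h hf hint, integral_finsetSum _ fun k _ => hk k]
  exact Finset.sum_congr rfl fun k _ => integral_smul _ _

end Independence

section CondCentered

variable {Ω α β E : Type*} [MeasurableSpace Ω] [MeasurableSpace α] [MeasurableSpace β]
variable [NormedAddCommGroup E] [NormedSpace ℝ E] [CompleteSpace E]

/-- The conditional mean of `Y` given `F` vanishes. This is how estimation errors are recorded.
Since Mathlib's conditional expectation is `0` for a non-integrable `Y` or a non-measurable `F`, it
is meaningful only together with integrability of `Y` and measurability of `F`. -/
def CondCentered (F : Ω → α) (Y : Ω → E) (P : Measure Ω) : Prop :=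
  P[Y | MeasurableSpace.comap F inferInstance] =ᵐ[P] 0

variable {P : Measure Ω} {F : Ω → α} {X Y : Ω → E}

namespace CondCentered

lemma add (hX : CondCentered F X P) (hY : CondCentered F Y P) (hXi : Integrable X P)
    (hYi : Integrable Y P) : CondCentered F (X + Y) P := by
  filter_upwards [condExp_add hXi hYi (MeasurableSpace.comap F inferInstance), hX, hY]
    with ω h hX hY
  rw [h, Pi.add_apply, hX, hY, Pi.zero_apply, add_zero]

lemma sum {κ : Type*} {s : Finset κ} {Y : κ → Ω → E} (hY : ∀ k ∈ s, CondCentered F (Y k) P)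
    (hYi : ∀ k ∈ s, Integrable (Y k) P) : CondCentered F (∑ k ∈ s, Y k) P := by
  classical
  induction s using Finset.induction_on with
  | empty =>
    rw [Finset.sum_empty, CondCentered, condExp_zero]
  | insert k s hk ih =>
    simp only [Finset.forall_mem_insert] at hY hYi
    rw [Finset.sum_insert hk]
    exact hY.1.add (ih hY.2 hYi.2) hYi.1 (integrable_finsetSum' _ hYi.2)

lemma clm_comp {E' : Type*} [NormedAddCommGroup E'] [NormedSpace ℝ E'] [CompleteSpace E']
    (hY : CondCentered F Y P) (hYi : Integrable Y P) (L : E →L[ℝ] E') :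
    CondCentered F (fun ω => L (Y ω)) P := by
  filter_upwards [ContinuousLinearMap.comp_condExp_comm
    (m := MeasurableSpace.comap F inferInstance) hYi L, hY] with ω h hY
  rw [Function.comp_apply, hY] at h
  exact h.symm.trans (map_zero L)

lemma switch {κ : Type*} [Finite κ] [MeasurableSpace κ] [MeasurableSingletonClass κ]
    (hF : Measurable F) {c : α → κ} (hc : Measurable c) {Y : κ → Ω → E}
    (hY : ∀ k, CondCentered F (Y k) P) (hYi : ∀ k, Integrable (Y k) P) :
    CondCentered F (fun ω => Y (c (F ω)) ω) P := by
  cases nonempty_fintype κ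
  have hs (k : κ) : MeasurableSet (c ⁻¹' {k}) := hc (measurableSet_singleton k)
  rw [apply_eq_sum_indicator (fun ω => c (F ω))]
  refine sum (fun k _ => ?_) fun k _ => (hYi k).indicator (hF (hs k))
  have hsF : MeasurableSet[MeasurableSpace.comap F inferInstance] (F ⁻¹' (c ⁻¹' {k})) :=
    ⟨_, hs k, rfl⟩
  filter_upwards [condExp_indicator (hYi k) hsF, hY k] with ω h hY
  exact h.trans (Set.indicator_apply_eq_zero.2 fun _ => hY)

lemma switch_mulVec {ι γ κ : Type*} [Fintype ι] [Fintype γ] [Finite κ] [MeasurableSpace κ]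
    [MeasurableSingletonClass κ] (hF : Measurable F) {c : α → κ} (hc : Measurable c)
    {Y : Ω → ι → ℝ} (hY : CondCentered F Y P) (hYi : Integrable Y P) (A : κ → Matrix γ ι ℝ) :
    CondCentered F (fun ω => A (c (F ω)) *ᵥ Y ω) P :=
  switch (Y := fun k ω => A k *ᵥ Y ω) hF hc
    (fun k => hY.clm_comp hYi (A k).mulVecLin.toContinuousLinearMap)
    fun k => (A k).mulVecLin.toContinuousLinearMap.integrable_comp hYi

lemma sumElim {ι κ : Type*} [Fintype ι] [Fintype κ] {Y : Ω → ι → ℝ} {Z : Ω → κ → ℝ}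
    (hY : CondCentered F Y P) (hZ : CondCentered F Z P) (hYi : Integrable Y P)
    (hZi : Integrable Z P) : CondCentered F (fun ω => Sum.elim (Y ω) (Z ω)) P := by
  let inl : (ι → ℝ) →L[ℝ] (ι ⊕ κ → ℝ) := .pi (Sum.rec .proj fun _ => 0)
  let inr : (κ → ℝ) →L[ℝ] (ι ⊕ κ → ℝ) := .pi (Sum.rec (fun _ => 0) .proj)
  have h := (hY.clm_comp hYi inl).add (hZ.clm_comp hZi inr) (inl.integrable_comp hYi)
    (inr.integrable_comp hZi)
  convert h using 1
  ext ω (i | i) <;> simp [inl, inr]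

end CondCentered

variable [IsFiniteMeasure P]

lemma condCentered_iff_setIntegral_eq_zero (hF : Measurable F) (hYi : Integrable Y P) :
    CondCentered F Y P ↔ ∀ B, MeasurableSet B → ∫ ω in F ⁻¹' B, Y ω ∂P = 0 := by
  refine ⟨fun h B hB => ?_, fun h => ?_⟩
  · rw [← setIntegral_condExp hF.comap_le hYi ⟨B, hB, rfl⟩]
    exact integral_eq_zero_of_ae (ae_restrict_of_ae h)
  · refine (ae_eq_condExp_of_forall_setIntegral_eq hF.comap_le hYi
      (fun _ _ _ => integrableOn_zero) ?_ aestronglyMeasurable_zero).symm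
    rintro _ ⟨B, hB, rfl⟩ -
    exact (integral_zero _ _).trans (h B hB).symm

namespace CondCentered

lemma indicator_of_eqOn {G : Ω → β} (hF : Measurable F) (hG : Measurable G)
    (hY : CondCentered F Y P) (hYi : Integrable Y P) {s : Set α} (hs : MeasurableSet s)
    {g : α → β} (hg : Measurable g) (hFG : Set.EqOn G (g ∘ F) (F ⁻¹' s)) :
    CondCentered G ((F ⁻¹' s).indicator Y) P := by
  refine (condCentered_iff_setIntegral_eq_zero hG (hYi.indicator (hF hs))).2 fun B hB => ?_
  have preimage_eq : G ⁻¹' B ∩ F ⁻¹' s = F ⁻¹' (g ⁻¹' B ∩ s) := by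
    ext ω
    exact and_congr_left fun hω => by rw [Set.mem_preimage, hFG hω]; rfl
  rw [setIntegral_indicator (hF hs), preimage_eq]
  exact (condCentered_iff_setIntegral_eq_zero hF hYi).1 hY _ ((hg hB).inter hs)

lemma comp (hY : CondCentered F Y P) (hF : Measurable F) {g : α → β} (hg : Measurable g) :
    CondCentered (fun ω => g (F ω)) Y P := by
  have hle : MeasurableSpace.comap (fun ω => g (F ω)) inferInstance ≤
      MeasurableSpace.comap F inferInstance := (hg.comp (comap_measurable F)).comap_le
  calc P[Y | MeasurableSpace.comap (fun ω => g (F ω)) inferInstance]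
      =ᵐ[P] P[P[Y | MeasurableSpace.comap F inferInstance] |
          MeasurableSpace.comap (fun ω => g (F ω)) inferInstance] :=
        (condExp_condExp_of_le hle hF.comap_le).symm
    _ =ᵐ[P] P[0 | MeasurableSpace.comap (fun ω => g (F ω)) inferInstance] := condExp_congr_ae hY
    _ = 0 := condExp_zero

lemma integral_mul_eq_zero {Y : Ω → ℝ} (hF : Measurable F) (hY : CondCentered F Y P)
    (hYL : MemLp Y 2 P) {f : α → ℝ} (hf : Measurable f) (hfL : MemLp (fun ω => f (F ω)) 2 P) :
    ∫ ω, f (F ω) * Y ω ∂P = 0 := by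
  have hfF : StronglyMeasurable[MeasurableSpace.comap F inferInstance] fun ω => f (F ω) :=
    (hf.comp (comap_measurable F)).stronglyMeasurable
  rw [← integral_condExp hF.comap_le]
  refine integral_eq_zero_of_ae ?_
  filter_upwards [condExp_mul_of_stronglyMeasurable_left hfF (hfL.integrable_mul hYL)
    (hYL.integrable one_le_two), hY] with ω h hY
  exact h.trans (by rw [Pi.mul_apply, hY, Pi.zero_apply, mul_zero])

lemma integral_dotProduct_eq_zero {ι : Type*} [Fintype ι] {Y : Ω → ι → ℝ} (hF : Measurable F)
    (hY : CondCentered F Y P) (hYL : MemLp Y 2 P) {x : α → ι → ℝ} (hx : Measurable x)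
    (hxL : MemLp (fun ω => x (F ω)) 2 P) : ∫ ω, x (F ω) ⬝ᵥ Y ω ∂P = 0 := by
  have hint (i : ι) : Integrable (fun ω => x (F ω) i * Y ω i) P :=
    (hxL.eval i).integrable_mul (hYL.eval i)
  simp only [dotProduct]
  rw [integral_finsetSum _ fun i _ => hint i]
  exact Finset.sum_eq_zero fun i _ =>
    (hY.clm_comp (hYL.integrable one_le_two) (.proj i)).integral_mul_eq_zero hF (hYL.eval i)
      ((measurable_pi_apply i).comp hx) (hxL.eval i)

/- Pythagoras: the cross terms are products of an `F`-measurable vector with `Y`. -/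
lemma integral_quadForm_add {ι κ : Type*} [Fintype ι] [Finite κ] [MeasurableSpace κ]
    [MeasurableSingletonClass κ] (hF : Measurable F) {c : α → κ} (hc : Measurable c)
    (A : κ → Matrix ι ι ℝ) {x : α → ι → ℝ} (hx : Measurable x)
    (hxL : MemLp (fun ω => x (F ω)) 2 P) {Y : Ω → ι → ℝ} (hYL : MemLp Y 2 P)
    (hY : CondCentered F Y P) :
    ∫ ω, quadForm (A (c (F ω))) (x (F ω) + Y ω) ∂P =
      ∫ ω, quadForm (A (c (F ω))) (x (F ω)) ∂P + ∫ ω, quadForm (A (c (F ω))) (Y ω) ∂P := by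
  have hc' : Measurable fun ω => c (F ω) := hc.comp hF
  have cross_measurable : Measurable fun a => ((A (c a))ᵀ + A (c a)) *ᵥ x a :=
    measurable_switch_mulVec hc (fun k => (A k)ᵀ + A k) hx
  have cross_memLp : MemLp (fun ω => ((A (c (F ω)))ᵀ + A (c (F ω))) *ᵥ x (F ω)) 2 P :=
    memLp_switch_mulVec hc' (fun k => (A k)ᵀ + A k) hxL
  have hxq := integrable_quadForm_switch hc' A hxL
  have hYq := integrable_quadForm_switch hc' A hYL
  have hsum : Integrable
      (fun ω => quadForm (A (c (F ω))) (x (F ω)) + quadForm (A (c (F ω))) (Y ω)) P := hxq.add hYq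
  simp only [quadForm_add_vec]
  rw [integral_add hsum (integrable_dotProduct cross_memLp hYL), integral_add hxq hYq,
    hY.integral_dotProduct_eq_zero hF hYL cross_measurable cross_memLp, add_zero]

variable [MeasurableSpace E] [BorelSpace E] [SecondCountableTopology E]

lemma of_indepFun (hF : Measurable F) (hY : Measurable Y) (h : IndepFun F Y P)
    (hmean : ∫ ω, Y ω ∂P = 0) : CondCentered F Y P := by
  have h := condExp_indep_eq hY.comap_le hF.comap_le (comap_measurable Y).stronglyMeasurable
    ((IndepFun_iff_Indep _ _ _).1 h.symm)
  rw [hmean] at h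
  exact h

lemma prodMk_of_indepFun {N : Ω → β} (hF : Measurable F) (hY : Measurable Y) (hN : Measurable N)
    (h : CondCentered F Y P) (hYi : Integrable Y P) (hind : IndepFun (fun ω => (F ω, Y ω)) N P) :
    CondCentered (fun ω => (F ω, N ω)) Y P := by
  have hFN := hF.prodMk hN
  refine (condCentered_iff_setIntegral_eq_zero hFN hYi).2 fun B hB => ?_
  let g : (α × E) × β → E :=
    ((fun q : (α × E) × β => (q.1.1, q.2)) ⁻¹' B).indicator fun q => q.1.2
  have hg : StronglyMeasurable g :=
    (measurable_fst.snd.indicator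
      ((measurable_fst.fst.prodMk measurable_snd) hB)).stronglyMeasurable
  have section_eq (n : β) : ∫ ω, g ((F ω, Y ω), n) ∂P = 0 :=
    (integral_indicator (hF (measurable_prodMk_right hB))).trans
      ((condCentered_iff_setIntegral_eq_zero hF hYi).1 h _ (measurable_prodMk_right hB))
  calc ∫ ω in (fun ω => (F ω, N ω)) ⁻¹' B, Y ω ∂P
      = ∫ ω, g ((F ω, Y ω), N ω) ∂P := (integral_indicator (hFN hB)).symm
    _ = ∫ n, ∫ ω, g ((F ω, Y ω), n) ∂P ∂(P.map N) :=
        integral_of_indepFun (hF.prodMk hY) hN hind hg (hYi.indicator (hFN hB))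
    _ = 0 := by simp only [section_eq, integral_zero]

end CondCentered

lemma condExp_sub_of_measurable [MeasurableSpace E] [BorelSpace E] [SecondCountableTopology E]
    (hF : Measurable F) {Y : Ω → E} (hY : Integrable Y P) {b : α → E} (hb : Measurable b)
    (hbi : Integrable (fun ω => b (F ω)) P) :
    P[fun ω => Y ω - b (F ω) | MeasurableSpace.comap F inferInstance] =ᵐ[P]
      P[Y | MeasurableSpace.comap F inferInstance] - fun ω => b (F ω) := by
  have hbF : StronglyMeasurable[MeasurableSpace.comap F inferInstance] fun ω => b (F ω) :=
    (hb.comp (comap_measurable F)).stronglyMeasurable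
  have h := condExp_sub hY hbi (MeasurableSpace.comap F inferInstance)
  rwa [condExp_of_stronglyMeasurable hF.comap_le hbF hbi] at h

lemma exists_condMean {ι : Type*} [Fintype ι] (hF : Measurable F) {Y : Ω → ι → ℝ}
    (hY : MemLp Y 2 P) : ∃ b : α → ι → ℝ, Measurable b ∧ MemLp (fun ω => b (F ω)) 2 P ∧
      CondCentered F (fun ω => Y ω - b (F ω)) P := by
  obtain ⟨b, hb, hbF⟩ := (stronglyMeasurable_condExp (μ := P) (f := Y)
    (m := MeasurableSpace.comap F inferInstance)).exists_eq_measurable_comp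
  have hbL : MemLp (fun ω => b (F ω)) 2 P := by
    have h := hY.condExp (m := MeasurableSpace.comap F inferInstance) one_le_two
    rwa [hbF] at h
  refine ⟨b, hb.measurable, hbL, ?_⟩
  have h := condExp_sub_of_measurable hF (hY.integrable one_le_two) hb.measurable
    (hbL.integrable one_le_two)
  rw [hbF] at h
  exact h.trans (.of_eq (sub_self _))

lemma condExp_eq_of_condCentered_sub [MeasurableSpace E] [BorelSpace E] [SecondCountableTopology E]
    (hF : Measurable F) {Y : Ω → E} (hY : Integrable Y P) {b : α → E} (hb : Measurable b)
    (hbi : Integrable (fun ω => b (F ω)) P) (h : CondCentered F (fun ω => Y ω - b (F ω)) P) :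
    P[Y | MeasurableSpace.comap F inferInstance] =ᵐ[P] fun ω => b (F ω) := by
  filter_upwards [condExp_sub_of_measurable hF hY hb hbi, h] with ω hsub hzero
  exact sub_eq_zero.1 (hsub.symm.trans hzero)

end CondCentered

/-! ### Common information and independence -/

instance {α β : Type*} [MeasurableSpace α] [MeasurableSpace β] [MeasurableSingletonClass α]
    [MeasurableSingletonClass β] : MeasurableSingletonClass (α ⊕ β) where
  measurableSet_singleton
    | Sum.inl a => by
      rw [← Set.image_singleton, measurableSet_inl_image]; exact measurableSet_singleton a
    | Sum.inr b => by
      rw [← Set.image_singleton, measurableSet_inr_image]; exact measurableSet_singleton b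

lemma measurable_fin_snoc {Ω α : Type*} [MeasurableSpace Ω] [MeasurableSpace α] {t : ℕ}
    {f : Ω → Fin t → α} {g : Ω → α} (hf : Measurable f) (hg : Measurable g) :
    Measurable fun ω => (Fin.snoc (α := fun _ => α) (f ω) (g ω) : Fin (t + 1) → α) := by
  refine measurable_pi_iff.2 (Fin.lastCases ?_ fun j => ?_)
  · simpa only [Fin.snoc_last] using hg
  · simpa only [Fin.snoc_castSucc] using measurable_pi_iff.1 hf j

namespace Dims

variable {d : Dims} {t : ℕ}

/-- The common information with the current channel outputs replaced by `∅`: what the global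
controller knows about time `t` before the channel is used. -/
def Hist.erase (h : d.Hist t) : d.Hist t :=
  (h.1, h.2.1, Function.update h.2.2.1 (Fin.last t) (Sum.inr ()),
    Function.update h.2.2.2.1 (Fin.last t) (Sum.inr ()), h.2.2.2.2)

namespace Hist

section Projections

variable (h : d.Hist t) (u : d.U0) (x : d.X0) (m : d.M0) (z : Received d.X1) (zt : Received d.M1)

@[simp] lemma x0_erase : h.erase.x0 = h.x0 := rfl

@[simp] lemma z_erase : h.erase.z = Sum.inr () := by simp [erase, Hist.z]

@[simp] lemma past_erase (h : d.Hist (t + 1)) : h.erase.past = h.past := by simp [erase, past]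

lemma erase_eq_self (hz : h.z = Sum.inr ()) (hzt : h.zt = Sum.inr ()) : h.erase = h := by
  unfold erase
  rw [← hz, ← hzt, Hist.z, Hist.zt, Function.update_eq_self, Function.update_eq_self]

@[simp] lemma x0_extend : (h.extend u x m z zt).x0 = x := by simp [extend, Hist.x0]

@[simp] lemma m0_extend : (h.extend u x m z zt).m0 = m := by simp [extend, Hist.m0]

@[simp] lemma z_extend : (h.extend u x m z zt).z = z := by simp [extend, Hist.z]

@[simp] lemma zt_extend : (h.extend u x m z zt).zt = zt := by simp [extend, Hist.zt]

@[simp] lemma past_extend : (h.extend u x m z zt).past = h := by simp [extend, past]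

@[simp] lemma erase_extend :
    (h.extend u x m z zt).erase = h.extend u x m (Sum.inr ()) (Sum.inr ()) := by
  simp [extend, erase, Fin.update_snoc_last]

@[simp] lemma erase_start : (start x m z zt).erase = start x m (Sum.inr ()) (Sum.inr ()) := by
  have update_const {α : Type} (a b : α) :
      Function.update (fun _ : Fin (0 + 1) => a) (Fin.last 0) b = fun _ => b := by
    ext i
    rw [Fin.fin_one_eq_zero i, Fin.last_zero, Function.update_self]
  simp only [start, erase, update_const]

end Projections

section Measurability

variable {Ω : Type*} [MeasurableSpace Ω]

lemma measurable_x0 : Measurable (Hist.x0 : d.Hist t → d.X0) := by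
  unfold Hist.x0; fun_prop

lemma measurable_m0 : Measurable (Hist.m0 : d.Hist t → d.M0) := by
  unfold Hist.m0; fun_prop

lemma measurable_z : Measurable (Hist.z : d.Hist t → Received d.X1) := by
  unfold Hist.z; fun_prop

lemma measurable_zt : Measurable (Hist.zt : d.Hist t → Received d.M1) := by
  unfold Hist.zt; fun_prop

lemma measurable_past : Measurable (past : d.Hist (t + 1) → d.Hist t) := by
  unfold past; fun_prop

lemma measurable_erase : Measurable (erase : d.Hist t → d.Hist t) := by
  have h {α : Type} [MeasurableSpace α] (a : α) :
      Measurable fun f : Fin (t + 1) → α => Function.update f (Fin.last t) a :=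
    measurable_update_left
  exact measurable_fst.prodMk <| measurable_snd.fst.prodMk <|
    ((h _).comp measurable_snd.snd.fst).prodMk <|
    ((h _).comp measurable_snd.snd.snd.fst).prodMk measurable_snd.snd.snd.snd

variable {x : Ω → d.X0} {m : Ω → d.M0} {z : Ω → Received d.X1} {zt : Ω → Received d.M1}

lemma measurable_start (hx : Measurable x) (hm : Measurable m) (hz : Measurable z)
    (hzt : Measurable zt) : Measurable fun ω => start (x ω) (m ω) (z ω) (zt ω) := by
  unfold start
  fun_prop

lemma measurable_extend {h : Ω → d.Hist t} {u : Ω → d.U0} (hh : Measurable h) (hu : Measurable u)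
    (hx : Measurable x) (hm : Measurable m) (hz : Measurable z) (hzt : Measurable zt) :
    Measurable fun ω => (h ω).extend (u ω) (x ω) (m ω) (z ω) (zt ω) :=
  (measurable_fin_snoc hh.fst hx).prodMk <| (measurable_fin_snoc hh.snd.fst hm).prodMk <|
    (measurable_fin_snoc hh.snd.snd.fst hz).prodMk <|
    (measurable_fin_snoc hh.snd.snd.snd.fst hzt).prodMk <|
    measurable_fin_snoc hh.snd.snd.snd.snd hu

end Measurability

end Hist

end Dims

lemma measurable_sumElim {Ω ι κ : Type*} [MeasurableSpace Ω] {x : Ω → ι → ℝ} {y : Ω → κ → ℝ}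
    (hx : Measurable x) (hy : Measurable y) : Measurable fun ω => Sum.elim (x ω) (y ω) :=
  measurable_pi_iff.2 fun
    | .inl i => (measurable_pi_apply i).comp hx
    | .inr i => (measurable_pi_apply i).comp hy

lemma measurable_comp_index {Ω ι κ : Type*} [MeasurableSpace Ω] {x : Ω → ι → ℝ}
    (hx : Measurable x) (g : κ → ι) : Measurable fun ω => x ω ∘ g :=
  measurable_pi_iff.2 fun i => (measurable_pi_apply (g i)).comp hx

namespace System

variable {d : Dims} (S : System d)

lemma measurable_vec {Ω : Type*} [MeasurableSpace Ω] {x0 : Ω → d.X0} {x1 : Ω → d.X1}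
    {u0 : Ω → d.U0} {u1 : Ω → d.U1} (hx0 : Measurable x0) (hx1 : Measurable x1)
    (hu0 : Measurable u0) (hu1 : Measurable u1) :
    Measurable fun ω => vec (x0 ω) (x1 ω) (u0 ω) (u1 ω) :=
  measurable_sumElim (measurable_sumElim hx0 hx1) (measurable_sumElim hu0 hu1)

lemma measurable_channel {Ω : Type*} [MeasurableSpace Ω] {α : Type} [MeasurableSpace α]
    {b : Ω → Bool} {a : Ω → α} (hb : Measurable b) (ha : Measurable a) :
    Measurable fun ω => channel (b ω) (a ω) :=
  Measurable.ite (hb (measurableSet_singleton true)) (measurable_inl.comp ha) measurable_const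

lemma D_mulVec_vec (m0 : d.M0) (m1 : d.M1) (x0 : d.X0) (x1 : d.X1) (u0 : d.U0) (u1 : d.U1) :
    S.D m0 m1 *ᵥ vec x0 x1 u0 u1 =
      S.A m0 m1 *ᵥ Sum.elim x0 x1 + S.B m0 m1 *ᵥ Sum.elim u0 u1 := by
  simp only [D, vec, Matrix.fromCols_mulVec_sumElim]

section ClosedLoop

variable {Ω : Type*} (ξ : Primitives d Ω) (l0 : Strategy0 d) (l1 : Strategy1 d)

lemma hist_zero (ω : Ω) : S.hist ξ l0 l1 0 ω = Hist.start (ξ.x0 ω) (ξ.m0 0 ω)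
    (channel (ξ.γ 0 ω) (ξ.x1 ω)) (channel (ξ.γ 0 ω) (ξ.m1 0 ω)) := rfl

lemma hist_m0 (t : ℕ) (ω : Ω) : (S.hist ξ l0 l1 t ω).m0 = ξ.m0 t ω := by
  cases t with
  | zero => rfl
  | succ t => exact Hist.m0_extend ..

lemma hist_zt (t : ℕ) (ω : Ω) : (S.hist ξ l0 l1 t ω).zt = channel (ξ.γ t ω) (ξ.m1 t ω) := by
  cases t with
  | zero => rfl
  | succ t => exact Hist.zt_extend ..

lemma hist_z (t : ℕ) (ω : Ω) :
    (S.hist ξ l0 l1 t ω).z = channel (ξ.γ t ω) (S.state1 ξ l0 l1 t ω) := by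
  cases t with
  | zero => rfl
  | succ t => exact Hist.z_extend ..

/-- `D(M⁰_t, M¹_t) vec(X_t, U_t)`, the next state before the noise is added. -/
def drift (t : ℕ) (ω : Ω) : d.IX → ℝ :=
  S.D (ξ.m0 t ω) (ξ.m1 t ω) *ᵥ vec (S.state0 ξ l0 l1 t ω) (S.state1 ξ l0 l1 t ω)
    (S.action0 ξ l0 l1 t ω) (S.action1 ξ l0 l1 t ω)

lemma state1_succ (t : ℕ) (ω : Ω) : S.state1 ξ l0 l1 (t + 1) ω =
    S.drift ξ l0 l1 t ω ∘ Sum.inr + ξ.w1 t ω := by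
  ext i
  rw [drift, D_mulVec_vec, ← hist_m0 S ξ l0 l1]
  rfl

lemma state0_succ (t : ℕ) (ω : Ω) : S.state0 ξ l0 l1 (t + 1) ω =
    S.drift ξ l0 l1 t ω ∘ Sum.inl + ξ.w0 t ω := by
  refine (Hist.x0_extend ..).trans ?_
  ext i
  rw [drift, D_mulVec_vec, ← hist_m0 S ξ l0 l1]
  rfl

lemma hist_succ (t : ℕ) (ω : Ω) : S.hist ξ l0 l1 (t + 1) ω =
    (S.hist ξ l0 l1 t ω).extend (S.action0 ξ l0 l1 t ω) (S.state0 ξ l0 l1 (t + 1) ω)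
      (ξ.m0 (t + 1) ω) (channel (ξ.γ (t + 1) ω) (S.state1 ξ l0 l1 (t + 1) ω))
      (channel (ξ.γ (t + 1) ω) (ξ.m1 (t + 1) ω)) := by
  have h : S.state0 ξ l0 l1 (t + 1) ω = _ := Hist.x0_extend ..
  rw [h]
  rfl

end ClosedLoop

/-- Borel measurability of a pair of strategies up to the horizon. -/
structure MeasurableStrategies (l0 : Strategy0 d) (l1 : Strategy1 d) (T : ℕ) : Prop where
  measurable0 : ∀ t ≤ T, Measurable (l0 t)
  measurable1 : ∀ t ≤ T, Measurable (l1 t)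

/-- The primitive random variables that determine the states at time `t`. -/
def stateSources (T t : ℕ) : Set (Src T) := {i | match i with
  | .x0 => True
  | .x1 => True
  | .w0 s => s < t
  | .w1 s => s < t
  | .m0 s => s < t
  | .m1 s => s < t
  | .γ s => s < t}

/-- The primitive random variables that determine the common information at time `t`. -/
def histSources (T t : ℕ) : Set (Src T) := {i | match i with
  | .x0 => True
  | .x1 => True
  | .w0 s => s < t
  | .w1 s => s < t
  | .m0 s => s ≤ t
  | .m1 s => s ≤ t
  | .γ s => s ≤ t}

lemma stateSources_subset_histSources (T t : ℕ) : stateSources T t ⊆ histSources T t := by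
  rintro (_ | _ | s | s | s | s | s) hs
  exacts [trivial, trivial, hs, hs, Nat.le_of_lt hs, Nat.le_of_lt hs, Nat.le_of_lt hs]

lemma histSources_subset_stateSources_succ (T t : ℕ) :
    histSources T t ⊆ stateSources T (t + 1) := by
  rintro (_ | _ | s | s | s | s | s) hs
  exacts [trivial, trivial, Nat.lt_succ_of_lt hs, Nat.lt_succ_of_lt hs, Nat.lt_succ_of_le hs,
    Nat.lt_succ_of_le hs, Nat.lt_succ_of_le hs]

section Measurability

/- The σ-algebra on `Ω` is left arbitrary: it is either the ambient one or the one generated by some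
of the primitive random variables. -/
variable {Ω : Type*} {mΩ : MeasurableSpace Ω} {ξ : Primitives d Ω} {l0 : Strategy0 d}
  {l1 : Strategy1 d} {T t : ℕ}

lemma measurable_state_succ (hl : MeasurableStrategies l0 l1 T) (ht : t ≤ T)
    (hhist : Measurable (S.hist ξ l0 l1 t)) (hstate : Measurable (S.state1 ξ l0 l1 t))
    (hm1 : Measurable (ξ.m1 t)) (hw0 : Measurable (ξ.w0 t)) (hw1 : Measurable (ξ.w1 t)) :
    Measurable (S.state0 ξ l0 l1 (t + 1)) ∧ Measurable (S.state1 ξ l0 l1 (t + 1)) := by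
  have hm0 : Measurable (ξ.m0 t) := by
    simpa only [Function.comp_def, hist_m0] using Hist.measurable_m0.comp hhist
  have hdrift : Measurable (S.drift ξ l0 l1 t) :=
    measurable_switch_mulVec (hm0.prodMk hm1) (fun k => S.D k.1 k.2) <|
      measurable_vec (Hist.measurable_x0.comp hhist) hstate ((hl.measurable0 t ht).comp hhist)
        ((hl.measurable1 t ht).comp (hhist.prodMk (hstate.prodMk hm1)))
  rw [funext fun ω => state0_succ S ξ l0 l1 t ω, funext fun ω => state1_succ S ξ l0 l1 t ω]
  exact ⟨(measurable_comp_index hdrift _).add hw0, (measurable_comp_index hdrift _).add hw1⟩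

lemma measurable_hist_and_state1 (hl : MeasurableStrategies l0 l1 T) (ht : t ≤ T)
    (hξ : ∀ i ∈ histSources T t, Measurable (ξ.family i)) :
    Measurable (S.hist ξ l0 l1 t) ∧ Measurable (S.state1 ξ l0 l1 t) := by
  have ht' := Nat.lt_succ_of_le ht
  have hm0 : Measurable (ξ.m0 t) := hξ (.m0 ⟨t, ht'⟩) (le_refl t)
  have hm1 : Measurable (ξ.m1 t) := hξ (.m1 ⟨t, ht'⟩) (le_refl t)
  have hγ : Measurable (ξ.γ t) := hξ (.γ ⟨t, ht'⟩) (le_refl t)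
  induction t with
  | zero =>
    have hx0 : Measurable ξ.x0 := hξ .x0 trivial
    have hx1 : Measurable ξ.x1 := hξ .x1 trivial
    exact ⟨Hist.measurable_start hx0 hm0 (measurable_channel hγ hx1) (measurable_channel hγ hm1),
      hx1⟩
  | succ t ih =>
    have ht₀ : t < T + 1 := by omega
    have hξ' (i : Src T) (hi : i ∈ histSources T t) : Measurable (ξ.family i) :=
      hξ i (stateSources_subset_histSources _ _ (histSources_subset_stateSources_succ _ _ hi))
    have hm1' : Measurable (ξ.m1 t) := hξ' (.m1 ⟨t, ht₀⟩) (le_refl t)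
    obtain ⟨hhist, hstate⟩ := ih (by omega) hξ' ht₀ (hξ' (.m0 ⟨t, ht₀⟩) (le_refl t)) hm1'
      (hξ' (.γ ⟨t, ht₀⟩) (le_refl t))
    obtain ⟨hstate0, hstate1⟩ := S.measurable_state_succ hl (by omega) hhist hstate hm1'
      (hξ (.w0 ⟨t, ht₀⟩) t.lt_succ_self) (hξ (.w1 ⟨t, ht₀⟩) t.lt_succ_self)
    rw [funext fun ω => hist_succ S ξ l0 l1 t ω]
    exact ⟨Hist.measurable_extend hhist ((hl.measurable0 t (by omega)).comp hhist) hstate0 hm0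
      (measurable_channel hγ hstate1) (measurable_channel hγ hm1), hstate1⟩

lemma measurable_hist (hl : MeasurableStrategies l0 l1 T) (ht : t ≤ T)
    (hξ : ∀ i ∈ histSources T t, Measurable (ξ.family i)) : Measurable (S.hist ξ l0 l1 t) :=
  (S.measurable_hist_and_state1 hl ht hξ).1

lemma measurable_states (hl : MeasurableStrategies l0 l1 T) (ht : t ≤ T)
    (hξ : ∀ i ∈ stateSources T t, Measurable (ξ.family i)) :
    Measurable (S.state0 ξ l0 l1 t) ∧ Measurable (S.state1 ξ l0 l1 t) := by
  cases t with
  | zero => exact ⟨hξ .x0 trivial, hξ .x1 trivial⟩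
  | succ t =>
    have ht₀ : t < T + 1 := by omega
    obtain ⟨hhist, hstate⟩ := S.measurable_hist_and_state1 (t := t) hl (by omega) fun i hi =>
      hξ i (histSources_subset_stateSources_succ _ _ hi)
    exact S.measurable_state_succ hl (by omega) hhist hstate (hξ (.m1 ⟨t, ht₀⟩) t.lt_succ_self)
      (hξ (.w0 ⟨t, ht₀⟩) t.lt_succ_self) (hξ (.w1 ⟨t, ht₀⟩) t.lt_succ_self)

lemma measurable_erase_hist (hl : MeasurableStrategies l0 l1 T) (ht : t ≤ T)
    (hξ : ∀ i ∈ stateSources T t, Measurable (ξ.family i)) (hm0 : Measurable (ξ.m0 t)) :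
    Measurable fun ω => (S.hist ξ l0 l1 t ω).erase := by
  cases t with
  | zero =>
    simp only [hist_zero, Hist.erase_start]
    exact Hist.measurable_start (hξ .x0 trivial) hm0 measurable_const measurable_const
  | succ t =>
    have hhist := S.measurable_hist (t := t) hl (by omega) fun i hi =>
      hξ i (histSources_subset_stateSources_succ _ _ hi)
    simp only [hist_succ, Hist.erase_extend]
    exact Hist.measurable_extend hhist ((hl.measurable0 t (by omega)).comp hhist)
      (S.measurable_states hl ht hξ).1 hm0 measurable_const measurable_const

end Measurability

/-- The σ-algebra generated by a set of primitive random variables. -/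
abbrev sig {Ω : Type*} (ξ : Primitives d Ω) {T : ℕ} (s : Set (Src T)) : MeasurableSpace Ω :=
  ⨆ i ∈ s, MeasurableSpace.comap (ξ.family i) (Src.instMeasurableSpace d i)

lemma measurable_sig {Ω : Type*} (ξ : Primitives d Ω) {T : ℕ} {s : Set (Src T)} {i : Src T}
    (hi : i ∈ s) : Measurable[sig ξ s] (ξ.family i) :=
  Measurable.of_comap_le (le_iSup₂_of_le i hi le_rfl)

namespace Realizes

variable {S} {Ω : Type*} [MeasurableSpace Ω] {P : Measure Ω} {T t : ℕ} {ξ : Primitives d Ω}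
  {l0 : Strategy0 d} {l1 : Strategy1 d}

lemma measurable_w0 (hξ : S.Realizes P T ξ) (ht : t ≤ T) : Measurable (ξ.w0 t) :=
  hξ.measurable (.w0 ⟨t, Nat.lt_succ_of_le ht⟩)

lemma measurable_w1 (hξ : S.Realizes P T ξ) (ht : t ≤ T) : Measurable (ξ.w1 t) :=
  hξ.measurable (.w1 ⟨t, Nat.lt_succ_of_le ht⟩)

lemma measurable_m0 (hξ : S.Realizes P T ξ) (ht : t ≤ T) : Measurable (ξ.m0 t) :=
  hξ.measurable (.m0 ⟨t, Nat.lt_succ_of_le ht⟩)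

lemma measurable_m1 (hξ : S.Realizes P T ξ) (ht : t ≤ T) : Measurable (ξ.m1 t) :=
  hξ.measurable (.m1 ⟨t, Nat.lt_succ_of_le ht⟩)

lemma measurable_γ (hξ : S.Realizes P T ξ) (ht : t ≤ T) : Measurable (ξ.γ t) :=
  hξ.measurable (.γ ⟨t, Nat.lt_succ_of_le ht⟩)

lemma measurable_hist (hξ : S.Realizes P T ξ) (hl : MeasurableStrategies l0 l1 T) (ht : t ≤ T) :
    Measurable (S.hist ξ l0 l1 t) :=
  S.measurable_hist hl ht fun i _ => hξ.measurable i

lemma measurable_state1 (hξ : S.Realizes P T ξ) (hl : MeasurableStrategies l0 l1 T) (ht : t ≤ T) :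
    Measurable (S.state1 ξ l0 l1 t) :=
  (S.measurable_states hl ht fun i _ => hξ.measurable i).2

lemma indepFun_of_sig_compl (hξ : S.Realizes P T ξ) {s : Set (Src T)} {α β : Type*}
    [MeasurableSpace α] [MeasurableSpace β] {f : Ω → α} {g : Ω → β} (hf : Measurable[sig ξ s] f)
    (hg : Measurable[sig ξ sᶜ] g) : IndepFun f g P := by
  have h : Indep (sig ξ s) (sig ξ sᶜ) P := indep_iSup_of_disjoint
    (fun i => (hξ.measurable i).comap_le) hξ.indep disjoint_compl_right
  exact indep_of_indep_of_le_left (indep_of_indep_of_le_right h hg.comap_le) hf.comap_le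

lemma indepFun_m1 (hξ : S.Realizes P T ξ) (hl : MeasurableStrategies l0 l1 T) (ht : t ≤ T) :
    IndepFun (ξ.m1 t)
      (fun ω => (((S.hist ξ l0 l1 t ω).erase, S.state1 ξ l0 l1 t ω), ξ.γ t ω)) P := by
  have ht' := Nat.lt_succ_of_le ht
  let s : Set (Src T) := {.m1 ⟨t, ht'⟩}
  have hs (i : Src T) (hi : i ∈ stateSources T t) : Measurable[sig ξ sᶜ] (ξ.family i) :=
    measurable_sig ξ (by rintro rfl; exact lt_irrefl t hi)
  refine hξ.indepFun_of_sig_compl (s := s) (measurable_sig ξ (i := .m1 ⟨t, ht'⟩) rfl) ?_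
  exact ((S.measurable_erase_hist hl ht hs (measurable_sig ξ (i := .m0 ⟨t, ht'⟩)
    (by simp [s]))).prodMk (S.measurable_states hl ht hs).2).prodMk
    (measurable_sig ξ (i := .γ ⟨t, ht'⟩) (by simp [s]))

lemma indepFun_noise (hξ : S.Realizes P T ξ) (hl : MeasurableStrategies l0 l1 T) (ht : t ≤ T) :
    IndepFun (fun ω => (S.hist ξ l0 l1 t ω, S.state1 ξ l0 l1 t ω, ξ.m1 t ω))
      (fun ω => (ξ.w0 t ω, ξ.w1 t ω)) P := by
  have ht' := Nat.lt_succ_of_le ht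
  let s : Set (Src T) := {.w0 ⟨t, ht'⟩, .w1 ⟨t, ht'⟩}
  have hs (i : Src T) (hi : i ∈ histSources T t) : Measurable[sig ξ sᶜ] (ξ.family i) :=
    measurable_sig ξ (by rintro (rfl | rfl) <;> exact lt_irrefl t hi)
  obtain ⟨hhist, hstate⟩ := S.measurable_hist_and_state1 hl ht hs
  refine (hξ.indepFun_of_sig_compl (s := s) ?_ (hhist.prodMk (hstate.prodMk
    (measurable_sig ξ (i := .m1 ⟨t, ht'⟩) (by simp [s]))))).symm
  exact (measurable_sig ξ (i := .w0 ⟨t, ht'⟩) (by simp [s])).prodMk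
    (measurable_sig ξ (i := .w1 ⟨t, ht'⟩) (by simp [s]))

lemma indepFun_next (hξ : S.Realizes P T ξ) (hl : MeasurableStrategies l0 l1 T) (ht : t + 1 ≤ T) :
    IndepFun (fun ω => ((S.hist ξ l0 l1 t ω, S.state1 ξ l0 l1 t ω, ξ.m1 t ω), ξ.w1 t ω))
      (fun ω => (ξ.w0 t ω, ξ.m0 (t + 1) ω, ξ.m1 (t + 1) ω, ξ.γ (t + 1) ω)) P := by
  have ht' : t < T + 1 := by omega
  have hts := Nat.lt_succ_of_le ht
  let s : Set (Src T) := {.w0 ⟨t, ht'⟩, .m0 ⟨t + 1, hts⟩, .m1 ⟨t + 1, hts⟩, .γ ⟨t + 1, hts⟩}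
  have hs (i : Src T) (hi : i ∈ histSources T t) : Measurable[sig ξ sᶜ] (ξ.family i) :=
    measurable_sig ξ (by rintro (rfl | rfl | rfl | rfl) <;> simp [histSources] at hi)
  obtain ⟨hhist, hstate⟩ := S.measurable_hist_and_state1 hl (by omega) hs
  refine (hξ.indepFun_of_sig_compl (s := s) ?_ ((hhist.prodMk (hstate.prodMk
    (measurable_sig ξ (i := .m1 ⟨t, ht'⟩) (by simp [s])))).prodMk
    (measurable_sig ξ (i := .w1 ⟨t, ht'⟩) (by simp [s])))).symm
  exact (measurable_sig ξ (i := .w0 ⟨t, ht'⟩) (by simp [s])).prodMk <|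
    (measurable_sig ξ (i := .m0 ⟨t + 1, hts⟩) (by simp [s])).prodMk <|
    (measurable_sig ξ (i := .m1 ⟨t + 1, hts⟩) (by simp [s])).prodMk <|
    measurable_sig ξ (i := .γ ⟨t + 1, hts⟩) (by simp [s])

lemma indepFun_x1 (hξ : S.Realizes P T ξ) :
    IndepFun (fun ω => (ξ.x0 ω, ξ.m0 0 ω, ξ.m1 0 ω, ξ.γ 0 ω)) ξ.x1 P := by
  let s : Set (Src T) := {.x1}
  refine (hξ.indepFun_of_sig_compl (s := s) (measurable_sig ξ (i := .x1) rfl) ?_).symm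
  exact (measurable_sig ξ (i := .x0) (by simp [s])).prodMk <|
    (measurable_sig ξ (i := .m0 0) (by simp [s])).prodMk <|
    (measurable_sig ξ (i := .m1 0) (by simp [s])).prodMk <|
    measurable_sig ξ (i := .γ 0) (by simp [s])

lemma indepFun_modes (hξ : S.Realizes P T ξ) (ht : t ≤ T) {α : Type*} [MeasurableSpace α]
    {V : Ω → α} (hV : Measurable[sig ξ (stateSources T t)] V) :
    IndepFun (ξ.γ t) (fun ω => (ξ.m1 t ω, ξ.m0 t ω, V ω)) P ∧
      IndepFun (ξ.m1 t) (fun ω => (ξ.m0 t ω, V ω)) P ∧ IndepFun (ξ.m0 t) V P := by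
  have ht' := Nat.lt_succ_of_le ht
  have hV_sig {s : Set (Src T)} (hs : stateSources T t ⊆ s) : Measurable[sig ξ s] V :=
    hV.mono (biSup_mono hs) le_rfl
  refine ⟨?_, ?_, ?_⟩
  · refine hξ.indepFun_of_sig_compl (s := {.γ ⟨t, ht'⟩})
      (measurable_sig ξ (i := .γ ⟨t, ht'⟩) rfl) ?_
    exact (measurable_sig ξ (i := .m1 ⟨t, ht'⟩) (by simp)).prodMk <|
      (measurable_sig ξ (i := .m0 ⟨t, ht'⟩) (by simp)).prodMk <|
      hV_sig fun i hi => by rintro rfl; exact lt_irrefl t hi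
  · refine hξ.indepFun_of_sig_compl (s := {.m1 ⟨t, ht'⟩})
      (measurable_sig ξ (i := .m1 ⟨t, ht'⟩) rfl) ?_
    exact (measurable_sig ξ (i := .m0 ⟨t, ht'⟩) (by simp)).prodMk <|
      hV_sig fun i hi => by rintro rfl; exact lt_irrefl t hi
  · refine hξ.indepFun_of_sig_compl (s := {.m0 ⟨t, ht'⟩})
      (measurable_sig ξ (i := .m0 ⟨t, ht'⟩) rfl) ?_
    exact hV_sig fun i hi => by rintro rfl; exact lt_irrefl t hi

end Realizes

end System

/-! ### Averaging over the unobserved mode -/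

lemma measurable_received {Ω α β : Type*} [MeasurableSpace Ω] [MeasurableSpace α]
    [MeasurableSpace β] {z : Ω → α ⊕ Unit} (hz : Measurable z) {f : α → β} (hf : Measurable f)
    {g : Ω → β} (hg : Measurable g) : Measurable fun ω => Sum.elim f (fun _ => g ω) (z ω) := by
  have h : Measurable fun q : (α ⊕ Unit) × Ω => Sum.elim f (fun _ => g q.2) q.1 := by
    convert ((hf.comp measurable_fst).sumElim (hg.comp measurable_snd)).comp
      (MeasurableEquiv.sumProdDistrib α Unit Ω).measurable using 1
    ext ⟨_ | _, ω⟩ <;> rfl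
  exact h.comp (hz.prodMk measurable_id)

namespace System

variable {d : Dims} (S : System d)

/-- The mean of `f(M¹)` given the channel output: `f l` when the mode `l` is received, and the mean
over the law of `M¹` otherwise. -/
def avg {E : Type*} [AddCommMonoid E] [Module ℝ E] (zt : Received d.M1) (f : d.M1 → E) : E :=
  match zt with
  | Sum.inr _ => ∑ m, S.π1 m • f m
  | Sum.inl l => f l

lemma measurable_avg {α E : Type*} [MeasurableSpace α] [MeasurableSpace E] [AddCommMonoid E]
    [Module ℝ E] [MeasurableAdd₂ E] [MeasurableConstSMul ℝ E] {c : α → Received d.M1}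
    (hc : Measurable c) {f : α → d.M1 → E} (hf : ∀ m, Measurable fun a => f a m) :
    Measurable fun a => S.avg (c a) (f a) := by
  refine measurable_switch (f := fun k a => S.avg k (f a)) hc ?_
  rintro (l | _)
  · exact hf l
  · exact Finset.measurable_sum _ fun m _ => (hf m).const_smul (S.π1 m)

lemma avg_comp {ι κ : Type*} (zt : Received d.M1) (f : d.M1 → ι → ℝ) (g : κ → ι) :
    S.avg zt f ∘ g = S.avg zt fun m => f m ∘ g := by
  rcases zt with l | _
  · rfl
  · ext i
    simp [avg]

variable {S}

lemma avg_const (hπ : ∑ m, S.π1 m = 1) {E : Type*} [AddCommGroup E] [Module ℝ E]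
    (zt : Received d.M1) (a : E) : S.avg zt (fun _ => a) = a := by
  rcases zt with l | _
  · rfl
  · exact (Finset.sum_smul ..).symm.trans (by rw [hπ, one_smul])

lemma erase_hist_of_dropped {Ω : Type*} {ξ : Primitives d Ω} {l0 : Strategy0 d}
    {l1 : Strategy1 d} {t : ℕ} {ω : Ω} (h : ξ.γ t ω = false) :
    (S.hist ξ l0 l1 t ω).erase = S.hist ξ l0 l1 t ω :=
  Hist.erase_eq_self _ (by simp [hist_z, channel, h]) (by simp [hist_zt, channel, h])

namespace Realizes

variable {Ω : Type*} [MeasurableSpace Ω] {P : Measure Ω} [IsProbabilityMeasure P] {T t : ℕ}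
  {ξ : Primitives d Ω} {l0 : Strategy0 d} {l1 : Strategy1 d}

lemma sum_π1 (hξ : S.Realizes P T ξ) : ∑ m, S.π1 m = 1 := by
  have hm := hξ.measurable_m1 (Nat.zero_le T)
  have : IsProbabilityMeasure S.lawM1 := by
    rw [← hξ.law_m1 0 (Nat.zero_le T)]
    exact Measure.isProbabilityMeasure_map hm.aemeasurable
  simp only [π1, sum_measureReal_singleton, Finset.coe_univ, probReal_univ]

variable {E : Type*} [NormedAddCommGroup E] [NormedSpace ℝ E] [CompleteSpace E]
  [MeasurableSpace E] [BorelSpace E] [SecondCountableTopology E]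

lemma integral_avg (hξ : S.Realizes P T ξ) (hl : MeasurableStrategies l0 l1 T)
    (hpos : ∀ m : d.M1, 0 < S.π1 m) (ht : t ≤ T) {f : d.Hist t × d.X1 → d.M1 → E}
    (hf : ∀ m, Measurable fun a => f a m)
    (hint : Integrable (fun ω => f (S.hist ξ l0 l1 t ω, S.state1 ξ l0 l1 t ω) (ξ.m1 t ω)) P) :
    Integrable (fun ω =>
      S.avg (S.hist ξ l0 l1 t ω).zt (f (S.hist ξ l0 l1 t ω, S.state1 ξ l0 l1 t ω))) P ∧
    ∫ ω, S.avg (S.hist ξ l0 l1 t ω).zt (f (S.hist ξ l0 l1 t ω, S.state1 ξ l0 l1 t ω)) ∂P =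
      ∫ ω, f (S.hist ξ l0 l1 t ω, S.state1 ξ l0 l1 t ω) (ξ.m1 t ω) ∂P := by
  have hm1 := hξ.measurable_m1 ht
  have hγ := hξ.measurable_γ ht
  let V : Ω → (d.Hist t × d.X1) × Bool := fun ω =>
    (((S.hist ξ l0 l1 t ω).erase, S.state1 ξ l0 l1 t ω), ξ.γ t ω)
  have hV : Measurable V :=
    ((Hist.measurable_erase.comp (hξ.measurable_hist hl ht)).prodMk
      (hξ.measurable_state1 hl ht)).prodMk hγ
  -- The part of `f` on the event that the channel drops; there the history does not depend on `M¹`.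
  let g : d.M1 → (d.Hist t × d.X1) × Bool → E := fun m v => if v.2 then 0 else f v.1 m
  have hg (m : d.M1) : Measurable (g m) :=
    Measurable.ite (measurable_snd (measurableSet_singleton true)) measurable_const
      ((hf m).comp measurable_fst)
  have avg_eq (ω : Ω) :
      S.avg (S.hist ξ l0 l1 t ω).zt (f (S.hist ξ l0 l1 t ω, S.state1 ξ l0 l1 t ω)) =
        f (S.hist ξ l0 l1 t ω, S.state1 ξ l0 l1 t ω) (ξ.m1 t ω) +
          (∑ m, S.π1 m • g m (V ω) - g (ξ.m1 t ω) (V ω)) := by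
    rw [hist_zt]
    cases h : ξ.γ t ω
    · simp [g, V, h, erase_hist_of_dropped h, channel, avg]
    · simp [g, V, h, channel, avg]
  have hg_int : Integrable (fun ω => g (ξ.m1 t ω) (V ω)) P := by
    refine (hint.indicator (hγ (measurableSet_singleton false))).congr (.of_forall fun ω => ?_)
    cases h : ξ.γ t ω <;> simp [g, V, h, Set.indicator, erase_hist_of_dropped]
  have hpos' (m : d.M1) : 0 < (P.map (ξ.m1 t)).real {m} := by
    rw [hξ.law_m1 t ht]
    exact hpos m
  obtain ⟨hsum_int, integral_sum⟩ := integral_sum_smul_of_indepFun hm1 hV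
    (hξ.indepFun_m1 hl ht) hg hg_int hpos'
  simp only [hξ.law_m1 t ht] at hsum_int integral_sum
  simp only [avg_eq]
  refine ⟨hint.add (hsum_int.sub hg_int),
    (integral_add hint (hsum_int.sub hg_int)).trans ?_⟩
  rw [integral_sub' hsum_int hg_int, integral_sum, sub_self, add_zero]

-- Given the common information, `M¹_t` is either known or still has its law, so that `avg` is a
-- conditional expectation.
lemma condCentered_sub_avg (hξ : S.Realizes P T ξ) (hl : MeasurableStrategies l0 l1 T)
    (hpos : ∀ m : d.M1, 0 < S.π1 m) (ht : t ≤ T) {f : d.Hist t → d.M1 → E}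
    (hf : ∀ m, Measurable fun h => f h m)
    (hint : Integrable (fun ω => f (S.hist ξ l0 l1 t ω) (ξ.m1 t ω)) P) :
    CondCentered (S.hist ξ l0 l1 t) (fun ω => f (S.hist ξ l0 l1 t ω) (ξ.m1 t ω) -
      S.avg (S.hist ξ l0 l1 t ω).zt (f (S.hist ξ l0 l1 t ω))) P := by
  have hF := hξ.measurable_hist hl ht
  have avg_int := (hξ.integral_avg hl hpos ht (f := fun a => f a.1)
    (fun m => (hf m).comp measurable_fst) hint).1
  refine (condCentered_iff_setIntegral_eq_zero hF (hint.sub avg_int)).2 fun B hB => ?_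
  have integral_avg_indicator := (hξ.integral_avg hl hpos ht
    (f := fun a m => B.indicator (fun h => f h m) a.1)
    (fun m => ((hf m).indicator hB).comp measurable_fst) (hint.indicator (hF hB))).2
  have avg_indicator (h : d.Hist t) : S.avg h.zt (fun m => B.indicator (fun h => f h m) h) =
      B.indicator (fun h => S.avg h.zt (f h)) h := by
    by_cases hh : h ∈ B
    · simp only [Set.indicator_of_mem hh]
    · simp only [Set.indicator_of_notMem hh, avg_const hξ.sum_π1]
  simp only [avg_indicator] at integral_avg_indicator
  refine (integral_sub hint.integrableOn avg_int.integrableOn).trans (sub_eq_zero.2 ?_)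
  rw [← integral_indicator (hF hB), ← integral_indicator (hF hB)]
  exact integral_avg_indicator.symm

lemma memLp_avg (hξ : S.Realizes P T ξ) (hl : MeasurableStrategies l0 l1 T)
    (hpos : ∀ m : d.M1, 0 < S.π1 m) (ht : t ≤ T) {f : d.Hist t → d.M1 → E}
    (hf : ∀ m, Measurable fun h => f h m)
    (hL : MemLp (fun ω => f (S.hist ξ l0 l1 t ω) (ξ.m1 t ω)) 2 P) :
    MemLp (fun ω => S.avg (S.hist ξ l0 l1 t ω).zt (f (S.hist ξ l0 l1 t ω))) 2 P := by
  have hint := hL.integrable one_le_two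
  have avg_int := (hξ.integral_avg hl hpos ht (f := fun a => f a.1)
    (fun m => (hf m).comp measurable_fst) hint).1
  have condExp_eq := condExp_eq_of_condCentered_sub (hξ.measurable_hist hl ht) hint
    (S.measurable_avg Hist.measurable_zt hf) avg_int (hξ.condCentered_sub_avg hl hpos ht hf hint)
  exact (memLp_congr_ae condExp_eq).1 (hL.condExp one_le_two)

end Realizes

end System

/-! ### Conditional means along the closed loop -/

/-- A function `b` standing for the conditional mean `b t h m` of `U¹_t` given `H⁰_t = h` and
`M¹_t = m`. -/
abbrev MeanAction (d : Dims) : Type := ∀ t : ℕ, d.Hist t → d.M1 → d.U1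

namespace System

variable {d : Dims} (S : System d)

/-- Borel measurability up to the horizon of a pair of strategies and of a mean action `b`. -/
structure MeasurableMeans (l0 : Strategy0 d) (l1 : Strategy1 d) (b : MeanAction d)
    (T : ℕ) : Prop extends MeasurableStrategies l0 l1 T where
  measurable_mean : ∀ t ≤ T, ∀ m, Measurable (b t · m)

section Estimate

variable (l0 : Strategy0 d) (b : MeanAction d)

/-- The recursive estimate of the local state when controller `1` plays `b` in the mean: the state
itself when it is received, and the prediction from the previous estimate otherwise. -/
def est : ∀ t : ℕ, d.Hist t → d.X1
  | 0, h => Sum.elim id (fun _ => ∫ x, x ∂S.lawX1) h.z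
  | t + 1, h => Sum.elim id (fun _ => S.avg h.past.zt (fun m => S.D h.past.m0 m *ᵥ
      vec h.past.x0 (est t h.past) (l0 t h.past) (b t h.past m)) ∘ Sum.inr) h.z

/-- The conditional mean of the states and actions given the common information and the mode. -/
def zbar (t : ℕ) (h : d.Hist t) (m : d.M1) : d.IX ⊕ d.IU → ℝ :=
  vec h.x0 (S.est l0 b t h) (l0 t h) (b t h m)

/-- The conditional mean of the next states, before the noise, given the common information. -/
def pred (t : ℕ) (h : d.Hist t) : d.IX → ℝ :=
  S.avg h.zt fun m => S.D h.m0 m *ᵥ S.zbar l0 b t h m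

lemma est_succ (t : ℕ) (h : d.Hist (t + 1)) :
    S.est l0 b (t + 1) h = Sum.elim id (fun _ => S.pred l0 b t h.past ∘ Sum.inr) h.z := rfl

lemma est_of_received {t : ℕ} (h : d.Hist t) {x : d.X1} (hz : h.z = Sum.inl x) :
    S.est l0 b t h = x := by
  cases t with
  | zero => simp [est, hz]
  | succ t => simp [est_succ, hz]

variable {l0 b} {l1 : Strategy1 d} {T t : ℕ}

lemma measurable_est (hm : MeasurableMeans l0 l1 b T) (ht : t ≤ T) : Measurable (S.est l0 b t) := by
  induction t with
  | zero => exact measurable_received Hist.measurable_z measurable_id measurable_const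
  | succ t ih =>
    have ht' : t ≤ T := (Nat.le_succ t).trans ht
    have hpred (m : d.M1) : Measurable fun h => S.D (Hist.m0 h) m *ᵥ S.zbar l0 b t h m :=
      measurable_switch_mulVec Hist.measurable_m0 (fun m0 => S.D m0 m)
        (measurable_vec Hist.measurable_x0 (ih ht') (hm.measurable0 t ht')
          (hm.measurable_mean t ht' m))
    exact measurable_received Hist.measurable_z measurable_id (measurable_comp_index
      ((S.measurable_avg Hist.measurable_zt hpred).comp Hist.measurable_past) Sum.inr)

lemma measurable_zbar (hm : MeasurableMeans l0 l1 b T) (ht : t ≤ T) (m : d.M1) :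
    Measurable (S.zbar l0 b t · m) :=
  measurable_vec Hist.measurable_x0 (S.measurable_est hm ht) (hm.measurable0 t ht)
    (hm.measurable_mean t ht m)

lemma measurable_D_zbar (hm : MeasurableMeans l0 l1 b T) (ht : t ≤ T) (m : d.M1) :
    Measurable fun h : d.Hist t => S.D h.m0 m *ᵥ S.zbar l0 b t h m :=
  measurable_switch_mulVec Hist.measurable_m0 (fun m0 => S.D m0 m) (S.measurable_zbar hm ht m)

lemma measurable_pred (hm : MeasurableMeans l0 l1 b T) (ht : t ≤ T) : Measurable (S.pred l0 b t) :=
  S.measurable_avg Hist.measurable_zt (S.measurable_D_zbar hm ht)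

end Estimate

lemma D_mulVec_inl (m0 : d.M0) (m1 : d.M1) (x0 : d.X0) (x1 : d.X1) (u0 : d.U0) (u1 : d.U1) :
    (S.D m0 m1 *ᵥ vec x0 x1 u0 u1) ∘ Sum.inl = S.A00 m0 *ᵥ x0 + S.B00 m0 *ᵥ u0 := by
  rw [D_mulVec_vec, A, B, Matrix.fromBlocks_mulVec, Matrix.fromBlocks_mulVec]
  ext i
  simp

lemma D_mulVec_inr (m0 : d.M0) (m1 : d.M1) (e : d.X1) (q : d.U1) :
    (S.D m0 m1 *ᵥ vec 0 e 0 q) ∘ Sum.inr = S.D11 m0 m1 *ᵥ Sum.elim e q := by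
  rw [D_mulVec_vec, A, B, Matrix.fromBlocks_mulVec, Matrix.fromBlocks_mulVec, D11,
    Matrix.fromCols_mulVec_sumElim]
  ext i
  simp

lemma vec_add (x0 y0 : d.X0) (x1 y1 : d.X1) (u0 v0 : d.U0) (u1 v1 : d.U1) :
    vec (x0 + y0) (x1 + y1) (u0 + v0) (u1 + v1) = vec x0 x1 u0 u1 + vec y0 y1 v0 v1 := by
  ext i
  rcases i with (i | i) | (i | i) <;> rfl

section Deviations

variable {Ω : Type*} (ξ : Primitives d Ω) (l0 : Strategy0 d) (l1 : Strategy1 d)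
  (b : MeanAction d) (t : ℕ)

/-- The deviations of local state and action from their conditional means. -/
def dev (ω : Ω) : Fin d.x1 ⊕ Fin d.u1 → ℝ :=
  Sum.elim (S.state1 ξ l0 l1 t ω - S.est l0 b t (S.hist ξ l0 l1 t ω))
    (S.action1 ξ l0 l1 t ω - b t (S.hist ξ l0 l1 t ω) (ξ.m1 t ω))

/-- The deviation of the mean next local state given the mode from its predicted mean. -/
def modeDev (h : d.Hist t) (m : d.M1) : d.X1 :=
  (S.D h.m0 m *ᵥ S.zbar l0 b t h m - S.pred l0 b t h) ∘ Sum.inr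

/-- The deviation of the next local state, before the noise, from its predicted mean. -/
def innov (ω : Ω) : d.X1 :=
  S.modeDev l0 b t (S.hist ξ l0 l1 t ω) (ξ.m1 t ω) +
    S.D11 (ξ.m0 t ω) (ξ.m1 t ω) *ᵥ S.dev ξ l0 l1 b t ω

/-- `innov` as a function of the common information, the local state and the local mode. -/
def innovFun (a : d.Hist t × d.X1 × d.M1) : d.X1 :=
  (S.D a.1.m0 a.2.2 *ᵥ vec a.1.x0 a.2.1 (l0 t a.1) (l1 t a) - S.pred l0 b t a.1) ∘ Sum.inr

lemma vec_eq_zbar_add (ω : Ω) :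
    vec (S.state0 ξ l0 l1 t ω) (S.state1 ξ l0 l1 t ω) (S.action0 ξ l0 l1 t ω)
      (S.action1 ξ l0 l1 t ω) = S.zbar l0 b t (S.hist ξ l0 l1 t ω) (ξ.m1 t ω) +
      vec 0 (S.state1 ξ l0 l1 t ω - S.est l0 b t (S.hist ξ l0 l1 t ω)) 0
        (S.action1 ξ l0 l1 t ω - b t (S.hist ξ l0 l1 t ω) (ξ.m1 t ω)) := by
  rw [zbar, ← vec_add]
  simp [state0, action0]

lemma drift_inr (ω : Ω) : S.drift ξ l0 l1 t ω ∘ Sum.inr =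
    S.pred l0 b t (S.hist ξ l0 l1 t ω) ∘ Sum.inr + S.innov ξ l0 l1 b t ω := by
  have h := S.D_mulVec_inr (ξ.m0 t ω) (ξ.m1 t ω)
    (S.state1 ξ l0 l1 t ω - S.est l0 b t (S.hist ξ l0 l1 t ω))
    (S.action1 ξ l0 l1 t ω - b t (S.hist ξ l0 l1 t ω) (ξ.m1 t ω))
  rw [innov, dev, ← h, drift, S.vec_eq_zbar_add ξ l0 l1 b, Matrix.mulVec_add, modeDev, hist_m0]
  ext i
  simp only [Function.comp_apply, Pi.add_apply, Pi.sub_apply]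
  ring

lemma innovFun_eq (ω : Ω) :
    S.innovFun l0 l1 b t (S.hist ξ l0 l1 t ω, S.state1 ξ l0 l1 t ω, ξ.m1 t ω) =
      S.innov ξ l0 l1 b t ω := by
  have h := S.drift_inr ξ l0 l1 b t ω
  rw [← sub_eq_iff_eq_add'] at h
  rw [← h, innovFun, hist_m0]
  rfl

lemma drift_inl (hπ : ∑ m, S.π1 m = 1) (ω : Ω) : S.drift ξ l0 l1 t ω ∘ Sum.inl =
    S.pred l0 b t (S.hist ξ l0 l1 t ω) ∘ Sum.inl := by
  rw [drift, pred, avg_comp]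
  simp only [zbar, D_mulVec_inl]
  rw [avg_const hπ, hist_m0]
  rfl

lemma state1_succ_eq (ω : Ω) : S.state1 ξ l0 l1 (t + 1) ω =
    S.pred l0 b t (S.hist ξ l0 l1 t ω) ∘ Sum.inr + (S.innov ξ l0 l1 b t ω + ξ.w1 t ω) := by
  rw [state1_succ, S.drift_inr ξ l0 l1 b, add_assoc]

lemma state0_succ_eq (hπ : ∑ m, S.π1 m = 1) (ω : Ω) : S.state0 ξ l0 l1 (t + 1) ω =
    S.pred l0 b t (S.hist ξ l0 l1 t ω) ∘ Sum.inl + ξ.w0 t ω := by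
  rw [state0_succ, S.drift_inl ξ l0 l1 b t hπ]

lemma est_erase_succ (ω : Ω) : S.est l0 b (t + 1) (S.hist ξ l0 l1 (t + 1) ω).erase =
    S.pred l0 b t (S.hist ξ l0 l1 t ω) ∘ Sum.inr := by
  rw [est_succ, Hist.z_erase, Hist.past_erase, hist_succ, Hist.past_extend]
  rfl

lemma est_erase_zero (ω : Ω) :
    S.est l0 b 0 (S.hist ξ l0 l1 0 ω).erase = ∫ x, x ∂S.lawX1 := by
  rw [est, Hist.z_erase]
  rfl

lemma est_hist (ω : Ω) : S.est l0 b t (S.hist ξ l0 l1 t ω) =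
    if ξ.γ t ω then S.state1 ξ l0 l1 t ω else S.est l0 b t (S.hist ξ l0 l1 t ω).erase := by
  cases h : ξ.γ t ω
  · simp [erase_hist_of_dropped h]
  · simpa using S.est_of_received l0 b _ (by simp [hist_z, channel, h])

end Deviations

variable {Ω : Type*} [MeasurableSpace Ω]

/-- At time `t` the states are square integrable and `est` is the conditional mean of the local
state before transmission, that is, given the common information with the current channel output
erased. -/
structure StateMean (P : Measure Ω) (ξ : Primitives d Ω) (l0 : Strategy0 d) (l1 : Strategy1 d)
    (b : MeanAction d) (t : ℕ) : Prop where
  memLp_state0 : MemLp (S.state0 ξ l0 l1 t) 2 P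
  memLp_state1 : MemLp (S.state1 ξ l0 l1 t) 2 P
  memLp_est_erase : MemLp (fun ω => S.est l0 b t (S.hist ξ l0 l1 t ω).erase) 2 P
  state1_centered : CondCentered (fun ω => ((S.hist ξ l0 l1 t ω).erase, ξ.m1 t ω, ξ.γ t ω))
    (fun ω => S.state1 ξ l0 l1 t ω - S.est l0 b t (S.hist ξ l0 l1 t ω).erase) P

/-- At time `t` the actions are square integrable and `b` is the conditional mean of the local
action given the common information and the mode. -/
structure ActionMean (P : Measure Ω) (ξ : Primitives d Ω) (l0 : Strategy0 d) (l1 : Strategy1 d)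
    (b : MeanAction d) (t : ℕ) : Prop where
  memLp_action0 : MemLp (S.action0 ξ l0 l1 t) 2 P
  memLp_action1 : MemLp (S.action1 ξ l0 l1 t) 2 P
  memLp_mean : MemLp (fun ω => b t (S.hist ξ l0 l1 t ω) (ξ.m1 t ω)) 2 P
  action1_centered : CondCentered (fun ω => (S.hist ξ l0 l1 t ω, ξ.m1 t ω))
    (fun ω => S.action1 ξ l0 l1 t ω - b t (S.hist ξ l0 l1 t ω) (ξ.m1 t ω)) P

/-- At time `t` the functions `est` and `b` are the conditional means of the local state and
action, and all states and actions are square integrable. -/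
structure ConditionalMeans (P : Measure Ω) (ξ : Primitives d Ω) (l0 : Strategy0 d)
    (l1 : Strategy1 d) (b : MeanAction d) (t : ℕ) : Prop extends
    StateMean S P ξ l0 l1 b t, ActionMean S P ξ l0 l1 b t

variable {S} {P : Measure Ω} {T t : ℕ} {ξ : Primitives d Ω} {l0 : Strategy0 d} {l1 : Strategy1 d}
  {b : MeanAction d}

lemma StateMean.memLp_est (hA : S.StateMean P ξ l0 l1 b t) (hξ : S.Realizes P T ξ)
    (ht : t ≤ T) : MemLp (fun ω => S.est l0 b t (S.hist ξ l0 l1 t ω)) 2 P := by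
  simp only [S.est_hist ξ l0 l1 b]
  refine memLp_switch (f := fun (g : Bool) ω => if g then S.state1 ξ l0 l1 t ω else
    S.est l0 b t (S.hist ξ l0 l1 t ω).erase) (hξ.measurable_γ ht) ?_
  rintro (_ | _)
  · simpa only [Bool.false_eq_true, if_false] using hA.memLp_est_erase
  · simpa only [if_true] using hA.memLp_state1

lemma StateMean.centered_hist [IsFiniteMeasure P] (hA : S.StateMean P ξ l0 l1 b t)
    (hξ : S.Realizes P T ξ) (hl : MeasurableStrategies l0 l1 T) (ht : t ≤ T) :
    CondCentered (fun ω => (S.hist ξ l0 l1 t ω, ξ.m1 t ω))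
      (fun ω => S.state1 ξ l0 l1 t ω - S.est l0 b t (S.hist ξ l0 l1 t ω)) P := by
  have hh := hξ.measurable_hist hl ht
  have hm := hξ.measurable_m1 ht
  let F : Ω → d.Hist t × d.M1 × Bool :=
    fun ω => ((S.hist ξ l0 l1 t ω).erase, ξ.m1 t ω, ξ.γ t ω)
  have hF : Measurable F :=
    (Hist.measurable_erase.comp hh).prodMk (hm.prodMk (hξ.measurable_γ ht))
  have centered := hA.state1_centered.indicator_of_eqOn
    (G := fun ω => (S.hist ξ l0 l1 t ω, ξ.m1 t ω))
    (g := fun a => (a.1, a.2.1)) (s := {a | a.2.2 = false}) hF (hh.prodMk hm)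
    ((hA.memLp_state1.sub hA.memLp_est_erase).integrable one_le_two)
    (measurable_snd.snd (measurableSet_singleton false)) (by fun_prop)
    fun ω hω => Prod.ext (erase_hist_of_dropped hω).symm rfl
  convert centered using 1
  ext1 ω
  cases h : ξ.γ t ω
  · rw [Set.indicator_of_mem (show ω ∈ F ⁻¹' {a | a.2.2 = false} from h), erase_hist_of_dropped h]
  · rw [Set.indicator_of_notMem (fun hω => Bool.false_ne_true (hω.symm.trans h)), S.est_hist, h,
      if_pos rfl, sub_self]

lemma measurable_innovFun (hm : MeasurableMeans l0 l1 b T) (ht : t ≤ T) :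
    Measurable (S.innovFun l0 l1 b t) := by
  have hD : Measurable fun a : d.Hist t × d.X1 × d.M1 =>
      S.D a.1.m0 a.2.2 *ᵥ vec a.1.x0 a.2.1 (l0 t a.1) (l1 t a) :=
    measurable_switch_mulVec (c := fun a : d.Hist t × d.X1 × d.M1 => (a.1.m0, a.2.2))
      ((Hist.measurable_m0.comp measurable_fst).prodMk (by fun_prop))
      (fun k => S.D k.1 k.2) (measurable_vec (Hist.measurable_x0.comp measurable_fst)
        (by fun_prop) ((hm.measurable0 t ht).comp measurable_fst) (hm.measurable1 t ht))
  exact measurable_comp_index (hD.sub ((S.measurable_pred hm ht).comp measurable_fst)) Sum.inr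

namespace ConditionalMeans

lemma memLp_zbar (hM : S.ConditionalMeans P ξ l0 l1 b t) (hξ : S.Realizes P T ξ) (ht : t ≤ T) :
    MemLp (fun ω => S.zbar l0 b t (S.hist ξ l0 l1 t ω) (ξ.m1 t ω)) 2 P :=
  memLp_sumElim (memLp_sumElim hM.memLp_state0 (hM.memLp_est hξ ht))
    (memLp_sumElim hM.memLp_action0 hM.memLp_mean)

lemma memLp_dev (hM : S.ConditionalMeans P ξ l0 l1 b t) (hξ : S.Realizes P T ξ) (ht : t ≤ T) :
    MemLp (S.dev ξ l0 l1 b t) 2 P :=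
  memLp_sumElim (hM.memLp_state1.sub (hM.memLp_est hξ ht)) (hM.memLp_action1.sub hM.memLp_mean)

lemma dev_centered [IsFiniteMeasure P] (hM : S.ConditionalMeans P ξ l0 l1 b t)
    (hξ : S.Realizes P T ξ) (hl : MeasurableStrategies l0 l1 T) (ht : t ≤ T) :
    CondCentered (fun ω => (S.hist ξ l0 l1 t ω, ξ.m1 t ω)) (S.dev ξ l0 l1 b t) P :=
  (hM.centered_hist hξ hl ht).sumElim hM.action1_centered
    ((hM.memLp_state1.sub (hM.memLp_est hξ ht)).integrable one_le_two)
    ((hM.memLp_action1.sub hM.memLp_mean).integrable one_le_two)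

lemma memLp_D_zbar (hM : S.ConditionalMeans P ξ l0 l1 b t) (hξ : S.Realizes P T ξ)
    (hl : MeasurableStrategies l0 l1 T) (ht : t ≤ T) :
    MemLp (fun ω => S.D (S.hist ξ l0 l1 t ω).m0 (ξ.m1 t ω) *ᵥ
      S.zbar l0 b t (S.hist ξ l0 l1 t ω) (ξ.m1 t ω)) 2 P :=
  memLp_switch_mulVec (c := fun ω => ((S.hist ξ l0 l1 t ω).m0, ξ.m1 t ω))
    ((Hist.measurable_m0.comp (hξ.measurable_hist hl ht)).prodMk (hξ.measurable_m1 ht))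
    (fun k => S.D k.1 k.2) (hM.memLp_zbar hξ ht)

lemma memLp_D11_dev (hM : S.ConditionalMeans P ξ l0 l1 b t) (hξ : S.Realizes P T ξ)
    (ht : t ≤ T) : MemLp (fun ω => S.D11 (ξ.m0 t ω) (ξ.m1 t ω) *ᵥ S.dev ξ l0 l1 b t ω) 2 P :=
  memLp_switch_mulVec (c := fun ω => (ξ.m0 t ω, ξ.m1 t ω))
    ((hξ.measurable_m0 ht).prodMk (hξ.measurable_m1 ht)) (fun k => S.D11 k.1 k.2)
    (hM.memLp_dev hξ ht)

lemma D11_dev_centered [IsFiniteMeasure P] (hM : S.ConditionalMeans P ξ l0 l1 b t)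
    (hξ : S.Realizes P T ξ) (hl : MeasurableStrategies l0 l1 T) (ht : t ≤ T) :
    CondCentered (fun ω => (S.hist ξ l0 l1 t ω, ξ.m1 t ω))
      (fun ω => S.D11 (ξ.m0 t ω) (ξ.m1 t ω) *ᵥ S.dev ξ l0 l1 b t ω) P := by
  have h := (hM.dev_centered hξ hl ht).switch_mulVec
    ((hξ.measurable_hist hl ht).prodMk (hξ.measurable_m1 ht))
    (c := fun a : d.Hist t × d.M1 => (a.1.m0, a.2))
    ((Hist.measurable_m0.comp measurable_fst).prodMk measurable_snd)
    ((hM.memLp_dev hξ ht).integrable one_le_two) (fun k => S.D11 k.1 k.2)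
  simpa only [hist_m0] using h

end ConditionalMeans

namespace Realizes

lemma measurable_innov (hξ : S.Realizes P T ξ) (hm : MeasurableMeans l0 l1 b T) (ht : t ≤ T) :
    Measurable (S.innov ξ l0 l1 b t) := by
  have hl := hm.toMeasurableStrategies
  have h := (S.measurable_innovFun hm ht).comp ((hξ.measurable_hist hl ht).prodMk
    ((hξ.measurable_state1 hl ht).prodMk (hξ.measurable_m1 ht)))
  simpa only [Function.comp_def, innovFun_eq] using h

lemma indepFun_innov_next (hξ : S.Realizes P T ξ) (hm : MeasurableMeans l0 l1 b T)
    (ht : t + 1 ≤ T) :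
    IndepFun (fun ω => (S.hist ξ l0 l1 t ω, S.innov ξ l0 l1 b t ω + ξ.w1 t ω))
      (fun ω => (ξ.w0 t ω, ξ.m0 (t + 1) ω, ξ.m1 (t + 1) ω, ξ.γ (t + 1) ω)) P := by
  have hφ : Measurable fun a : (d.Hist t × d.X1 × d.M1) × d.X1 =>
      (a.1.1, S.innovFun l0 l1 b t a.1 + a.2) :=
    (by fun_prop : Measurable fun a : (d.Hist t × d.X1 × d.M1) × d.X1 => a.1.1).prodMk
      (((S.measurable_innovFun hm (Nat.le_of_succ_le ht)).comp measurable_fst).add measurable_snd)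
  have h := (hξ.indepFun_next hm.toMeasurableStrategies ht).comp hφ measurable_id
  simpa only [Function.comp_def, innovFun_eq, id_eq] using h

lemma memLp_w0 (hξ : S.Realizes P T ξ) (hS : S.Standing T) (ht : t ≤ T) : MemLp (ξ.w0 t) 2 P :=
  (hS.w0_sq t ht).comp_measurePreserving ⟨hξ.measurable_w0 ht, hξ.law_w0 t ht⟩

lemma memLp_w1 (hξ : S.Realizes P T ξ) (hS : S.Standing T) (ht : t ≤ T) : MemLp (ξ.w1 t) 2 P :=
  (hS.w1_sq t ht).comp_measurePreserving ⟨hξ.measurable_w1 ht, hξ.law_w1 t ht⟩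

lemma memLp_x0 (hξ : S.Realizes P T ξ) (hS : S.Standing T) : MemLp ξ.x0 2 P :=
  hS.x0_sq.comp_measurePreserving ⟨hξ.measurable .x0, hξ.law_x0⟩

lemma memLp_x1 (hξ : S.Realizes P T ξ) (hS : S.Standing T) : MemLp ξ.x1 2 P :=
  hS.x1_sq.comp_measurePreserving ⟨hξ.measurable .x1, hξ.law_x1⟩

variable [IsProbabilityMeasure P]

lemma w0_centered (hξ : S.Realizes P T ξ) (hS : S.Standing T)
    (hl : MeasurableStrategies l0 l1 T) (ht : t ≤ T) :
    CondCentered (S.hist ξ l0 l1 t) (ξ.w0 t) P :=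
  .of_indepFun (hξ.measurable_hist hl ht) (hξ.measurable_w0 ht)
    ((hξ.indepFun_noise hl ht).comp measurable_fst measurable_fst)
    ((MeasurePreserving.mk (hξ.measurable_w0 ht) (hξ.law_w0 t ht)).hasLaw.integral_eq.trans
      (hS.w0_mean t ht))

lemma w1_centered (hξ : S.Realizes P T ξ) (hS : S.Standing T)
    (hl : MeasurableStrategies l0 l1 T) (ht : t ≤ T) :
    CondCentered (fun ω => (S.hist ξ l0 l1 t ω, S.state1 ξ l0 l1 t ω, ξ.m1 t ω)) (ξ.w1 t) P :=
  .of_indepFun ((hξ.measurable_hist hl ht).prodMk ((hξ.measurable_state1 hl ht).prodMk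
      (hξ.measurable_m1 ht))) (hξ.measurable_w1 ht)
    ((hξ.indepFun_noise hl ht).comp measurable_id measurable_snd)
    ((MeasurePreserving.mk (hξ.measurable_w1 ht) (hξ.law_w1 t ht)).hasLaw.integral_eq.trans
      (hS.w1_mean t ht))

end Realizes

variable [IsProbabilityMeasure P]

lemma StateMean.zero (hξ : S.Realizes P T ξ) (hS : S.Standing T) :
    S.StateMean P ξ l0 l1 b 0 := by
  have hx1 : Measurable ξ.x1 := hξ.measurable .x1
  have hx0 : Measurable ξ.x0 := hξ.measurable .x0
  have hT := Nat.zero_le T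
  have hsq := hξ.memLp_x1 hS
  have hF : Measurable fun ω => (ξ.x0 ω, ξ.m0 0 ω, ξ.m1 0 ω, ξ.γ 0 ω) :=
    hx0.prodMk ((hξ.measurable_m0 hT).prodMk ((hξ.measurable_m1 hT).prodMk (hξ.measurable_γ hT)))
  have mean_zero : ∫ ω, (ξ.x1 ω - ∫ x, x ∂S.lawX1) ∂P = 0 := by
    rw [integral_sub (hsq.integrable one_le_two) (integrable_const _), integral_const,
      probReal_univ, one_smul, (MeasurePreserving.mk hx1 hξ.law_x1).hasLaw.integral_eq, sub_self]
  have centered : CondCentered (fun ω => (ξ.x0 ω, ξ.m0 0 ω, ξ.m1 0 ω, ξ.γ 0 ω))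
      (fun ω => ξ.x1 ω - ∫ x, x ∂S.lawX1) P :=
    .of_indepFun hF (hx1.sub_const _)
      (hξ.indepFun_x1.comp measurable_id (measurable_id.sub_const _)) mean_zero
  have hstart : Measurable fun a : d.X0 × d.M0 × d.M1 × Bool =>
      (Hist.start a.1 a.2.1 (Sum.inr ()) (Sum.inr ()), a.2.2.1, a.2.2.2) :=
    (Hist.measurable_start measurable_fst (by fun_prop) measurable_const
      measurable_const).prodMk (by fun_prop)
  refine ⟨hξ.memLp_x0 hS, hsq, ?_, ?_⟩
  · simp only [S.est_erase_zero ξ l0 l1 b]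
    exact memLp_const _
  · simp only [S.est_erase_zero ξ l0 l1 b]
    simp only [hist_zero, Hist.erase_start]
    exact centered.comp hF hstart

namespace ConditionalMeans

lemma memLp_pred (hM : S.ConditionalMeans P ξ l0 l1 b t) (hξ : S.Realizes P T ξ)
    (hm : MeasurableMeans l0 l1 b T) (hpos : ∀ m : d.M1, 0 < S.π1 m) (ht : t ≤ T) :
    MemLp (fun ω => S.pred l0 b t (S.hist ξ l0 l1 t ω)) 2 P :=
  hξ.memLp_avg hm.toMeasurableStrategies hpos ht
    (f := fun h m => S.D h.m0 m *ᵥ S.zbar l0 b t h m)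
    (S.measurable_D_zbar hm ht) (hM.memLp_D_zbar hξ hm.toMeasurableStrategies ht)

lemma memLp_modeDev (hM : S.ConditionalMeans P ξ l0 l1 b t) (hξ : S.Realizes P T ξ)
    (hm : MeasurableMeans l0 l1 b T) (hpos : ∀ m : d.M1, 0 < S.π1 m) (ht : t ≤ T) :
    MemLp (fun ω => S.modeDev l0 b t (S.hist ξ l0 l1 t ω) (ξ.m1 t ω)) 2 P :=
  memLp_comp_index ((hM.memLp_D_zbar hξ hm.toMeasurableStrategies ht).sub
    (hM.memLp_pred hξ hm hpos ht)) Sum.inr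

lemma modeDev_centered (hM : S.ConditionalMeans P ξ l0 l1 b t) (hξ : S.Realizes P T ξ)
    (hm : MeasurableMeans l0 l1 b T) (hpos : ∀ m : d.M1, 0 < S.π1 m) (ht : t ≤ T) :
    CondCentered (S.hist ξ l0 l1 t)
      (fun ω => S.modeDev l0 b t (S.hist ξ l0 l1 t ω) (ξ.m1 t ω)) P := by
  have hD := hM.memLp_D_zbar hξ hm.toMeasurableStrategies ht
  have centered := hξ.condCentered_sub_avg hm.toMeasurableStrategies hpos ht
    (f := fun h m => S.D h.m0 m *ᵥ S.zbar l0 b t h m) (S.measurable_D_zbar hm ht)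
    (hD.integrable one_le_two)
  exact centered.clm_comp ((hD.sub (hM.memLp_pred hξ hm hpos ht)).integrable one_le_two)
    (.pi fun i => .proj (Sum.inr i))

lemma memLp_innov (hM : S.ConditionalMeans P ξ l0 l1 b t) (hξ : S.Realizes P T ξ)
    (hm : MeasurableMeans l0 l1 b T) (hpos : ∀ m : d.M1, 0 < S.π1 m) (ht : t ≤ T) :
    MemLp (S.innov ξ l0 l1 b t) 2 P :=
  (hM.memLp_modeDev hξ hm hpos ht).add (hM.memLp_D11_dev hξ ht)

lemma innov_centered (hM : S.ConditionalMeans P ξ l0 l1 b t) (hξ : S.Realizes P T ξ)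
    (hm : MeasurableMeans l0 l1 b T) (hpos : ∀ m : d.M1, 0 < S.π1 m) (ht : t ≤ T) :
    CondCentered (S.hist ξ l0 l1 t) (S.innov ξ l0 l1 b t) P := by
  have hl := hm.toMeasurableStrategies
  have hh := hξ.measurable_hist hl ht
  exact (hM.modeDev_centered hξ hm hpos ht).add
    ((hM.D11_dev_centered hξ hl ht).comp (hh.prodMk (hξ.measurable_m1 ht)) measurable_fst)
    ((hM.memLp_modeDev hξ hm hpos ht).integrable one_le_two)
    ((hM.memLp_D11_dev hξ ht).integrable one_le_two)

end ConditionalMeans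

lemma ConditionalMeans.innov_add_w1_centered (hM : S.ConditionalMeans P ξ l0 l1 b t)
    (hξ : S.Realizes P T ξ) (hS : S.Standing T) (hm : MeasurableMeans l0 l1 b T)
    (hpos : ∀ m : d.M1, 0 < S.π1 m) (ht : t ≤ T) :
    CondCentered (S.hist ξ l0 l1 t) (fun ω => S.innov ξ l0 l1 b t ω + ξ.w1 t ω) P := by
  have hl := hm.toMeasurableStrategies
  exact (hM.innov_centered hξ hm hpos ht).add ((hξ.w1_centered hS hl ht).comp
      ((hξ.measurable_hist hl ht).prodMk ((hξ.measurable_state1 hl ht).prodMk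
        (hξ.measurable_m1 ht))) measurable_fst)
    ((hM.memLp_innov hξ hm hpos ht).integrable one_le_two)
    ((hξ.memLp_w1 hS ht).integrable one_le_two)

lemma ConditionalMeans.stateMean_succ (hM : S.ConditionalMeans P ξ l0 l1 b t)
    (hξ : S.Realizes P T ξ) (hS : S.Standing T) (hm : MeasurableMeans l0 l1 b T)
    (hpos : ∀ m : d.M1, 0 < S.π1 m) (ht : t + 1 ≤ T) :
    S.StateMean P ξ l0 l1 b (t + 1) := by
  have htT := Nat.le_of_succ_le ht
  have hl := hm.toMeasurableStrategies
  have hh := hξ.measurable_hist hl htT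
  have hpred := hM.memLp_pred hξ hm hpos htT
  have hdev := (hM.memLp_innov hξ hm hpos htT).add (hξ.memLp_w1 hS htT)
  have hN : Measurable fun ω => (ξ.w0 t ω, ξ.m0 (t + 1) ω, ξ.m1 (t + 1) ω, ξ.γ (t + 1) ω) :=
    (hξ.measurable_w0 htT).prodMk
      ((hξ.measurable_m0 ht).prodMk ((hξ.measurable_m1 ht).prodMk (hξ.measurable_γ ht)))
  have centered := (hM.innov_add_w1_centered hξ hS hm hpos htT).prodMk_of_indepFun hh
    ((hξ.measurable_innov hm htT).add (hξ.measurable_w1 htT)) hN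
    (hdev.integrable one_le_two) (hξ.indepFun_innov_next hm ht)
  have hg : Measurable fun a : d.Hist t × d.X0 × d.M0 × d.M1 × Bool =>
      (a.1.extend (l0 t a.1) (S.pred l0 b t a.1 ∘ Sum.inl + a.2.1) a.2.2.1 (Sum.inr ())
        (Sum.inr ()), a.2.2.2.1, a.2.2.2.2) :=
    (Hist.measurable_extend measurable_fst ((hl.measurable0 t htT).comp measurable_fst)
      ((measurable_comp_index ((S.measurable_pred hm htT).comp measurable_fst) Sum.inl).add
        (by fun_prop)) (by fun_prop) measurable_const measurable_const).prodMk (by fun_prop)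
  refine ⟨?_, ?_, ?_, ?_⟩
  · rw [funext (S.state0_succ_eq ξ l0 l1 b t hξ.sum_π1)]
    exact (memLp_comp_index hpred Sum.inl).add (hξ.memLp_w0 hS htT)
  · rw [funext (S.state1_succ_eq ξ l0 l1 b t)]
    exact (memLp_comp_index hpred Sum.inr).add hdev
  · simp only [S.est_erase_succ ξ l0 l1 b t]
    exact memLp_comp_index hpred Sum.inr
  · simp only [S.est_erase_succ ξ l0 l1 b t, S.state1_succ_eq ξ l0 l1 b t, add_sub_cancel_left]
    simp only [hist_succ, Hist.erase_extend, S.state0_succ_eq ξ l0 l1 b t hξ.sum_π1]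
    exact centered.comp (hh.prodMk hN) hg

end System

/-! ### The dynamic programming identity -/

namespace System

variable {d : Dims} (S : System d)

section Values

variable {Ω : Type*} (ξ : Primitives d Ω) (l0 : Strategy0 d) (l1 : Strategy1 d)
  (b : MeanAction d) (G : PFam d) (Gt : PtFam d) (t : ℕ)

/-- The value after the transmission at time `t`: a quadratic form in the conditional means of the
states plus a quadratic form in the deviation of the local state. -/
def postValue (ω : Ω) : ℝ :=
  quadForm (G (S.hist ξ l0 l1 t ω).m0 (S.hist ξ l0 l1 t ω).zt)
    (Sum.elim (S.state0 ξ l0 l1 t ω) (S.est l0 b t (S.hist ξ l0 l1 t ω))) +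
  quadForm (Gt (S.hist ξ l0 l1 t ω).m0 (S.hist ξ l0 l1 t ω).zt)
    (S.state1 ξ l0 l1 t ω - S.est l0 b t (S.hist ξ l0 l1 t ω))

/-- The value before the transmission at time `t`, in which the estimate is the one given the
history with the current channel output erased. -/
def priorValue (ω : Ω) : ℝ :=
  quadForm (S.PiOp G)
    (Sum.elim (S.state0 ξ l0 l1 t ω) (S.est l0 b t (S.hist ξ l0 l1 t ω).erase)) +
  quadForm (S.Psi11 G Gt) (S.state1 ξ l0 l1 t ω - S.est l0 b t (S.hist ξ l0 l1 t ω).erase)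

/-- The instantaneous cost along the closed loop. -/
def stageCost (ω : Ω) : ℝ :=
  S.cost t (S.state0 ξ l0 l1 t ω) (S.state1 ξ l0 l1 t ω) (ξ.m0 t ω) (ξ.m1 t ω)
    (S.action0 ξ l0 l1 t ω) (S.action1 ξ l0 l1 t ω)

/-- The cost-to-go, up to noise, of the conditional means: `Hempty` and `Hmode` are the matrices
`H_t(m⁰, ∅)` and `H_t(m⁰, l)`. -/
def meanValue (h : d.Hist t) : ℝ :=
  match h.zt with
  | Sum.inr _ => quadForm (S.Hempty t G Gt h.m0)
      (aug (Sum.elim h.x0 (S.est l0 b t h)) (l0 t h) (b t h))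
  | Sum.inl l => quadForm (S.Hmode t G h.m0 l) (S.zbar l0 b t h l)

/-- The contribution of the noises at time `t` to the cost-to-go. -/
def noiseCost [MeasurableSpace Ω] (P : Measure Ω) : ℝ :=
  ∫ ω, quadForm (S.PiOp G) (Sum.elim (ξ.w0 t ω) 0) ∂P +
    ∫ ω, quadForm (S.Psi11 G Gt) (ξ.w1 t ω) ∂P

lemma cost_eq_quadForm (x0 : d.X0) (x1 : d.X1) (m0 : d.M0) (m1 : d.M1) (u0 : d.U0) (u1 : d.U1) :
    S.cost t x0 x1 m0 m1 u0 u1 = quadForm (S.C t m0 m1) (vec x0 x1 u0 u1) := by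
  rw [C, vec, quadForm_fromBlocks_diag]
  rfl

lemma quadForm_C_vec_zero (m0 : d.M0) (m1 : d.M1) (x1 : d.X1) (u1 : d.U1) :
    quadForm (S.C t m0 m1) (vec 0 x1 0 u1) = quadForm (S.C11 t m0 m1) (Sum.elim x1 u1) := by
  rw [C, C11, vec, quadForm_fromBlocks_diag, quadForm_fromBlocks_diag, quadForm_sumElim_zero_left,
    quadForm_sumElim_zero_left]

lemma postValue_eq (ω : Ω) : S.postValue ξ l0 l1 b G Gt t ω =
    if ξ.γ t ω then quadForm (G (ξ.m0 t ω) (Sum.inl (ξ.m1 t ω)))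
      (Sum.elim (S.state0 ξ l0 l1 t ω) (S.state1 ξ l0 l1 t ω))
    else quadForm (G (ξ.m0 t ω) (Sum.inr ()))
        (Sum.elim (S.state0 ξ l0 l1 t ω) (S.est l0 b t (S.hist ξ l0 l1 t ω).erase)) +
      quadForm (Gt (ξ.m0 t ω) (Sum.inr ()))
        (S.state1 ξ l0 l1 t ω - S.est l0 b t (S.hist ξ l0 l1 t ω).erase) := by
  rw [postValue, hist_m0, hist_zt, S.est_hist ξ l0 l1 b]
  cases ξ.γ t ω <;> simp [channel, quadForm]

lemma priorValue_final (T : ℕ) (ω : Ω) :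
    S.priorValue ξ l0 l1 b (S.Pmat T (T + 1)) (S.Ptmat T (T + 1)) (T + 1) ω = 0 := by
  have hP : S.Pmat T (T + 1) = 0 := by simp [Pmat, riccati]
  have hPt : S.Ptmat T (T + 1) = 0 := by simp [Ptmat, riccati]
  have hPi : S.PiOp (0 : PFam d) = 0 := by simp [PiOp]
  have hPsi : S.Psi11 (0 : PFam d) (0 : PtFam d) = 0 := by
    have toBlocks_zero : (0 : Matrix d.IX d.IX ℝ).toBlocks₂₂ = 0 := rfl
    simp [Psi11, PsiOp, toBlocks_zero]
  rw [priorValue, hP, hPt, hPi, hPsi]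
  simp [quadForm]

variable {S}

lemma priorValue_succ (hπ : ∑ m, S.π1 m = 1) (ω : Ω) :
    S.priorValue ξ l0 l1 b G Gt (t + 1) ω =
      quadForm (S.PiOp G) (S.pred l0 b t (S.hist ξ l0 l1 t ω) + Sum.elim (ξ.w0 t ω) 0) +
      quadForm (S.Psi11 G Gt) (S.innov ξ l0 l1 b t ω + ξ.w1 t ω) := by
  rw [priorValue, S.est_erase_succ ξ l0 l1 b, S.state1_succ_eq ξ l0 l1 b,
    S.state0_succ_eq ξ l0 l1 b t hπ, add_sub_cancel_left]
  congr 2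
  ext (i | i) <;> simp

lemma avg_eq_meanValue (hπ : ∑ m, S.π1 m = 1) (h : d.Hist t) :
    S.avg h.zt (fun m => quadForm (S.C t h.m0 m) (S.zbar l0 b t h m) +
      quadForm (S.PiOp G) (S.pred l0 b t h) +
      quadForm (S.Psi11 G Gt) (S.modeDev l0 b t h m)) = S.meanValue l0 b G Gt t h := by
  unfold meanValue modeDev
  cases hz : h.zt with
  | inl l =>
    have hp : S.pred l0 b t h = S.D h.m0 l *ᵥ S.zbar l0 b t h l := by rw [pred, hz]; rfl
    have h0 : (0 : d.IX → ℝ) ∘ (Sum.inr : Fin d.x1 → d.IX) = 0 := rfl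
    simp only [avg, quadForm_Hmode, hp, sub_self, h0, quadForm_zero, add_zero]
  | inr u =>
    have hp : S.pred l0 b t h = ∑ m, S.π1 m • (S.D h.m0 m *ᵥ S.zbar l0 b t h m) := by
      rw [pred, hz]; rfl
    simp only [avg, smul_eq_mul, S.quadForm_Hempty hπ, hp, L_mulVec_aug]
    simp only [zbar, vec, add_assoc]
    rfl

lemma quadForm_stepP_le_meanValue {T : ℕ} (hS : S.Standing T) (hpos : ∀ m : d.M1, 0 < S.π1 m)
    (hπ : ∑ m, S.π1 m = 1) (ht : t ≤ T) (hG : ∀ m0 z, (G m0 z).PosSemidef)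
    (hGt : ∀ m0 z, (Gt m0 z).PosSemidef) (h : d.Hist t) :
    quadForm (S.stepP t G Gt h.m0 h.zt) (Sum.elim h.x0 (S.est l0 b t h)) ≤
      S.meanValue l0 b G Gt t h := by
  unfold meanValue
  cases h.zt with
  | inl l => exact (actionDefinite_Hmode hS ht hG h.m0 l).quadForm_SC_le _ _
  | inr u => exact (actionDefinite_Hempty hS hpos hπ ht hG hGt h.m0).quadForm_SC_le _ _

lemma avg_SC_Htilde (m0 : d.M0) (zt : Received d.M1) (e : d.X1) :
    S.avg zt (fun m => quadForm (SC (S.Htilde t G Gt m0 m)) e) =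
      quadForm (S.stepPt t G Gt m0 zt) e := by
  cases zt with
  | inl l => rfl
  | inr u => simp only [avg, stepPt, quadForm_sum, quadForm_smul, smul_eq_mul]

end Values

lemma measurable_est_erase {Ω : Type*} {mΩ : MeasurableSpace Ω} {ξ : Primitives d Ω}
    {l0 : Strategy0 d} {l1 : Strategy1 d} {b : MeanAction d} {T t : ℕ}
    (hm : MeasurableMeans l0 l1 b T) (ht : t ≤ T)
    (hξ : ∀ i ∈ stateSources T t, Measurable (ξ.family i)) :
    Measurable fun ω => S.est l0 b t (S.hist ξ l0 l1 t ω).erase := by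
  cases t with
  | zero =>
    simp only [S.est_erase_zero ξ l0 l1 b]
    exact measurable_const
  | succ t =>
    have ht' : t ≤ T := Nat.le_of_succ_le ht
    simp only [S.est_erase_succ ξ l0 l1 b]
    exact measurable_comp_index ((S.measurable_pred hm ht').comp
      (S.measurable_hist hm.toMeasurableStrategies ht' fun i hi =>
        hξ i (histSources_subset_stateSources_succ _ _ hi))) Sum.inr

lemma measurable_states_est_erase {Ω : Type*} {mΩ : MeasurableSpace Ω} {ξ : Primitives d Ω}
    {l0 : Strategy0 d} {l1 : Strategy1 d} {b : MeanAction d} {T t : ℕ}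
    (hm : MeasurableMeans l0 l1 b T) (ht : t ≤ T)
    (hξ : ∀ i ∈ stateSources T t, Measurable (ξ.family i)) :
    Measurable fun ω => (Sum.elim (S.state0 ξ l0 l1 t ω) (S.state1 ξ l0 l1 t ω),
      Sum.elim (S.state0 ξ l0 l1 t ω) (S.est l0 b t (S.hist ξ l0 l1 t ω).erase),
      S.state1 ξ l0 l1 t ω - S.est l0 b t (S.hist ξ l0 l1 t ω).erase) := by
  obtain ⟨h0, h1⟩ := S.measurable_states hm.toMeasurableStrategies ht hξ
  have hest := S.measurable_est_erase hm ht hξ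
  exact (measurable_sumElim h0 h1).prodMk ((measurable_sumElim h0 hest).prodMk (h1.sub hest))

section Transmission

variable {S} {Ω : Type*} [MeasurableSpace Ω] {P : Measure Ω} {T t : ℕ} {ξ : Primitives d Ω}
  {l0 : Strategy0 d} {l1 : Strategy1 d} {b : MeanAction d}

lemma quadForm_PsiOp (hπ : ∑ m, S.π1 m = 1) {ι : Type} [Fintype ι]
    (G1 G2 : d.M0 → Received d.M1 → Matrix ι ι ℝ) (v : ι → ℝ) :
    quadForm (S.PsiOp G1 G2) v = ∑ g, S.p g * ∑ m1, S.π1 m1 * ∑ m0, S.π0 m0 *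
      quadForm (if g then G2 m0 (Sum.inl m1) else G1 m0 (Sum.inr ())) v := by
  rw [Fintype.sum_bool]
  simp only [if_true, Bool.false_eq_true, if_false, ← Finset.sum_mul, hπ, one_mul]
  simp only [PsiOp, quadForm_add, quadForm_smul, quadForm_sum]
  rw [Finset.sum_comm, add_comm]
  simp only [Finset.mul_sum, mul_assoc, mul_left_comm]

lemma integral_quadForm_PsiOp (hπ : ∑ m, S.π1 m = 1) {ι : Type} [Fintype ι]
    (G1 G2 : d.M0 → Received d.M1 → Matrix ι ι ℝ) {X : Ω → ι → ℝ} (hX : MemLp X 2 P) :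
    ∫ ω, quadForm (S.PsiOp G1 G2) (X ω) ∂P = ∑ g, S.p g * ∑ m1, S.π1 m1 * ∑ m0, S.π0 m0 *
      ∫ ω, quadForm (if g then G2 m0 (Sum.inl m1) else G1 m0 (Sum.inr ())) (X ω) ∂P := by
  simp only [quadForm_PsiOp hπ, Finset.mul_sum, ← integral_const_mul]
  have hint (g : Bool) (m1 : d.M1) (m0 : d.M0) : Integrable (fun ω => S.p g * (S.π1 m1 *
      (S.π0 m0 * quadForm (if g then G2 m0 (Sum.inl m1) else G1 m0 (Sum.inr ())) (X ω)))) P :=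
    (((integrable_quadForm _ hX).const_mul _).const_mul _).const_mul _
  rw [integral_finsetSum _ fun g _ => integrable_finsetSum _ fun m1 _ =>
    integrable_finsetSum _ fun m0 _ => hint g m1 m0]
  refine Finset.sum_congr rfl fun g _ => ?_
  rw [integral_finsetSum _ fun m1 _ => integrable_finsetSum _ fun m0 _ => hint g m1 m0]
  exact Finset.sum_congr rfl fun m1 _ => integral_finsetSum _ fun m0 _ => hint g m1 m0

lemma Realizes.integral_modes [IsFiniteMeasure P] (hξ : S.Realizes P T ξ) (ht : t ≤ T)
    {α : Type*} [MeasurableSpace α] {V : Ω → α} (hV : Measurable[sig ξ (stateSources T t)] V)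
    {f : Bool → d.M1 → d.M0 → α → ℝ} (hf : ∀ g m1 m0, Measurable (f g m1 m0))
    (hint : ∀ g m1 m0, Integrable (fun ω => f g m1 m0 (V ω)) P) :
    ∫ ω, f (ξ.γ t ω) (ξ.m1 t ω) (ξ.m0 t ω) (V ω) ∂P =
      ∑ g, S.p g * ∑ m1, S.π1 m1 * ∑ m0, S.π0 m0 * ∫ ω, f g m1 m0 (V ω) ∂P := by
  have hγ := hξ.measurable_γ ht
  have hm1 := hξ.measurable_m1 ht
  have hm0 := hξ.measurable_m0 ht
  have hVm : Measurable V := hV.mono (iSup₂_le fun i _ => (hξ.measurable i).comap_le) le_rfl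
  obtain ⟨hγ_indep, hm1_indep, hm0_indep⟩ := hξ.indepFun_modes ht hV
  have hf0 (g : Bool) (m1 : d.M1) : Measurable fun a : d.M0 × α => f g m1 a.1 a.2 :=
    measurable_from_prod_countable_right (hf g m1)
  have hf1 (g : Bool) : Measurable fun a : d.M1 × d.M0 × α => f g a.1 a.2.1 a.2.2 :=
    measurable_from_prod_countable_right (hf0 g)
  simp only [← memLp_one_iff_integrable] at hint
  have hint0 (g : Bool) (m1 : d.M1) : MemLp (fun ω => f g m1 (ξ.m0 t ω) (V ω)) 1 P :=
    memLp_switch (f := fun k ω => f g m1 k (V ω)) hm0 (hint g m1)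
  have hint1 (g : Bool) : MemLp (fun ω => f g (ξ.m1 t ω) (ξ.m0 t ω) (V ω)) 1 P :=
    memLp_switch (f := fun k ω => f g k (ξ.m0 t ω) (V ω)) hm1 (hint0 g)
  have hint2 : MemLp (fun ω => f (ξ.γ t ω) (ξ.m1 t ω) (ξ.m0 t ω) (V ω)) 1 P :=
    memLp_switch (f := fun k ω => f k (ξ.m1 t ω) (ξ.m0 t ω) (V ω)) hγ hint1
  simp only [memLp_one_iff_integrable] at hint0 hint1 hint2
  rw [integral_of_indepFun_finite hγ (hm1.prodMk (hm0.prodMk hVm)) hγ_indep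
    (f := fun g a => f g a.1 a.2.1 a.2.2) hf1 hint2, hξ.law_γ t ht]
  refine Finset.sum_congr rfl fun g _ => congrArg (S.p g * ·) ?_
  rw [integral_of_indepFun_finite hm1 (hm0.prodMk hVm) hm1_indep
    (f := fun m1 a => f g m1 a.1 a.2) (hf0 g) (hint1 g), hξ.law_m1 t ht]
  refine Finset.sum_congr rfl fun m1 _ => congrArg (S.π1 m1 * ·) ?_
  rw [integral_of_indepFun_finite hm0 hVm hm0_indep (f := fun m0 a => f g m1 m0 a) (hf g m1)
    (hint0 g m1), hξ.law_m0 t ht]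
  rfl

namespace StateMean

variable [IsProbabilityMeasure P]

lemma integral_quadForm_state (hA : S.StateMean P ξ l0 l1 b t) (hξ : S.Realizes P T ξ)
    (hm : MeasurableMeans l0 l1 b T) (ht : t ≤ T) (A : Matrix d.IX d.IX ℝ) :
    ∫ ω, quadForm A (Sum.elim (S.state0 ξ l0 l1 t ω) (S.state1 ξ l0 l1 t ω)) ∂P =
      ∫ ω, quadForm A (Sum.elim (S.state0 ξ l0 l1 t ω)
        (S.est l0 b t (S.hist ξ l0 l1 t ω).erase)) ∂P +
      ∫ ω, quadForm A.toBlocks₂₂ (S.state1 ξ l0 l1 t ω -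
        S.est l0 b t (S.hist ξ l0 l1 t ω).erase) ∂P := by
  have herase : Measurable fun ω => (S.hist ξ l0 l1 t ω).erase :=
    Hist.measurable_erase.comp (hξ.measurable_hist hm.toMeasurableStrategies ht)
  have dev_memLp := hA.memLp_state1.sub hA.memLp_est_erase
  have dev_centered := hA.state1_centered.comp (herase.prodMk
    ((hξ.measurable_m1 ht).prodMk (hξ.measurable_γ ht))) measurable_fst
  have zero_centered : CondCentered (fun ω => (S.hist ξ l0 l1 t ω).erase)
      (fun _ => (0 : d.X0)) P := condExp_zero.eventuallyEq
  have pythagoras := (zero_centered.sumElim dev_centered (integrable_const 0)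
    (dev_memLp.integrable one_le_two)).integral_quadForm_add herase
    (measurable_const (a := ())) (fun _ => A) (x := fun h => Sum.elim h.x0 (S.est l0 b t h))
    (measurable_sumElim Hist.measurable_x0 (S.measurable_est hm ht))
    (memLp_sumElim hA.memLp_state0 hA.memLp_est_erase)
    (memLp_sumElim (memLp_const 0) dev_memLp)
  simp only [quadForm_sumElim_zero_left] at pythagoras
  refine Eq.trans (integral_congr_ae (.of_forall fun ω => congrArg (quadForm A) ?_)) pythagoras
  ext (i | i) <;> simp [state0]

lemma integral_postValue (hA : S.StateMean P ξ l0 l1 b t) (hξ : S.Realizes P T ξ)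
    (hm : MeasurableMeans l0 l1 b T) (ht : t ≤ T) (G : PFam d) (Gt : PtFam d) :
    ∫ ω, S.postValue ξ l0 l1 b G Gt t ω ∂P = ∫ ω, S.priorValue ξ l0 l1 b G Gt t ω ∂P := by
  let X : Ω → d.IX → ℝ := fun ω => Sum.elim (S.state0 ξ l0 l1 t ω) (S.state1 ξ l0 l1 t ω)
  let Y : Ω → d.IX → ℝ := fun ω =>
    Sum.elim (S.state0 ξ l0 l1 t ω) (S.est l0 b t (S.hist ξ l0 l1 t ω).erase)
  let e : Ω → d.X1 := fun ω => S.state1 ξ l0 l1 t ω - S.est l0 b t (S.hist ξ l0 l1 t ω).erase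
  have hX : MemLp X 2 P := memLp_sumElim hA.memLp_state0 hA.memLp_state1
  have hY : MemLp Y 2 P := memLp_sumElim hA.memLp_state0 hA.memLp_est_erase
  have he : MemLp e 2 P := hA.memLp_state1.sub hA.memLp_est_erase
  have hV : Measurable[sig ξ (stateSources T t)] fun ω => (X ω, Y ω, e ω) :=
    S.measurable_states_est_erase hm ht fun i hi => measurable_sig ξ hi
  let f (g : Bool) (m1 : d.M1) (m0 : d.M0) (v : (d.IX → ℝ) × (d.IX → ℝ) × d.X1) : ℝ :=
    if g then quadForm (G m0 (Sum.inl m1)) v.1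
    else quadForm (G m0 (Sum.inr ())) v.2.1 + quadForm (Gt m0 (Sum.inr ())) v.2.2
  have hf (g : Bool) (m1 : d.M1) (m0 : d.M0) : Measurable (f g m1 m0) := by
    have h (ι : Type) [Fintype ι] (A : Matrix ι ι ℝ) := measurable_quadForm A
    cases g <;> simp only [f, if_true, Bool.false_eq_true, if_false] <;> fun_prop
  have hint (g : Bool) (m1 : d.M1) (m0 : d.M0) :
      Integrable (fun ω => f g m1 m0 (X ω, Y ω, e ω)) P := by
    cases g
    · exact (integrable_quadForm _ hY).add (integrable_quadForm _ he)
    · exact integrable_quadForm _ hX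
  have integral_f (g : Bool) (m1 : d.M1) (m0 : d.M0) : ∫ ω, f g m1 m0 (X ω, Y ω, e ω) ∂P =
      ∫ ω, quadForm (if g then G m0 (Sum.inl m1) else G m0 (Sum.inr ())) (Y ω) ∂P +
      ∫ ω, quadForm (if g then (G m0 (Sum.inl m1)).toBlocks₂₂ else Gt m0 (Sum.inr ()))
        (e ω) ∂P := by
    cases g
    · exact integral_add (integrable_quadForm _ hY) (integrable_quadForm _ he)
    · exact hA.integral_quadForm_state hξ hm ht _
  calc ∫ ω, S.postValue ξ l0 l1 b G Gt t ω ∂P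
      = ∫ ω, f (ξ.γ t ω) (ξ.m1 t ω) (ξ.m0 t ω) (X ω, Y ω, e ω) ∂P := by
        simp only [postValue_eq]; rfl
    _ = ∫ ω, quadForm (S.PsiOp G G) (Y ω) ∂P +
        ∫ ω, quadForm (S.PsiOp Gt fun m0 z => (G m0 z).toBlocks₂₂) (e ω) ∂P := by
        rw [hξ.integral_modes ht hV hf hint, integral_quadForm_PsiOp hξ.sum_π1 _ _ hY,
          integral_quadForm_PsiOp hξ.sum_π1 _ _ he]
        simp only [integral_f, mul_add, Finset.sum_add_distrib]
    _ = ∫ ω, S.priorValue ξ l0 l1 b G Gt t ω ∂P :=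
        (integral_add (integrable_quadForm _ hY) (integrable_quadForm _ he)).symm

end StateMean

section OptimalCost

variable (S P T ξ)

/-- The optimal cost: the value of the initial state plus the contributions of all noises. -/
def optCost : ℝ :=
  ∫ ω, (quadForm (S.PiOp (S.Pmat T 0)) (Sum.elim (ξ.x0 ω) (∫ x, x ∂S.lawX1)) +
    quadForm (S.Psi11 (S.Pmat T 0) (S.Ptmat T 0)) (ξ.x1 ω - ∫ x, x ∂S.lawX1)) ∂P +
  ∑ t ∈ Finset.range (T + 1), S.noiseCost ξ (S.Pmat T (t + 1)) (S.Ptmat T (t + 1)) t P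

variable (l0 l1 b)

lemma optCost_eq_sum : S.optCost P T ξ = ∑ t ∈ Finset.range (T + 1),
    (∫ ω, S.priorValue ξ l0 l1 b (S.Pmat T t) (S.Ptmat T t) t ω ∂P +
      S.noiseCost ξ (S.Pmat T (t + 1)) (S.Ptmat T (t + 1)) t P -
      ∫ ω, S.priorValue ξ l0 l1 b (S.Pmat T (t + 1)) (S.Ptmat T (t + 1)) (t + 1) ω ∂P) := by
  have telescope := Finset.sum_range_sub'
    (fun t => ∫ ω, S.priorValue ξ l0 l1 b (S.Pmat T t) (S.Ptmat T t) t ω ∂P) (T + 1)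
  simp only [priorValue_final, integral_zero, sub_zero] at telescope
  simp only [add_sub_right_comm, Finset.sum_add_distrib, telescope]
  simp only [optCost, priorValue, S.est_erase_zero ξ l0 l1 b]
  rfl

variable {S P T ξ l0 l1 b}

lemma ConditionalMeans.integrable_stageCost (hM : S.ConditionalMeans P ξ l0 l1 b t)
    (hξ : S.Realizes P T ξ) (ht : t ≤ T) : Integrable (S.stageCost ξ l0 l1 t) P := by
  have h := integrable_quadForm_switch (c := fun ω => (ξ.m0 t ω, ξ.m1 t ω))
    ((hξ.measurable_m0 ht).prodMk (hξ.measurable_m1 ht)) (fun k => S.C t k.1 k.2)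
    (memLp_sumElim (memLp_sumElim hM.memLp_state0 hM.memLp_state1)
      (memLp_sumElim hM.memLp_action0 hM.memLp_action1))
  exact h.congr (.of_forall fun ω => (S.cost_eq_quadForm t _ _ _ _ _ _).symm)

lemma ConditionalMeans.integral_quadForm_Htilde (hM : S.ConditionalMeans P ξ l0 l1 b t)
    (hξ : S.Realizes P T ξ) (ht : t ≤ T) (G : PFam d) (Gt : PtFam d) :
    ∫ ω, quadForm (S.Htilde t G Gt (ξ.m0 t ω) (ξ.m1 t ω)) (S.dev ξ l0 l1 b t ω) ∂P =
      ∫ ω, quadForm (S.C11 t (ξ.m0 t ω) (ξ.m1 t ω)) (S.dev ξ l0 l1 b t ω) ∂P +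
      ∫ ω, quadForm (S.Psi11 G Gt)
        (S.D11 (ξ.m0 t ω) (ξ.m1 t ω) *ᵥ S.dev ξ l0 l1 b t ω) ∂P := by
  simp only [quadForm_Htilde]
  exact integral_add (integrable_quadForm_switch (c := fun ω => (ξ.m0 t ω, ξ.m1 t ω))
      ((hξ.measurable_m0 ht).prodMk (hξ.measurable_m1 ht)) (fun k => S.C11 t k.1 k.2)
      (hM.memLp_dev hξ ht))
    (integrable_quadForm _ (hM.memLp_D11_dev hξ ht))

lemma J_eq_sum (hM : ∀ t ≤ T, S.ConditionalMeans P ξ l0 l1 b t) (hξ : S.Realizes P T ξ) :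
    S.J ξ l0 l1 P T = ∑ t ∈ Finset.range (T + 1), ∫ ω, S.stageCost ξ l0 l1 t ω ∂P :=
  integral_finsetSum _ fun t h =>
    have ht : t ≤ T := Nat.lt_succ_iff.1 (Finset.mem_range.1 h)
    (hM t ht).integrable_stageCost hξ ht

end OptimalCost

namespace ConditionalMeans

variable [IsProbabilityMeasure P]

lemma integral_stageCost (hM : S.ConditionalMeans P ξ l0 l1 b t) (hξ : S.Realizes P T ξ)
    (hm : MeasurableMeans l0 l1 b T) (ht : t ≤ T) :
    ∫ ω, S.stageCost ξ l0 l1 t ω ∂P =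
      ∫ ω, quadForm (S.C t (ξ.m0 t ω) (ξ.m1 t ω))
        (S.zbar l0 b t (S.hist ξ l0 l1 t ω) (ξ.m1 t ω)) ∂P +
      ∫ ω, quadForm (S.C11 t (ξ.m0 t ω) (ξ.m1 t ω)) (S.dev ξ l0 l1 b t ω) ∂P := by
  have hl := hm.toMeasurableStrategies
  have hF := (hξ.measurable_hist hl ht).prodMk (hξ.measurable_m1 ht)
  have hx := memLp_sumElim (memLp_const (0 : d.X0)) (hM.memLp_state1.sub (hM.memLp_est hξ ht))
  have hu := memLp_sumElim (memLp_const (0 : d.U0)) (hM.memLp_action1.sub hM.memLp_mean)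
  have zero_centered (n : ℕ) : CondCentered (fun ω => (S.hist ξ l0 l1 t ω, ξ.m1 t ω))
      (fun _ => (0 : Fin n → ℝ)) P := condExp_zero.eventuallyEq
  have x_centered := (zero_centered d.x0).sumElim (hM.centered_hist hξ hl ht)
    (integrable_const 0) ((hM.memLp_state1.sub (hM.memLp_est hξ ht)).integrable one_le_two)
  have u_centered := (zero_centered d.u0).sumElim hM.action1_centered
    (integrable_const 0) ((hM.memLp_action1.sub hM.memLp_mean).integrable one_le_two)
  have pythagoras := (x_centered.sumElim u_centered (hx.integrable one_le_two)
    (hu.integrable one_le_two)).integral_quadForm_add hF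
    (c := fun a : d.Hist t × d.M1 => (a.1.m0, a.2))
    ((Hist.measurable_m0.comp measurable_fst).prodMk measurable_snd) (fun k => S.C t k.1 k.2)
    (x := fun a => S.zbar l0 b t a.1 a.2)
    (measurable_from_prod_countable_left fun m => S.measurable_zbar hm ht m)
    (hM.memLp_zbar hξ ht) (memLp_sumElim hx hu)
  simp only [stageCost, cost_eq_quadForm, dev, S.vec_eq_zbar_add ξ l0 l1 b,
    ← quadForm_C_vec_zero]
  simp only [hist_m0] at pythagoras
  exact pythagoras

lemma integral_quadForm_pred_add_w0 (hM : S.ConditionalMeans P ξ l0 l1 b t)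
    (hξ : S.Realizes P T ξ) (hS : S.Standing T) (hm : MeasurableMeans l0 l1 b T)
    (hpos : ∀ m : d.M1, 0 < S.π1 m) (ht : t ≤ T) (A : Matrix d.IX d.IX ℝ) :
    ∫ ω, quadForm A (S.pred l0 b t (S.hist ξ l0 l1 t ω) + Sum.elim (ξ.w0 t ω) 0) ∂P =
      ∫ ω, quadForm A (S.pred l0 b t (S.hist ξ l0 l1 t ω)) ∂P +
      ∫ ω, quadForm A (Sum.elim (ξ.w0 t ω) 0) ∂P := by
  have hl := hm.toMeasurableStrategies
  have hw0 := hξ.memLp_w0 hS ht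
  have zero_centered : CondCentered (S.hist ξ l0 l1 t) (fun _ => (0 : d.X1)) P :=
    condExp_zero.eventuallyEq
  exact ((hξ.w0_centered hS hl ht).sumElim zero_centered (hw0.integrable one_le_two)
    (integrable_const 0)).integral_quadForm_add (hξ.measurable_hist hl ht)
    (measurable_const (a := ())) (fun _ => A) (S.measurable_pred hm ht)
    (hM.memLp_pred hξ hm hpos ht) (memLp_sumElim hw0 (memLp_const 0))

lemma integral_quadForm_innov_add_w1 (hM : S.ConditionalMeans P ξ l0 l1 b t)
    (hξ : S.Realizes P T ξ) (hS : S.Standing T) (hm : MeasurableMeans l0 l1 b T)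
    (hpos : ∀ m : d.M1, 0 < S.π1 m) (ht : t ≤ T) (A : Matrix (Fin d.x1) (Fin d.x1) ℝ) :
    ∫ ω, quadForm A (S.innov ξ l0 l1 b t ω + ξ.w1 t ω) ∂P =
      ∫ ω, quadForm A (S.innov ξ l0 l1 b t ω) ∂P + ∫ ω, quadForm A (ξ.w1 t ω) ∂P := by
  have hl := hm.toMeasurableStrategies
  have pythagoras := (hξ.w1_centered hS hl ht).integral_quadForm_add
    ((hξ.measurable_hist hl ht).prodMk ((hξ.measurable_state1 hl ht).prodMk (hξ.measurable_m1 ht)))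
    (measurable_const (a := ())) (fun _ => A) (S.measurable_innovFun hm ht)
    (by simpa only [innovFun_eq] using hM.memLp_innov hξ hm hpos ht) (hξ.memLp_w1 hS ht)
  simpa only [innovFun_eq] using pythagoras

lemma integral_quadForm_innov (hM : S.ConditionalMeans P ξ l0 l1 b t) (hξ : S.Realizes P T ξ)
    (hm : MeasurableMeans l0 l1 b T) (hpos : ∀ m : d.M1, 0 < S.π1 m) (ht : t ≤ T)
    (A : Matrix (Fin d.x1) (Fin d.x1) ℝ) :
    ∫ ω, quadForm A (S.innov ξ l0 l1 b t ω) ∂P =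
      ∫ ω, quadForm A (S.modeDev l0 b t (S.hist ξ l0 l1 t ω) (ξ.m1 t ω)) ∂P +
      ∫ ω, quadForm A (S.D11 (ξ.m0 t ω) (ξ.m1 t ω) *ᵥ S.dev ξ l0 l1 b t ω) ∂P := by
  have hl := hm.toMeasurableStrategies
  have hmodeDev (m : d.M1) : Measurable fun h : d.Hist t => S.modeDev l0 b t h m :=
    measurable_comp_index ((S.measurable_D_zbar hm ht m).sub (S.measurable_pred hm ht)) Sum.inr
  exact (hM.D11_dev_centered hξ hl ht).integral_quadForm_add
    ((hξ.measurable_hist hl ht).prodMk (hξ.measurable_m1 ht))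
    (measurable_const (a := ())) (fun _ => A) (x := fun a => S.modeDev l0 b t a.1 a.2)
    (measurable_from_prod_countable_left hmodeDev) (hM.memLp_modeDev hξ hm hpos ht)
    (hM.memLp_D11_dev hξ ht)

lemma integral_priorValue_succ (hM : S.ConditionalMeans P ξ l0 l1 b t)
    (hξ : S.Realizes P T ξ) (hS : S.Standing T) (hm : MeasurableMeans l0 l1 b T)
    (hpos : ∀ m : d.M1, 0 < S.π1 m) (ht : t ≤ T) (G : PFam d) (Gt : PtFam d) :
    ∫ ω, S.priorValue ξ l0 l1 b G Gt (t + 1) ω ∂P =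
      ∫ ω, quadForm (S.PiOp G) (S.pred l0 b t (S.hist ξ l0 l1 t ω)) ∂P +
      ∫ ω, quadForm (S.Psi11 G Gt) (S.modeDev l0 b t (S.hist ξ l0 l1 t ω) (ξ.m1 t ω)) ∂P +
      ∫ ω, quadForm (S.Psi11 G Gt)
        (S.D11 (ξ.m0 t ω) (ξ.m1 t ω) *ᵥ S.dev ξ l0 l1 b t ω) ∂P +
      S.noiseCost ξ G Gt t P := by
  have hmean : MemLp (fun ω => S.pred l0 b t (S.hist ξ l0 l1 t ω) +
      Sum.elim (ξ.w0 t ω) 0) 2 P :=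
    (hM.memLp_pred hξ hm hpos ht).add (memLp_sumElim (hξ.memLp_w0 hS ht) (memLp_const 0))
  have hdev : MemLp (fun ω => S.innov ξ l0 l1 b t ω + ξ.w1 t ω) 2 P :=
    (hM.memLp_innov hξ hm hpos ht).add (hξ.memLp_w1 hS ht)
  simp only [priorValue_succ ξ l0 l1 b G Gt t hξ.sum_π1]
  rw [integral_add (integrable_quadForm _ hmean) (integrable_quadForm _ hdev),
    hM.integral_quadForm_pred_add_w0 hξ hS hm hpos ht,
    hM.integral_quadForm_innov_add_w1 hξ hS hm hpos ht,
    hM.integral_quadForm_innov hξ hm hpos ht, noiseCost]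
  ring

lemma integral_meanValue (hM : S.ConditionalMeans P ξ l0 l1 b t) (hξ : S.Realizes P T ξ)
    (hm : MeasurableMeans l0 l1 b T) (hpos : ∀ m : d.M1, 0 < S.π1 m) (ht : t ≤ T)
    (G : PFam d) (Gt : PtFam d) :
    Integrable (fun ω => S.meanValue l0 b G Gt t (S.hist ξ l0 l1 t ω)) P ∧
    ∫ ω, S.meanValue l0 b G Gt t (S.hist ξ l0 l1 t ω) ∂P =
      ∫ ω, quadForm (S.C t (ξ.m0 t ω) (ξ.m1 t ω))
        (S.zbar l0 b t (S.hist ξ l0 l1 t ω) (ξ.m1 t ω)) ∂P +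
      ∫ ω, quadForm (S.PiOp G) (S.pred l0 b t (S.hist ξ l0 l1 t ω)) ∂P +
      ∫ ω, quadForm (S.Psi11 G Gt) (S.modeDev l0 b t (S.hist ξ l0 l1 t ω) (ξ.m1 t ω)) ∂P := by
  let f (h : d.Hist t) (m : d.M1) : ℝ := quadForm (S.C t h.m0 m) (S.zbar l0 b t h m) +
    quadForm (S.PiOp G) (S.pred l0 b t h) + quadForm (S.Psi11 G Gt) (S.modeDev l0 b t h m)
  have hpred := S.measurable_pred hm ht
  have hf (m : d.M1) : Measurable fun h => f h m :=
    ((measurable_switch (f := fun k h => quadForm (S.C t k m) (S.zbar l0 b t h m))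
      Hist.measurable_m0 fun k => (measurable_quadForm _).comp (S.measurable_zbar hm ht m)).add
      ((measurable_quadForm _).comp hpred)).add ((measurable_quadForm _).comp
        (measurable_comp_index ((S.measurable_D_zbar hm ht m).sub hpred) Sum.inr))
  have hzbar : Integrable (fun ω => quadForm (S.C t (S.hist ξ l0 l1 t ω).m0 (ξ.m1 t ω))
      (S.zbar l0 b t (S.hist ξ l0 l1 t ω) (ξ.m1 t ω))) P := by
    simp only [hist_m0]
    exact integrable_quadForm_switch (c := fun ω => (ξ.m0 t ω, ξ.m1 t ω))
      ((hξ.measurable_m0 ht).prodMk (hξ.measurable_m1 ht)) (fun k => S.C t k.1 k.2)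
      (hM.memLp_zbar hξ ht)
  have hPi := integrable_quadForm (S.PiOp G) (hM.memLp_pred hξ hm hpos ht)
  have hPsi := integrable_quadForm (S.Psi11 G Gt) (hM.memLp_modeDev hξ hm hpos ht)
  obtain ⟨avg_int, integral_avg⟩ := hξ.integral_avg hm.toMeasurableStrategies hpos ht
    (f := fun a => f a.1) (fun m => (hf m).comp measurable_fst) ((hzbar.add hPi).add hPsi)
  simp only [f, avg_eq_meanValue l0 b G Gt t hξ.sum_π1] at avg_int integral_avg
  refine ⟨avg_int, integral_avg.trans ?_⟩
  have integral_split := (integral_add (hzbar.add hPi) hPsi).trans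
    (congrArg (· + _) (integral_add hzbar hPi))
  simp only [hist_m0] at integral_split ⊢
  exact integral_split

-- The dynamic programming identity, valid for every strategy pair.
lemma integral_stageCost_add_priorValue_succ (hM : S.ConditionalMeans P ξ l0 l1 b t)
    (hξ : S.Realizes P T ξ) (hS : S.Standing T) (hm : MeasurableMeans l0 l1 b T)
    (hpos : ∀ m : d.M1, 0 < S.π1 m) (ht : t ≤ T) (G : PFam d) (Gt : PtFam d) :
    ∫ ω, S.stageCost ξ l0 l1 t ω ∂P + ∫ ω, S.priorValue ξ l0 l1 b G Gt (t + 1) ω ∂P =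
      ∫ ω, S.meanValue l0 b G Gt t (S.hist ξ l0 l1 t ω) ∂P +
      ∫ ω, quadForm (S.Htilde t G Gt (ξ.m0 t ω) (ξ.m1 t ω)) (S.dev ξ l0 l1 b t ω) ∂P +
      S.noiseCost ξ G Gt t P := by
  rw [hM.integral_stageCost hξ hm ht, hM.integral_priorValue_succ hξ hS hm hpos ht,
    (hM.integral_meanValue hξ hm hpos ht G Gt).2, hM.integral_quadForm_Htilde hξ ht]
  ring

end ConditionalMeans

namespace StateMean

variable [IsProbabilityMeasure P]

lemma integral_quadForm_SC_Htilde (hA : S.StateMean P ξ l0 l1 b t) (hξ : S.Realizes P T ξ)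
    (hm : MeasurableMeans l0 l1 b T) (hpos : ∀ m : d.M1, 0 < S.π1 m) (ht : t ≤ T)
    (G : PFam d) (Gt : PtFam d) :
    ∫ ω, quadForm (SC (S.Htilde t G Gt (ξ.m0 t ω) (ξ.m1 t ω)))
      (S.state1 ξ l0 l1 t ω - S.est l0 b t (S.hist ξ l0 l1 t ω)) ∂P =
    ∫ ω, quadForm (S.stepPt t G Gt (S.hist ξ l0 l1 t ω).m0 (S.hist ξ l0 l1 t ω).zt)
      (S.state1 ξ l0 l1 t ω - S.est l0 b t (S.hist ξ l0 l1 t ω)) ∂P := by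
  have hf (m : d.M1) : Measurable fun a : d.Hist t × d.X1 =>
      quadForm (SC (S.Htilde t G Gt a.1.m0 m)) (a.2 - S.est l0 b t a.1) :=
    measurable_switch
      (f := fun k (a : d.Hist t × d.X1) =>
        quadForm (SC (S.Htilde t G Gt k m)) (a.2 - S.est l0 b t a.1))
      (Hist.measurable_m0.comp measurable_fst) fun k => (measurable_quadForm _).comp
        (measurable_snd.sub ((S.measurable_est hm ht).comp measurable_fst))
  have hint := integrable_quadForm_switch (c := fun ω => (ξ.m0 t ω, ξ.m1 t ω))
    ((hξ.measurable_m0 ht).prodMk (hξ.measurable_m1 ht))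
    (fun k => SC (S.Htilde t G Gt k.1 k.2)) (hA.memLp_state1.sub (hA.memLp_est hξ ht))
  have integral_avg := (hξ.integral_avg hm.toMeasurableStrategies hpos ht
    (f := fun a m => quadForm (SC (S.Htilde t G Gt a.1.m0 m)) (a.2 - S.est l0 b t a.1)) hf
    (by simp only [hist_m0]; exact hint)).2
  simp only [avg_SC_Htilde, hist_m0] at integral_avg ⊢
  exact integral_avg.symm

lemma integral_priorValue_step (hA : S.StateMean P ξ l0 l1 b t) (hξ : S.Realizes P T ξ)
    (hm : MeasurableMeans l0 l1 b T) (hpos : ∀ m : d.M1, 0 < S.π1 m) (ht : t ≤ T)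
    (G : PFam d) (Gt : PtFam d) :
    ∫ ω, S.priorValue ξ l0 l1 b (S.stepP t G Gt) (S.stepPt t G Gt) t ω ∂P =
      ∫ ω, quadForm (S.stepP t G Gt (S.hist ξ l0 l1 t ω).m0 (S.hist ξ l0 l1 t ω).zt)
        (Sum.elim (S.state0 ξ l0 l1 t ω) (S.est l0 b t (S.hist ξ l0 l1 t ω))) ∂P +
      ∫ ω, quadForm (SC (S.Htilde t G Gt (ξ.m0 t ω) (ξ.m1 t ω)))
        (S.state1 ξ l0 l1 t ω - S.est l0 b t (S.hist ξ l0 l1 t ω)) ∂P := by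
  have hh := hξ.measurable_hist hm.toMeasurableStrategies ht
  have hc : Measurable fun ω => ((S.hist ξ l0 l1 t ω).m0, (S.hist ξ l0 l1 t ω).zt) :=
    (Hist.measurable_m0.comp hh).prodMk (Hist.measurable_zt.comp hh)
  rw [← hA.integral_postValue hξ hm ht, hA.integral_quadForm_SC_Htilde hξ hm hpos ht]
  exact integral_add (integrable_quadForm_switch hc (fun k => S.stepP t G Gt k.1 k.2)
      (memLp_sumElim hA.memLp_state0 (hA.memLp_est hξ ht)))
    (integrable_quadForm_switch hc (fun k => S.stepPt t G Gt k.1 k.2)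
      (hA.memLp_state1.sub (hA.memLp_est hξ ht)))

end StateMean

namespace ConditionalMeans

variable [IsProbabilityMeasure P]

lemma integral_priorValue_step_le (hM : S.ConditionalMeans P ξ l0 l1 b t)
    (hξ : S.Realizes P T ξ) (hS : S.Standing T) (hm : MeasurableMeans l0 l1 b T)
    (hpos : ∀ m : d.M1, 0 < S.π1 m) (ht : t ≤ T) {G : PFam d} {Gt : PtFam d}
    (hG : ∀ m0 z, (G m0 z).PosSemidef) (hGt : ∀ m0 z, (Gt m0 z).PosSemidef) :
    ∫ ω, S.priorValue ξ l0 l1 b (S.stepP t G Gt) (S.stepPt t G Gt) t ω ∂P +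
      S.noiseCost ξ G Gt t P ≤
    ∫ ω, S.stageCost ξ l0 l1 t ω ∂P + ∫ ω, S.priorValue ξ l0 l1 b G Gt (t + 1) ω ∂P := by
  have hh := hξ.measurable_hist hm.toMeasurableStrategies ht
  have hc : Measurable fun ω => ((S.hist ξ l0 l1 t ω).m0, (S.hist ξ l0 l1 t ω).zt) :=
    (Hist.measurable_m0.comp hh).prodMk (Hist.measurable_zt.comp hh)
  have hmodes : Measurable fun ω => (ξ.m0 t ω, ξ.m1 t ω) :=
    (hξ.measurable_m0 ht).prodMk (hξ.measurable_m1 ht)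
  have hest := hM.memLp_est hξ ht
  rw [hM.integral_stageCost_add_priorValue_succ hξ hS hm hpos ht,
    hM.integral_priorValue_step hξ hm hpos ht]
  refine add_le_add_left (add_le_add ?_ ?_) _
  · exact integral_mono
      (integrable_quadForm_switch hc (fun k => S.stepP t G Gt k.1 k.2)
        (memLp_sumElim hM.memLp_state0 hest))
      (hM.integral_meanValue hξ hm hpos ht G Gt).1
      fun ω => quadForm_stepP_le_meanValue l0 b G Gt t hS hpos hξ.sum_π1 ht hG hGt _
  · exact integral_mono
      (integrable_quadForm_switch hmodes (fun k => SC (S.Htilde t G Gt k.1 k.2))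
        (hM.memLp_state1.sub hest))
      (integrable_quadForm_switch hmodes (fun k => S.Htilde t G Gt k.1 k.2) (hM.memLp_dev hξ ht))
      fun ω => (actionDefinite_Htilde hS ht hG hGt _ _).quadForm_SC_le _ _

lemma integral_priorValue_step_eq (hM : S.ConditionalMeans P ξ l0 l1 b t)
    (hξ : S.Realizes P T ξ) (hS : S.Standing T) (hm : MeasurableMeans l0 l1 b T)
    (hpos : ∀ m : d.M1, 0 < S.π1 m) (ht : t ≤ T) {G : PFam d} {Gt : PtFam d}
    (hG : ∀ m0 z, (G m0 z).PosSemidef) (hGt : ∀ m0 z, (Gt m0 z).PosSemidef)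
    (hmean : ∀ h : d.Hist t, S.meanValue l0 b G Gt t h =
      quadForm (S.stepP t G Gt h.m0 h.zt) (Sum.elim h.x0 (S.est l0 b t h)))
    (hdev : ∀ ω, S.action1 ξ l0 l1 t ω - b t (S.hist ξ l0 l1 t ω) (ξ.m1 t ω) =
      gain (S.Htilde t G Gt (ξ.m0 t ω) (ξ.m1 t ω)) *ᵥ
        (S.state1 ξ l0 l1 t ω - S.est l0 b t (S.hist ξ l0 l1 t ω))) :
    ∫ ω, S.priorValue ξ l0 l1 b (S.stepP t G Gt) (S.stepPt t G Gt) t ω ∂P +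
      S.noiseCost ξ G Gt t P =
    ∫ ω, S.stageCost ξ l0 l1 t ω ∂P + ∫ ω, S.priorValue ξ l0 l1 b G Gt (t + 1) ω ∂P := by
  rw [hM.integral_stageCost_add_priorValue_succ hξ hS hm hpos ht,
    hM.integral_priorValue_step hξ hm hpos ht]
  simp only [hmean, dev, hdev, (actionDefinite_Htilde hS ht hG hGt _ _).quadForm_gain]
  rfl

end ConditionalMeans

lemma optCost_le_J [IsProbabilityMeasure P] (hM : ∀ t ≤ T, S.ConditionalMeans P ξ l0 l1 b t)
    (hξ : S.Realizes P T ξ) (hS : S.Standing T) (hm : MeasurableMeans l0 l1 b T)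
    (hpos : ∀ m : d.M1, 0 < S.π1 m) : S.optCost P T ξ ≤ S.J ξ l0 l1 P T := by
  rw [J_eq_sum hM hξ, S.optCost_eq_sum P T ξ l0 l1 b]
  refine Finset.sum_le_sum fun t h => ?_
  have ht : t ≤ T := Nat.lt_succ_iff.1 (Finset.mem_range.1 h)
  obtain ⟨hP, hPt⟩ := riccati_posSemidef hS hpos hξ.sum_π1 (T + 1 - (t + 1))
  rw [sub_le_iff_le_add, Pmat_eq ht, Ptmat_eq ht]
  exact (hM t ht).integral_priorValue_step_le hξ hS hm hpos ht hP hPt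

end Transmission

end System

/-! ### The candidate strategies -/

namespace System

variable {d : Dims} (S : System d)

section Candidate

variable (T : ℕ)

/-- The matrix of the linear map `(x⁰, x̂¹) ↦ u⁰*_t`, given `m⁰` and `z̃`. -/
def uStarGain (t : ℕ) (k : d.M0 × Received d.M1) : Matrix (Fin d.u0) d.IX ℝ :=
  match k.2 with
  | Sum.inr _ => (S.Kempty T t k.1).submatrix Sum.inl id
  | Sum.inl l => (S.Kmode T t k.1 l).submatrix Sum.inl id

/-- The matrix of the linear map `(x⁰, x̂¹) ↦ q̄*_t(m¹)`, given `m⁰`, `z̃` and `m¹`. -/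
def qbarGain (t : ℕ) (k : d.M0 × Received d.M1 × d.M1) : Matrix (Fin d.u1) d.IX ℝ :=
  match k.2.1 with
  | Sum.inr _ => (S.Kempty T t k.1).submatrix (fun i => Sum.inr (k.2.2, i)) id
  | Sum.inl l => if k.2.2 = l then (S.Kmode T t k.1 l).submatrix Sum.inr id else 0

/-- The conditional mean of the action of the local controller under the candidate strategies. -/
def optMeanAction : MeanAction d := fun t h m => S.qbar T t h.m0 h.zt h.x0 (S.xhat T t h) m

lemma optStrategy0_eq_mulVec (t : ℕ) (h : d.Hist t) : S.optStrategy0 T t h =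
    S.uStarGain T t (h.m0, h.zt) *ᵥ Sum.elim h.x0 (S.xhat T t h) := by
  unfold optStrategy0
  cases h.zt <;> rfl

lemma optMeanAction_eq_mulVec (t : ℕ) (h : d.Hist t) (m : d.M1) : S.optMeanAction T t h m =
    S.qbarGain T t (h.m0, h.zt, m) *ᵥ Sum.elim h.x0 (S.xhat T t h) := by
  unfold optMeanAction
  rcases h.zt with l | _
  · by_cases hm : m = l
    · simp only [qbar, qbarGain, hm, if_true]
      rfl
    · simp only [qbar, qbarGain, hm, if_false, Matrix.zero_mulVec]
  · rfl

lemma xhat_succ (t : ℕ) (h : d.Hist (t + 1)) : S.xhat T (t + 1) h = Sum.elim id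
    (fun _ => S.avg h.past.zt (fun m => S.D h.past.m0 m *ᵥ vec h.past.x0 (S.xhat T t h.past)
      (S.optStrategy0 T t h.past) (S.optMeanAction T t h.past m)) ∘ Sum.inr) h.z := by
  rw [xhat, avg_comp]
  cases h.z with
  | inl x => rfl
  | inr _ =>
    simp only [Sum.elim_inr]
    unfold optStrategy0 optMeanAction
    cases h.past.zt <;> rfl

lemma xhat_eq_est (t : ℕ) (h : d.Hist t) :
    S.xhat T t h = S.est (S.optStrategy0 T) (S.optMeanAction T) t h := by
  induction t with
  | zero => rw [xhat, est]; cases h.z <;> rfl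
  | succ t ih => rw [xhat_succ, est_succ, ih]; rfl

section Measurability

variable {T} {t : ℕ}

lemma measurable_optStrategy0_of_xhat (hx : Measurable (S.xhat T t)) :
    Measurable (S.optStrategy0 T t) := by
  simp only [funext fun h => S.optStrategy0_eq_mulVec T t h]
  exact measurable_switch_mulVec (Hist.measurable_m0.prodMk Hist.measurable_zt) (S.uStarGain T t)
    (measurable_sumElim Hist.measurable_x0 hx)

lemma measurable_optMeanAction_of_xhat (hx : Measurable (S.xhat T t)) :
    Measurable fun a : d.Hist t × d.M1 => S.optMeanAction T t a.1 a.2 := by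
  simp only [optMeanAction_eq_mulVec]
  exact measurable_switch_mulVec (c := fun a : d.Hist t × d.M1 => (a.1.m0, a.1.zt, a.2))
    ((Hist.measurable_m0.comp measurable_fst).prodMk
      ((Hist.measurable_zt.comp measurable_fst).prodMk measurable_snd)) (S.qbarGain T t)
    (measurable_sumElim (Hist.measurable_x0.comp measurable_fst) (hx.comp measurable_fst))

variable (T t)

lemma measurable_xhat : Measurable (S.xhat T t) := by
  induction t with
  | zero =>
    simp only [funext fun h => S.xhat_eq_est T 0 h, est]
    exact measurable_received Hist.measurable_z measurable_id measurable_const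
  | succ t ih =>
    have next_measurable (m : d.M1) : Measurable fun h : d.Hist t => S.D h.m0 m *ᵥ vec h.x0
        (S.xhat T t h) (S.optStrategy0 T t h) (S.optMeanAction T t h m) :=
      measurable_switch_mulVec Hist.measurable_m0 (fun m0 => S.D m0 m)
        (measurable_vec Hist.measurable_x0 ih (S.measurable_optStrategy0_of_xhat ih)
          ((S.measurable_optMeanAction_of_xhat ih).of_uncurry_right (y := m)))
    simp only [funext fun h => S.xhat_succ T t h]
    exact measurable_received Hist.measurable_z measurable_id (measurable_comp_index
      ((S.measurable_avg Hist.measurable_zt next_measurable).comp Hist.measurable_past) Sum.inr)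

lemma measurable_optMeanAction :
    Measurable fun a : d.Hist t × d.M1 => S.optMeanAction T t a.1 a.2 :=
  S.measurable_optMeanAction_of_xhat (S.measurable_xhat T t)

lemma measurable_optStrategy1 : Measurable (S.optStrategy1 T t) := by
  have hhist : Measurable fun a : d.Hist t × d.X1 × d.M1 => a.1 := measurable_fst
  have hm1 : Measurable fun a : d.Hist t × d.X1 × d.M1 => a.2.2 := by fun_prop
  have hdev : Measurable fun a : d.Hist t × d.X1 × d.M1 => a.2.1 - S.xhat T t a.1 :=
    (measurable_fst.comp measurable_snd).sub ((S.measurable_xhat T t).comp hhist)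
  refine ((S.measurable_optMeanAction T t).comp (hhist.prodMk hm1)).add
    (measurable_switch (f := fun k (a : d.Hist t × d.X1 × d.M1) =>
      S.qtilde T t a.1.m0 k (S.xhat T t a.1) a.2.1 a.2.2) (Hist.measurable_zt.comp hhist) ?_)
  rintro (_ | _)
  · exact measurable_const
  · exact measurable_switch_mulVec ((Hist.measurable_m0.comp hhist).prodMk hm1)
      (fun k => S.Ktilde T t k.1 k.2) hdev

lemma measurableMeans_opt :
    MeasurableMeans (S.optStrategy0 T) (S.optStrategy1 T) (S.optMeanAction T) T where
  measurable0 t _ := S.measurable_optStrategy0_of_xhat (S.measurable_xhat T t)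
  measurable1 t _ := S.measurable_optStrategy1 T t
  measurable_mean t _ _ :=
    (S.measurable_optMeanAction T t).comp (measurable_id.prodMk measurable_const)

end Measurability

end Candidate

section Optimality

variable {S} {Ω : Type*} {T t : ℕ} {ξ : Primitives d Ω}

lemma action1_sub_optMeanAction (ω : Ω) :
    S.action1 ξ (S.optStrategy0 T) (S.optStrategy1 T) t ω -
      S.optMeanAction T t (S.hist ξ (S.optStrategy0 T) (S.optStrategy1 T) t ω) (ξ.m1 t ω) =
    S.Ktilde T t (ξ.m0 t ω) (ξ.m1 t ω) *ᵥ
      (S.state1 ξ (S.optStrategy0 T) (S.optStrategy1 T) t ω -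
        S.est (S.optStrategy0 T) (S.optMeanAction T) t
          (S.hist ξ (S.optStrategy0 T) (S.optStrategy1 T) t ω)) := by
  simp only [action1, optStrategy1, optMeanAction, add_sub_cancel_left, hist_m0, hist_zt]
  cases h : ξ.γ t ω
  · simp only [channel, qtilde, xhat_eq_est]
    rfl
  · simp [channel, qtilde, est_hist, h]

variable [MeasurableSpace Ω] {P : Measure Ω}

lemma StateMean.memLp_opt (hA : S.StateMean P ξ (S.optStrategy0 T) (S.optStrategy1 T)
    (S.optMeanAction T) t) (hξ : S.Realizes P T ξ) (ht : t ≤ T) :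
    MemLp (S.action0 ξ (S.optStrategy0 T) (S.optStrategy1 T) t) 2 P ∧
    MemLp (fun ω => S.optMeanAction T t
      (S.hist ξ (S.optStrategy0 T) (S.optStrategy1 T) t ω) (ξ.m1 t ω)) 2 P := by
  have hh := hξ.measurable_hist (S.measurableMeans_opt T).toMeasurableStrategies ht
  have hm0 := Hist.measurable_m0.comp hh
  have hzt := Hist.measurable_zt.comp hh
  have hx := memLp_sumElim hA.memLp_state0 (hA.memLp_est hξ ht)
  simp only [← xhat_eq_est] at hx
  constructor
  · simp only [funext fun ω => show S.action0 ξ (S.optStrategy0 T) (S.optStrategy1 T) t ω = _ from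
      S.optStrategy0_eq_mulVec T t _]
    exact memLp_switch_mulVec (hm0.prodMk hzt) (S.uStarGain T t) hx
  · simp only [optMeanAction_eq_mulVec]
    exact memLp_switch_mulVec (hm0.prodMk (hzt.prodMk (hξ.measurable_m1 ht))) (S.qbarGain T t) hx

lemma actionMean_opt [IsFiniteMeasure P] (hA : S.StateMean P ξ (S.optStrategy0 T)
    (S.optStrategy1 T) (S.optMeanAction T) t) (hξ : S.Realizes P T ξ) (ht : t ≤ T) :
    S.ActionMean P ξ (S.optStrategy0 T) (S.optStrategy1 T) (S.optMeanAction T) t := by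
  have hl := (S.measurableMeans_opt T).toMeasurableStrategies
  have hh := hξ.measurable_hist hl ht
  have dev_memLp := hA.memLp_state1.sub (hA.memLp_est hξ ht)
  have dev_centered := (hA.centered_hist hξ hl ht).switch_mulVec
    (hh.prodMk (hξ.measurable_m1 ht)) (c := fun a : d.Hist t × d.M1 => (a.1.m0, a.2))
    ((Hist.measurable_m0.comp measurable_fst).prodMk measurable_snd)
    (dev_memLp.integrable one_le_two) (fun k => S.Ktilde T t k.1 k.2)
  obtain ⟨hu, hb⟩ := hA.memLp_opt hξ ht
  have action1_memLp := hb.add (memLp_switch_mulVec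
    ((hξ.measurable_m0 ht).prodMk (hξ.measurable_m1 ht)) (fun k => S.Ktilde T t k.1 k.2)
    dev_memLp)
  refine ⟨hu, action1_memLp.ae_eq (.of_forall fun ω => ?_), hb, ?_⟩
  · exact add_eq_of_eq_sub' (action1_sub_optMeanAction ω).symm
  · simp only [hist_m0, ← action1_sub_optMeanAction] at dev_centered
    exact dev_centered

lemma meanValue_opt (hS : S.Standing T) (hpos : ∀ m : d.M1, 0 < S.π1 m)
    (hπ : ∑ m, S.π1 m = 1) (ht : t ≤ T) (h : d.Hist t) :
    S.meanValue (S.optStrategy0 T) (S.optMeanAction T) (S.Pmat T (t + 1)) (S.Ptmat T (t + 1)) t h =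
      quadForm (S.stepP t (S.Pmat T (t + 1)) (S.Ptmat T (t + 1)) h.m0 h.zt)
        (Sum.elim h.x0 (S.est (S.optStrategy0 T) (S.optMeanAction T) t h)) := by
  obtain ⟨hP, hPt⟩ := riccati_posSemidef hS hpos hπ (T + 1 - (t + 1))
  have hb : S.optMeanAction T t h = S.qbar T t h.m0 h.zt h.x0 (S.xhat T t h) := rfl
  simp only [meanValue, zbar, ← xhat_eq_est, optStrategy0, hb]
  cases h.zt with
  | inl l =>
    have hv : vec h.x0 (S.xhat T t h) (S.uStar T t h.m0 (Sum.inl l) h.x0 (S.xhat T t h))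
        (S.qbar T t h.m0 (Sum.inl l) h.x0 (S.xhat T t h) l) =
        Sum.elim (Sum.elim h.x0 (S.xhat T t h))
          (S.Kmode T t h.m0 l *ᵥ Sum.elim h.x0 (S.xhat T t h)) := by
      ext i
      rcases i with i | (i | i) <;> simp [vec, uStar, qbar]
    simp only [hv]
    exact (actionDefinite_Hmode hS ht hP h.m0 l).quadForm_gain _
  | inr _ =>
    have hv : aug (Sum.elim h.x0 (S.xhat T t h))
        (S.uStar T t h.m0 (Sum.inr ()) h.x0 (S.xhat T t h))
        (S.qbar T t h.m0 (Sum.inr ()) h.x0 (S.xhat T t h)) =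
        Sum.elim (Sum.elim h.x0 (S.xhat T t h))
          (S.Kempty T t h.m0 *ᵥ Sum.elim h.x0 (S.xhat T t h)) := by
      ext i
      rcases i with i | (i | i) <;> simp [aug, uStar, qbar]
    simp only [hv]
    exact (actionDefinite_Hempty hS hpos hπ ht hP hPt h.m0).quadForm_gain _

variable [IsProbabilityMeasure P]

lemma conditionalMeans_of_actionMean {l0 : Strategy0 d} {l1 : Strategy1 d} {b : MeanAction d}
    (hξ : S.Realizes P T ξ) (hS : S.Standing T) (hm : MeasurableMeans l0 l1 b T)
    (hpos : ∀ m : d.M1, 0 < S.π1 m)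
    (h : ∀ t ≤ T, S.StateMean P ξ l0 l1 b t → S.ActionMean P ξ l0 l1 b t) (ht : t ≤ T) :
    S.ConditionalMeans P ξ l0 l1 b t := by
  have hA : S.StateMean P ξ l0 l1 b t := by
    induction t with
    | zero => exact .zero hξ hS
    | succ t ih =>
      have ht' : t ≤ T := Nat.le_of_succ_le ht
      exact ConditionalMeans.stateMean_succ ⟨ih ht', h t ht' (ih ht')⟩ hξ hS hm hpos ht
  exact ⟨hA, h t ht hA⟩

lemma conditionalMeans_opt (hξ : S.Realizes P T ξ) (hS : S.Standing T)
    (hpos : ∀ m : d.M1, 0 < S.π1 m) (ht : t ≤ T) :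
    S.ConditionalMeans P ξ (S.optStrategy0 T) (S.optStrategy1 T) (S.optMeanAction T) t :=
  conditionalMeans_of_actionMean hξ hS (S.measurableMeans_opt T) hpos
    (fun _ hs hA => actionMean_opt hA hξ hs) ht

lemma feasible_opt (hξ : S.Realizes P T ξ) (hS : S.Standing T) (hpos : ∀ m : d.M1, 0 < S.π1 m) :
    S.Feasible ξ (S.optStrategy0 T) (S.optStrategy1 T) P T where
  measurable0 := (S.measurableMeans_opt T).measurable0
  measurable1 := (S.measurableMeans_opt T).measurable1
  state0_sq _ ht := (conditionalMeans_opt hξ hS hpos ht).memLp_state0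
  state1_sq _ ht := (conditionalMeans_opt hξ hS hpos ht).memLp_state1
  action0_sq _ ht := (conditionalMeans_opt hξ hS hpos ht).memLp_action0
  action1_sq _ ht := (conditionalMeans_opt hξ hS hpos ht).memLp_action1

lemma J_opt (hξ : S.Realizes P T ξ) (hS : S.Standing T) (hpos : ∀ m : d.M1, 0 < S.π1 m) :
    S.J ξ (S.optStrategy0 T) (S.optStrategy1 T) P T = S.optCost P T ξ := by
  rw [J_eq_sum (fun t ht => conditionalMeans_opt hξ hS hpos ht) hξ,
    S.optCost_eq_sum P T ξ (S.optStrategy0 T) (S.optStrategy1 T) (S.optMeanAction T)]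
  refine Finset.sum_congr rfl fun t h => ?_
  have ht : t ≤ T := Nat.lt_succ_iff.1 (Finset.mem_range.1 h)
  obtain ⟨hP, hPt⟩ := riccati_posSemidef hS hpos hξ.sum_π1 (T + 1 - (t + 1))
  rw [eq_sub_iff_add_eq, Pmat_eq ht, Ptmat_eq ht]
  exact ((conditionalMeans_opt hξ hS hpos ht).integral_priorValue_step_eq hξ hS
    (S.measurableMeans_opt T) hpos ht hP hPt (meanValue_opt hS hpos hξ.sum_π1 ht)
    action1_sub_optMeanAction).symm

lemma Feasible.exists_meanAction {k0 : Strategy0 d} {k1 : Strategy1 d}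
    (hk : S.Feasible ξ k0 k1 P T) (hξ : S.Realizes P T ξ) :
    ∃ b : MeanAction d, MeasurableMeans k0 k1 b T ∧ ∀ t ≤ T, S.ActionMean P ξ k0 k1 b t := by
  have hl : MeasurableStrategies k0 k1 T := ⟨hk.measurable0, hk.measurable1⟩
  have exists_mean (t : ℕ) : ∃ b : d.Hist t × d.M1 → d.U1, t ≤ T → Measurable b ∧
      MemLp (fun ω => b (S.hist ξ k0 k1 t ω, ξ.m1 t ω)) 2 P ∧
      CondCentered (fun ω => (S.hist ξ k0 k1 t ω, ξ.m1 t ω))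
        (fun ω => S.action1 ξ k0 k1 t ω - b (S.hist ξ k0 k1 t ω, ξ.m1 t ω)) P := by
    by_cases ht : t ≤ T
    · obtain ⟨b, hb⟩ := exists_condMean
        ((hξ.measurable_hist hl ht).prodMk (hξ.measurable_m1 ht)) (hk.action1_sq t ht)
      exact ⟨b, fun _ => hb⟩
    · exact ⟨0, fun h => absurd h ht⟩
  choose b hb using exists_mean
  refine ⟨fun t h m => b t (h, m), ⟨hl, fun t ht m => ?_⟩, fun t ht => ?_⟩
  · exact (hb t ht).1.comp (measurable_id.prodMk measurable_const)
  · exact ⟨hk.action0_sq t ht, hk.action1_sq t ht, (hb t ht).2.1, (hb t ht).2.2⟩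

lemma Feasible.optCost_le_J {k0 : Strategy0 d} {k1 : Strategy1 d}
    (hk : S.Feasible ξ k0 k1 P T) (hξ : S.Realizes P T ξ) (hS : S.Standing T)
    (hpos : ∀ m : d.M1, 0 < S.π1 m) : S.optCost P T ξ ≤ S.J ξ k0 k1 P T := by
  obtain ⟨b, hm, hb⟩ := hk.exists_meanAction hξ
  exact System.optCost_le_J (fun t ht =>
    conditionalMeans_of_actionMean hξ hS hm hpos (fun s hs _ => hb s hs) ht) hξ hS hm hpos

lemma isOptimal_opt (hξ : S.Realizes P T ξ) (hS : S.Standing T)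
    (hpos : ∀ m : d.M1, 0 < S.π1 m) :
    S.IsOptimal ξ (S.optStrategy0 T) (S.optStrategy1 T) P T :=
  ⟨feasible_opt hξ hS hpos, fun _ _ hk =>
    (J_opt hξ hS hpos).trans_le (hk.optCost_le_J hξ hS hpos)⟩

lemma condExp_state1_opt (hξ : S.Realizes P T ξ) (hS : S.Standing T)
    (hpos : ∀ m : d.M1, 0 < S.π1 m) (ht : t ≤ T) :
    P[S.state1 ξ (S.optStrategy0 T) (S.optStrategy1 T) t |
        MeasurableSpace.comap (S.hist ξ (S.optStrategy0 T) (S.optStrategy1 T) t) inferInstance]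
      =ᵐ[P] fun ω => S.xhat T t (S.hist ξ (S.optStrategy0 T) (S.optStrategy1 T) t ω) := by
  have hM := conditionalMeans_opt hξ hS hpos ht
  have hm := S.measurableMeans_opt T
  have hl := hm.toMeasurableStrategies
  have hh := hξ.measurable_hist hl ht
  simp only [xhat_eq_est]
  exact condExp_eq_of_condCentered_sub hh (hM.memLp_state1.integrable one_le_two)
    (S.measurable_est hm ht) ((hM.memLp_est hξ ht).integrable one_le_two)
    ((hM.centered_hist hξ hl ht).comp (hh.prodMk (hξ.measurable_m1 ht)) measurable_fst)

lemma integral_belief_opt (hξ : S.Realizes P T ξ) (hS : S.Standing T)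
    (hpos : ∀ m : d.M1, 0 < S.π1 m) (ht : t ≤ T) :
    ∀ᵐ ω ∂P, ∫ x, x ∂(S.belief P ξ (S.optStrategy0 T) (S.optStrategy1 T) t
        (S.hist ξ (S.optStrategy0 T) (S.optStrategy1 T) t ω)) =
      S.xhat T t (S.hist ξ (S.optStrategy0 T) (S.optStrategy1 T) t ω) := by
  have hh := hξ.measurable_hist (S.measurableMeans_opt T).toMeasurableStrategies ht
  have hx := (conditionalMeans_opt hξ hS hpos ht).memLp_state1.integrable one_le_two
  exact (condExp_ae_eq_integral_condDistrib' hh hx).symm.trans (condExp_state1_opt hξ hS hpos ht)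

end Optimality

end System

end NCS

end

theorem theorem4 {d : NCS.Dims} (S : NCS.System d) (T : ℕ) (hS : S.Standing T)
    (hpos : ∀ m : d.M1, 0 < S.π1 m)
    {Ω : Type*} [MeasurableSpace Ω] (P : MeasureTheory.Measure Ω)
    [MeasureTheory.IsProbabilityMeasure P]
    (ξ : NCS.Primitives d Ω) (hξ : S.Realizes P T ξ) :
    S.IsOptimal ξ (S.optStrategy0 T) (S.optStrategy1 T) P T ∧
    ∀ t ≤ T,
      (∀ᵐ ω ∂P,
        ∫ x, x ∂(S.belief P ξ (S.optStrategy0 T) (S.optStrategy1 T) t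
            (S.hist ξ (S.optStrategy0 T) (S.optStrategy1 T) t ω)) =
          S.xhat T t (S.hist ξ (S.optStrategy0 T) (S.optStrategy1 T) t ω)) ∧
      P[S.state1 ξ (S.optStrategy0 T) (S.optStrategy1 T) t |
          MeasurableSpace.comap (S.hist ξ (S.optStrategy0 T) (S.optStrategy1 T) t) inferInstance]
        =ᵐ[P] fun ω => S.xhat T t (S.hist ξ (S.optStrategy0 T) (S.optStrategy1 T) t ω) :=
  ⟨NCS.System.isOptimal_opt hξ hS hpos, fun _ ht =>
    ⟨NCS.System.integral_belief_opt hξ hS hpos ht,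
      NCS.System.condExp_state1_opt hξ hS hpos ht⟩⟩
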